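/- **Theorem (extended Paley–Wiener theorem).** Let $n\ge 0$ be an integer, $\mathbb R^+=(0,\infty)$, $\mathbb C^+=\{z\in\mathbb C:\Im z>0\}$. *Notation.* Let $L^2(t^n)$ be the space of measurable $\varphi:\mathbb R^+\to\mathbb C$ with $\int_0^\infty|t^n\varphi(t)|^2\,dt<\infty$. Put $W^{0}\varphi=\varphi$ and, for $n\ge1$, $W^{-n}\varphi(t)=\frac1{(n-1)!}\int_t^\infty(s-t)^{n-1}\varphi(s)\,ds$ for $t>0$. Let $\mathcal T_2^{(n)}=W^{-n}(L^2(t^n))$ (functions equal almost everywhere being identified). Let $H_2=H_2(\mathbb C^+)$ be the space of holomorphic $F$ on $\mathbb C^+$ with $\|F\|_{H_2}=\sup_{y>0}\big(\frac1{2\pi}\int_{-\infty}^\infty|F(x+iy)|^2dx\big)^{1/2}<\infty$, with inner product $\langle F,G\rangle_{H_2}=\frac1{2\pi}\int_{-\infty}^\infty F^*(x)\overline{G^*(x)}\,dx$, where $F^*(x)=\lim_{y\to0^+}F(x+iy)$ for a.e. $x\in\mathbb R$. Let $H_2^{(n)}$ be the space of holomorphic $F$ on $\mathbb C^+$ with $z^kF^{(k)}\in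 H_2$ for $k=0,\dots,n$. Let $\mathcal F(f)(z)=\int_0^\infty f(t)e^{itz}\,dt$ for $f\in L^2(\mathbb R^+)$, $z\in\mathbb C^+$. *Statement.* 1. $\mathcal T_2^{(n)}\subseteq L^2(\mathbb R^+)$. If $f=W^{-n}\varphi$ with $\varphi\in L^2(t^n)$, then the $n$-th derivative $f^{(n)}$ of the function $W^{-n}\varphi$ exists a.e. on $\mathbb R^+$ and belongs to $L^2(t^n)$. With $$\langle f,g\rangle_{\mathcal T_2^{(n)}}=\int_0^\infty f^{(n)}(t)\,\overline{g^{(n)}(t)}\,t^{2n}\,dt$$ the space $\mathcal T_2^{(n)}$ is a Hilbert space. 2. $\mathcal F(\mathcal T_2^{(n)})=H_2^{(n)}$. 3. For $F\in H_2^{(n)}$ the boundary function $F^*$ exists a.e. on $\mathbb R$ and is $n$ times differentiable at a.e. $x\in\mathbb R$; $x^n(F^*)^{(n)}(x)$ is the boundary function of $z^nF^{(n)}$ for a.e. $x$, and it is square-integrable. With $$\langle F,G\rangle_{H_2^{(n)}}=\frac1{2\pi}\int_{-\infty}^\infty x^{2n}(F^*)^{(n)}(x)\overline{(G^*)^{(n)}(x)}\,dx=\langle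 z^nF^{(n)},z^nG^{(n)}\rangle_{H_2}$$ the space $H_2^{(n)}$ is a Hilbert space, and its norm is $\|F\|_{H_2^{(n)}}=\|z^nF^{(n)}\|_{H_2}$. 4. $\mathcal F$ is an isometric isomorphism from $\mathcal T_2^{(n)}$ onto $H_2^{(n)}$: it is a linear bijection and $\langle\mathcal F(f),\mathcal F(g)\rangle_{H_2^{(n)}}=\langle f,g\rangle_{\mathcal T_2^{(n)}}$ for all $f,g\in\mathcal T_2^{(n)}$. -/

import Mathlib

open MeasureTheory Set Filter Topology UpperHalfPlane
open scoped ComplexConjugate ENNReal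

noncomputable section

namespace PaleyWiener

/-- Lebesgue measure on `ℝ⁺ = (0, ∞)`. -/
abbrev posMeasure : Measure ℝ := volume.restrict (Ioi (0 : ℝ))

/-- `φ ∈ L²(tⁿ)`: `φ` is measurable on `(0, ∞)` and `∫₀^∞ |tⁿ φ(t)|² dt < ∞`. -/
def MemL2t (n : ℕ) (φ : ℝ → ℂ) : Prop :=
  MemLp (fun t : ℝ => (t : ℂ) ^ n * φ t) 2 posMeasure

/-- The integration operator `W⁻ⁿ`: `W⁰ φ = φ`, and for `n ≥ 1`
`W⁻ⁿ φ (t) = 1 / (n - 1)! ∫_t^∞ (s - t)ⁿ⁻¹ φ(s) ds`. -/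
def Wneg : ℕ → (ℝ → ℂ) → ℝ → ℂ
  | 0, φ, t => φ t
  | m + 1, φ, t => (Nat.factorial m : ℂ)⁻¹ * ∫ s in Ioi t, (((s - t) ^ m : ℝ) : ℂ) * φ s

theorem integrableOn_Wneg {m : ℕ} {φ : ℝ → ℂ} (hφ : MemL2t (m + 1) φ) {t : ℝ} (ht : 0 < t) :
    IntegrableOn (fun s => (((s - t) ^ m : ℝ) : ℂ) * φ s) (Ioi t) := by
  have h1 : MemLp (fun s : ℝ => (s : ℂ) ^ (m + 1) * φ s) 2 (volume.restrict (Ioi t)) :=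
    hφ.mono_measure (Measure.restrict_mono (Ioi_subset_Ioi ht.le) le_rfl)
  have h0 : MemLp (fun s : ℝ => s⁻¹) 2 (volume.restrict (Ioi t)) := by
    rw [memLp_two_iff_integrable_sq (by fun_prop)]
    have h := integrableOn_Ioi_rpow_of_lt (a := -2) (by norm_num) ht
    refine h.congr_fun (fun s hs => ?_) measurableSet_Ioi
    have hs0 : 0 < s := ht.trans hs
    simp only
    rw [Real.rpow_neg hs0.le, inv_pow]
    norm_num
  have h2 : MemLp (fun s : ℝ => (((s - t) ^ m / s ^ (m + 1) : ℝ) : ℂ)) 2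
      (volume.restrict (Ioi t)) := by
    have hm : Measurable fun s : ℝ => (((s - t) ^ m / s ^ (m + 1) : ℝ) : ℂ) := by fun_prop
    refine h0.mono hm.aestronglyMeasurable ?_
    refine (ae_restrict_iff' measurableSet_Ioi).2 (Eventually.of_forall fun s hs => ?_)
    have hs' : t < s := hs
    have hs0 : 0 < s := ht.trans hs'
    rw [Complex.norm_real, Real.norm_of_nonneg (by have := sub_pos.2 hs'; positivity),
      Real.norm_of_nonneg (by positivity), div_le_iff₀ (by positivity), pow_succ]
    have : (s - t) ^ m ≤ s ^ m := pow_le_pow_left₀ (by linarith) (by linarith) m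
    calc (s - t) ^ m ≤ s ^ m := this
      _ = s⁻¹ * (s ^ m * s) := by field_simp
  refine (h2.integrable_mul h1).congr ?_
  refine (ae_restrict_iff' measurableSet_Ioi).2 (Eventually.of_forall fun s hs => ?_)
  have hs0 : (s : ℂ) ≠ 0 := by exact_mod_cast (ht.trans hs).ne'
  simp only [Pi.mul_apply]
  push_cast
  field_simp

theorem Wneg_add {n : ℕ} {φ ψ : ℝ → ℂ} (hφ : MemL2t n φ) (hψ : MemL2t n ψ) {t : ℝ}
    (ht : 0 < t) : Wneg n (φ + ψ) t = Wneg n φ t + Wneg n ψ t := by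
  cases n with
  | zero => rfl
  | succ m =>
    simp only [Wneg, Pi.add_apply, mul_add]
    rw [integral_add (integrableOn_Wneg hφ ht) (integrableOn_Wneg hψ ht), mul_add]

theorem Wneg_smul (n : ℕ) (c : ℂ) (φ : ℝ → ℂ) (t : ℝ) :
    Wneg n (c • φ) t = c * Wneg n φ t := by
  cases n with
  | zero => rfl
  | succ m =>
    simp only [Wneg, Pi.smul_apply, smul_eq_mul]
    simp_rw [mul_left_comm _ c, integral_const_mul]
    ring

/-- The space `𝒯₂⁽ⁿ⁾ = W⁻ⁿ(L²(tⁿ))`, as a linear subspace of `L²(ℝ⁺)`. -/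
def T2 (n : ℕ) : Submodule ℂ (Lp ℂ 2 posMeasure) where
  carrier := {f | ∃ φ : ℝ → ℂ, MemL2t n φ ∧ f =ᵐ[posMeasure] Wneg n φ}
  zero_mem' := by
    refine ⟨0, by simp [MemL2t], ?_⟩
    filter_upwards [Lp.coeFn_zero ℂ 2 posMeasure] with t ht
    rw [ht]
    cases n <;> simp [Wneg]
  add_mem' := by
    rintro f g ⟨φ, hφ, hf⟩ ⟨ψ, hψ, hg⟩
    refine ⟨φ + ψ, ?_, ?_⟩
    · simpa only [MemL2t, Pi.add_apply, mul_add] using! hφ.add hψ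
    · filter_upwards [Lp.coeFn_add f g, hf, hg, ae_restrict_mem measurableSet_Ioi]
        with t h h1 h2 ht
      rw [h, Pi.add_apply, h1, h2, Wneg_add hφ hψ ht]
  smul_mem' := by
    rintro c f ⟨φ, hφ, hf⟩
    refine ⟨c • φ, ?_, ?_⟩
    · simpa only [MemL2t, Pi.smul_apply, smul_eq_mul, mul_left_comm _ c] using! hφ.const_mul c
    · filter_upwards [Lp.coeFn_smul c f, hf] with t h h1
      rw [h, Pi.smul_apply, h1, Wneg_smul, smul_eq_mul]

/-- `∫₀^∞ u⁽ⁿ⁾(t) conj(v⁽ⁿ⁾(t)) t²ⁿ dt` (only the values of `u`, `v` on `(0, ∞)` matter). -/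
def innerT (n : ℕ) (u v : ℝ → ℂ) : ℂ :=
  ∫ t in Ioi (0 : ℝ), iteratedDeriv n u t * conj (iteratedDeriv n v t) * (t : ℂ) ^ (2 * n)

/-- The holomorphic Fourier transform `𝓕 f (z) = ∫₀^∞ f(t) e^{itz} dt`, `z ∈ ℂ⁺`. -/
def holFourier (f : ℝ → ℂ) (z : ℍ) : ℂ :=
  ∫ t in Ioi (0 : ℝ), f t * Complex.exp (Complex.I * t * z)

/-- `sup_{y > 0} ∫ |F(x + iy)|² dx`, as an extended nonnegative number. -/
def hardySup (F : ℂ → ℂ) : ℝ≥0∞ :=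
  ⨆ (y : ℝ) (_ : 0 < y), ∫⁻ x : ℝ, ‖F (x + y * Complex.I)‖ₑ ^ 2

/-- Membership in the Hardy space `H₂(ℂ⁺)`
(only the values of `F` on the open upper half-plane matter). -/
def MemH2 (F : ℂ → ℂ) : Prop :=
  DifferentiableOn ℂ F upperHalfPlaneSet ∧ hardySup F < ∞

/-- The norm of `H₂(ℂ⁺)`: `sup_{y > 0} (1 / 2π ∫ |F(x + iy)|² dx)^{1/2}`. -/
def normH2 (F : ℂ → ℂ) : ℝ :=
  √((2 * Real.pi)⁻¹ * (hardySup F).toReal)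

/-- The boundary function `F*(x) = lim_{y → 0⁺} F(x + iy)`. -/
def bdry (F : ℂ → ℂ) (x : ℝ) : ℂ :=
  limUnder (𝓝[>] (0 : ℝ)) fun y : ℝ => F (x + y * Complex.I)

/-- The inner product of `H₂(ℂ⁺)`: `1 / 2π ∫ F*(x) conj(G*(x)) dx`. -/
def innerH2 (F G : ℂ → ℂ) : ℂ :=
  ((2 * Real.pi : ℝ) : ℂ)⁻¹ * ∫ x : ℝ, bdry F x * conj (bdry G x)

/-- For `F` on `ℂ⁺`, the function `z ↦ zᵏ F⁽ᵏ⁾(z)`. The extension of `F` to `ℂ` by `ofComplex`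
is irrelevant, since only values at points of `ℂ⁺` are used. -/
def zDeriv (k : ℕ) (F : ℍ → ℂ) (z : ℂ) : ℂ :=
  z ^ k * iteratedDeriv k (F ∘ ofComplex) z

theorem MemH2.congr {F G : ℂ → ℂ} (hF : MemH2 F) (h : EqOn G F upperHalfPlaneSet) :
    MemH2 G := by
  refine ⟨hF.1.congr h, ?_⟩
  have : hardySup G = hardySup F := by
    unfold hardySup
    refine iSup_congr fun y => iSup_congr fun hy => lintegral_congr fun x => ?_
    rw [h (show (x + y * Complex.I : ℂ) ∈ upperHalfPlaneSet by
      simpa [upperHalfPlaneSet] using hy)]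
  rw [this]
  exact hF.2

theorem MemH2.add {F G : ℂ → ℂ} (hF : MemH2 F) (hG : MemH2 G) : MemH2 (F + G) := by
  refine ⟨hF.1.add hG.1, ?_⟩
  have hle : hardySup (F + G) ≤ 2 * hardySup F + 2 * hardySup G := by
    refine iSup₂_le fun y hy => ?_
    have hm : Measurable fun x : ℝ => ‖F (x + y * Complex.I)‖ₑ ^ 2 := by
      have hc : Continuous fun x : ℝ => F (x + y * Complex.I) :=
        hF.1.continuousOn.comp_continuous (by fun_prop) fun x => by
          simpa [upperHalfPlaneSet] using hy
      exact hc.measurable.enorm.pow_const 2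
    calc ∫⁻ x : ℝ, ‖(F + G) (x + y * Complex.I)‖ₑ ^ 2
        ≤ ∫⁻ x : ℝ, (2 * ‖F (x + y * Complex.I)‖ₑ ^ 2 + 2 * ‖G (x + y * Complex.I)‖ₑ ^ 2) := by
          refine lintegral_mono fun x => ?_
          have h1 := enorm_add_le (F (x + y * Complex.I)) (G (x + y * Complex.I))
          have h2 := ENNReal.rpow_add_le_mul_rpow_add_rpow ‖F (x + y * Complex.I)‖ₑ
            ‖G (x + y * Complex.I)‖ₑ (p := 2) (by norm_num)
          norm_num at h2
          rw [mul_add] at h2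
          exact (pow_le_pow_left' h1 2).trans h2
      _ = 2 * (∫⁻ x : ℝ, ‖F (x + y * Complex.I)‖ₑ ^ 2)
          + 2 * ∫⁻ x : ℝ, ‖G (x + y * Complex.I)‖ₑ ^ 2 := by
          rw [lintegral_add_left (hm.const_mul 2), lintegral_const_mul' _ _ (by norm_num),
            lintegral_const_mul' _ _ (by norm_num)]
      _ ≤ 2 * hardySup F + 2 * hardySup G := by
          gcongr
          · exact le_iSup₂ (f := fun (y : ℝ) (_ : 0 < y) =>
              ∫⁻ x : ℝ, ‖F (x + y * Complex.I)‖ₑ ^ 2) y hy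
          · exact le_iSup₂ (f := fun (y : ℝ) (_ : 0 < y) =>
              ∫⁻ x : ℝ, ‖G (x + y * Complex.I)‖ₑ ^ 2) y hy
  exact hle.trans_lt (ENNReal.add_lt_top.2
    ⟨ENNReal.mul_lt_top (by norm_num) hF.2, ENNReal.mul_lt_top (by norm_num) hG.2⟩)

theorem MemH2.const_smul {F : ℂ → ℂ} (hF : MemH2 F) (c : ℂ) : MemH2 (c • F) := by
  refine ⟨hF.1.const_smul c, ?_⟩
  have hle : hardySup (c • F) ≤ ‖c‖ₑ ^ 2 * hardySup F := by
    refine iSup₂_le fun y hy => ?_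
    simp only [Pi.smul_apply, smul_eq_mul, enorm_mul, mul_pow]
    rw [lintegral_const_mul' _ _ (by simp)]
    gcongr
    exact le_iSup₂ (f := fun (y : ℝ) (_ : 0 < y) =>
      ∫⁻ x : ℝ, ‖F (x + y * Complex.I)‖ₑ ^ 2) y hy
  exact hle.trans_lt (ENNReal.mul_lt_top (by simp) hF.2)

theorem contDiffAt_of_memH2 {F : ℍ → ℂ} (hF : MemH2 (zDeriv 0 F)) (k : ℕ) {z : ℂ}
    (hz : z ∈ upperHalfPlaneSet) : ContDiffAt ℂ k (F ∘ ofComplex) z := by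
  have h : DifferentiableOn ℂ (F ∘ ofComplex) upperHalfPlaneSet :=
    hF.1.congr fun w _ => by simp [zDeriv]
  exact (h.analyticAt (isOpen_upperHalfPlaneSet.mem_nhds hz)).contDiffAt

/-- The Hardy–Sobolev space `H₂⁽ⁿ⁾(ℂ⁺)`: the functions `F` on `ℂ⁺` with `zᵏ F⁽ᵏ⁾ ∈ H₂(ℂ⁺)` for
`k = 0, …, n`; for `k = 0` this includes that `F` is holomorphic. -/
def HS (n : ℕ) : Submodule ℂ (ℍ → ℂ) where
  carrier := {F | ∀ k ≤ n, MemH2 (zDeriv k F)}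
  zero_mem' := by
    intro k _
    have h : zDeriv k 0 = 0 := by
      have : ((0 : ℍ → ℂ) ∘ ofComplex) = fun _ => (0 : ℂ) := rfl
      funext z
      simp [zDeriv, this]
    rw [h]
    exact ⟨differentiableOn_const 0, by simp [hardySup]⟩
  add_mem' := by
    intro F G hF hG k hk
    refine ((hF k hk).add (hG k hk)).congr fun z hz => ?_
    have := iteratedDeriv_add (n := k) (contDiffAt_of_memH2 (hF 0 n.zero_le) k hz)
      (contDiffAt_of_memH2 (hG 0 n.zero_le) k hz)
    have he : (F + G) ∘ ofComplex = F ∘ ofComplex + G ∘ ofComplex := rfl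
    simp only [zDeriv, Pi.add_apply]
    rw [he, this, mul_add]
  smul_mem' := by
    intro c F hF k hk
    refine ((hF k hk).const_smul c).congr fun z hz => ?_
    have he : (c • F) ∘ ofComplex = c • (F ∘ ofComplex) := rfl
    simp only [zDeriv, Pi.smul_apply, smul_eq_mul]
    rw [he, iteratedDeriv_const_smul (contDiffAt_of_memH2 (hF 0 n.zero_le) k hz) c, smul_eq_mul]
    ring

/-- `1 / 2π ∫ x²ⁿ (F*)⁽ⁿ⁾(x) conj((G*)⁽ⁿ⁾(x)) dx`. -/
def innerHS (n : ℕ) (F G : ℍ → ℂ) : ℂ :=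
  ((2 * Real.pi : ℝ) : ℂ)⁻¹ * ∫ x : ℝ, (x : ℂ) ^ (2 * n) *
    iteratedDeriv n (bdry (F ∘ ofComplex)) x * conj (iteratedDeriv n (bdry (G ∘ ofComplex)) x)

end PaleyWiener

end

open PaleyWiener

/-!
The theorem is a Paley–Wiener theorem with weights, and everything is transported to the one
Hilbert space `L²(ℝ⁺)` (`L2pos`), where the two spaces are ranges of the same operator.

On `ℝ⁺`, let `R_j = (j - t d/dt)⁻¹`, that is, `R_j g (t) = tʲ ∫_t^∞ s^{-j-1} g(s) ds`. It is bounded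
on `L²(ℝ⁺)` by Hardy's inequality (`memLp_hardyFun`). Since `W⁻ⁿ` is the `n`-th power of the tail
integral, `W⁻ⁿ φ = R_0 ⋯ R_{n-1} (tⁿ φ)` (`Wneg_ae_eq`), so `𝒯₂⁽ⁿ⁾` is the range of the injective
operator `R_0 ⋯ R_{n-1}` (`mem_T2_iff`). Differentiating the iterated tail integrals,
`(W⁻ⁿ φ)⁽ⁿ⁾ = (-1)ⁿ φ` almost everywhere (`iteratedDeriv_Wneg`), so the inner product of `𝒯₂⁽ⁿ⁾` is
that of the functions `g = tⁿ φ` in `L²(ℝ⁺)`.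

Under the Fourier transform, `f = R_j g` becomes `z F' + (j + 1) F = G` (`hF_hardyFun`), and this
equation determines `F` in the Hardy space (`Euler.unique`). By the classical Paley–Wiener theorem
(`MemH2.exists_hF_eq`), `H₂` is the Fourier transform of `L²(ℝ⁺)`. If `zᵏ F⁽ᵏ⁾ ∈ H₂` for `k ≤ n`,
then `z F' + F`, `(z d/dz + 2) (z d/dz + 1) F`, … lie in `H₂`, and inverting one Euler operator at a
time shows that `F` is the Fourier transform of an element of the range of `R_0 ⋯ R_{n-1}`
(`mem_HS_iff`). Moreover `zⁿ dⁿ/dzⁿ = ∏_{i<n} (z d/dz - i)` turns `R_0 ⋯ R_{n-1}` into the product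
of the operators `-(i + 1 + t d/dt) (i - t d/dt)⁻¹`. Each of these is isometric, because the adjoint
of `i - t d/dt` is `i + 1 + t d/dt` (`norm_cayleyOp`). So `‖zⁿ F⁽ⁿ⁾‖` in `H₂` is the norm of `g`,
which gives the isometry and the completeness of both spaces.

For the boundary functions, the Fourier transform of `f ∈ L²(ℝ⁺)` is the Poisson integral of its
`L²` boundary function `bd f`, and it converges at every differentiability point of the primitive of
`bd f` (`ae_tendsto_hF`), because the Poisson kernel is an average of symmetric means. The identity
`(z · zᵏ F⁽ᵏ⁾)' = (k + 1) zᵏ F⁽ᵏ⁾ + z^(k+1) F^(k+1)`, integrated over a segment parallel to the real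
axis, shows in the limit that `x` times the boundary function of `zᵏ F⁽ᵏ⁾` is a primitive
(`Euler.exists_tendsto`). This gives the derivatives of `F*` one after the other
(`ae_iteratedDeriv_bdry`).
-/

noncomputable section

namespace PaleyWiener

section Fourier

open FourierTransform

/-! ### The inverse Fourier transform on `L¹ ∩ L²` -/

theorem continuous_fourierInv {u : ℝ → ℂ} (h1 : Integrable u) : Continuous (𝓕⁻ u) :=
  VectorFourier.fourierIntegral_continuous Real.continuous_fourierChar
    (by exact (continuous_fst.inner continuous_snd).neg) h1

/-- On `L¹ ∩ L²` the inverse Fourier transform of Mathlib's `L²` theory is given by the integral.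
Both sides have the same pairings with test functions. -/
theorem fourierInv_toLp_ae_eq {u : ℝ → ℂ} (h1 : Integrable u) (h2 : MemLp u 2 volume) :
    ((𝓕⁻ (h2.toLp u) : Lp ℂ 2 (volume : Measure ℝ)) : ℝ → ℂ) =ᵐ[volume] 𝓕⁻ u := by
  refine ae_eq_of_integral_contDiff_smul_eq
    ((Lp.memLp _).locallyIntegrable (by norm_num)) (continuous_fourierInv h1).locallyIntegrable
    fun g hg hgc => ?_
  have hg' : ContDiff ℝ (⊤ : ℕ∞) (fun x => (g x : ℂ)) := Complex.ofRealCLM.contDiff.comp hg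
  have hgc' : HasCompactSupport (fun x => (g x : ℂ)) :=
    hgc.comp_left (g := fun x : ℝ => (x : ℂ)) rfl
  set ψ : SchwartzMap ℝ ℂ := hgc'.toSchwartzMap hg'
  have hψ : ∀ x, ψ x = g x := fun x => rfl
  have e1 := congrArg (fun T => T ψ) (Lp.fourierInv_toTemperedDistribution_eq (h2.toLp u))
  simp only [TemperedDistribution.fourierInv_apply, Lp.toTemperedDistribution_apply] at e1
  have e2 : ∫ x, (𝓕⁻ ψ) x • (h2.toLp u) x = ∫ x, (𝓕⁻ ψ) x • u x :=
    integral_congr_ae (h2.coeFn_toLp.mono fun x hx => by simp only [hx])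
  rw [e2] at e1
  have e3 := VectorFourier.integral_fourierIntegral_smul_eq_flip (μ := volume) (ν := volume)
    (L := -innerₗ ℝ) (e := Real.fourierChar) (f := ψ) (g := u) Real.continuous_fourierChar
    (by exact (continuous_fst.inner continuous_snd).neg) ψ.integrable h1
  have hfl : (-innerₗ ℝ).flip = -innerₗ ℝ := by
    ext; simp
  rw [hfl] at e3
  have e4 : ∀ x, (𝓕⁻ ψ) x =
      VectorFourier.fourierIntegral Real.fourierChar volume (-innerₗ ℝ) ψ x := by
    intro x
    rw [SchwartzMap.fourierInv_coe]
    rfl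
  simp only [e4] at e1
  rw [e3] at e1
  simp only [hψ] at e1
  simpa using! e1.symm

/-! ### The holomorphic Fourier transform -/

/-- The integral defining the holomorphic Fourier transform, as a function on all of `ℂ`; only its
values on the upper half-plane are meaningful. Unlike `holFourier`, it has complex derivatives. -/
def hF (f : ℝ → ℂ) (z : ℂ) : ℂ :=
  ∫ t in Ioi (0 : ℝ), f t * Complex.exp (Complex.I * t * z)

theorem holFourier_eq (f : ℝ → ℂ) (z : ℍ) : holFourier f z = hF f z := rfl

theorem hF_congr {f g : ℝ → ℂ} (h : f =ᵐ[posMeasure] g) (z : ℂ) : hF f z = hF g z :=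
  integral_congr_ae (h.mono fun t ht => by simp only [ht])

theorem norm_exp_I_mul (t : ℝ) (z : ℂ) :
    ‖Complex.exp (Complex.I * t * z)‖ = Real.exp (-(z.im * t)) := by
  rw [Complex.norm_exp]
  congr 1
  simp [mul_comm]

theorem memLp_two_exp_neg {y : ℝ} (hy : 0 < y) :
    MemLp (fun t : ℝ => Real.exp (-(y * t))) 2 posMeasure := by
  rw [memLp_two_iff_integrable_sq (by fun_prop)]
  have := integrableOn_exp_mul_Ioi (a := -(2 * y)) (by linarith) 0
  refine this.congr_fun (fun t _ => ?_) measurableSet_Ioi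
  simp only [← Real.exp_nat_mul]
  congr 1; push_cast; ring

/-- Polynomials times decaying exponentials are square integrable. -/
theorem memLp_two_pow_mul_exp (k : ℕ) {z : ℂ} (hz : 0 < z.im) :
    MemLp (fun t : ℝ => (t : ℂ) ^ k * Complex.exp (Complex.I * t * z)) 2 posMeasure := by
  have h1 := memLp_two_exp_neg (y := z.im / 2) (by linarith)
  have hb := (isLittleO_pow_exp_pos_mul_atTop k (b := z.im / 2) (by linarith)).bound
    (c := 1) one_pos
  obtain ⟨T, hT⟩ := eventually_atTop.1 hb
  have hcont : ContinuousOn (fun t : ℝ => t ^ k / Real.exp (z.im / 2 * t)) (Icc 0 (max T 0)) :=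
    (Continuous.div₀ (by fun_prop) (by fun_prop) fun t => (Real.exp_pos _).ne').continuousOn
  obtain ⟨C, hC⟩ := isCompact_Icc.exists_bound_of_continuousOn hcont
  refine h1.of_le_mul (c := max C 1) (by fun_prop) ?_
  refine (ae_restrict_iff' measurableSet_Ioi).2 (Eventually.of_forall fun t ht => ?_)
  have ht0 : (0 : ℝ) < t := ht
  rw [norm_mul, norm_pow, Complex.norm_real, norm_exp_I_mul, Real.norm_of_nonneg ht0.le,
    Real.norm_of_nonneg (Real.exp_pos _).le]
  have key : t ^ k ≤ max C 1 * Real.exp (z.im / 2 * t) := by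
    rcases le_total T t with h | h
    · have := hT t h
      rw [Real.norm_of_nonneg (by positivity), Real.norm_of_nonneg (by positivity)] at this
      exact this.trans (by gcongr; exact le_max_right _ _)
    · have := hC t ⟨ht0.le, h.trans (le_max_left _ _)⟩
      rw [Real.norm_of_nonneg (by positivity), div_le_iff₀ (by positivity)] at this
      exact this.trans (by gcongr; exact le_max_left _ _)
  calc t ^ k * Real.exp (-(z.im * t))
      ≤ (max C 1 * Real.exp (z.im / 2 * t)) * Real.exp (-(z.im * t)) := by gcongr
    _ = max C 1 * Real.exp (-(z.im / 2 * t)) := by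
      rw [mul_assoc, ← Real.exp_add]; congr 2; ring

theorem integrable_mul_pow_exp {f : ℝ → ℂ} (hf : MemLp f 2 posMeasure) (k : ℕ) {z : ℂ}
    (hz : 0 < z.im) :
    Integrable (fun t : ℝ => f t * ((t : ℂ) ^ k * Complex.exp (Complex.I * t * z))) posMeasure :=
  hf.integrable_mul (memLp_two_pow_mul_exp k hz)

theorem integrable_hF {f : ℝ → ℂ} (hf : MemLp f 2 posMeasure) {z : ℂ} (hz : 0 < z.im) :
    Integrable (fun t : ℝ => f t * Complex.exp (Complex.I * t * z)) posMeasure := by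
  simpa using integrable_mul_pow_exp hf 0 hz

theorem hasDerivAt_hF {f : ℝ → ℂ} (hf : MemLp f 2 posMeasure) {z : ℂ} (hz : 0 < z.im) :
    HasDerivAt (hF f) (∫ t in Ioi (0 : ℝ), f t * (Complex.I * t * Complex.exp (Complex.I * t * z)))
      z := by
  have hs : {w : ℂ | z.im / 2 < w.im} ∈ 𝓝 z :=
    (isOpen_lt continuous_const Complex.continuous_im).mem_nhds (by simp; linarith)
  refine (hasDerivAt_integral_of_dominated_loc_of_deriv_le (s := {w : ℂ | z.im / 2 < w.im})
    (bound := fun t => ‖f t * ((t : ℂ) ^ 1 * Complex.exp (Complex.I * t * (z.im / 2 * Complex.I)))‖)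
    (F' := fun w t => f t * (Complex.I * t * Complex.exp (Complex.I * t * w)))
    hs ?_ (integrable_hF hf hz) ?_ ?_ ?_ ?_).2
  · refine Eventually.of_forall fun w => hf.1.mul (by fun_prop)
  · exact hf.1.mul (by fun_prop)
  · refine (ae_restrict_iff' measurableSet_Ioi).2 (Eventually.of_forall fun t ht w hw => ?_)
    have ht0 : (0 : ℝ) < t := ht
    simp only [norm_mul, norm_exp_I_mul, Complex.norm_I, one_mul, pow_one]
    have hw' : z.im / 2 < w.im := hw
    gcongr
    simpa using hw'.le
  · exact (integrable_mul_pow_exp hf 1 (by simpa using hz)).norm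
  · refine Eventually.of_forall fun t w _ => ?_
    have := ((hasDerivAt_id w).const_mul (Complex.I * t)).cexp.const_mul (f t)
    convert! this using 1
    simp only [id, mul_one]
    ring

theorem differentiableOn_hF {f : ℝ → ℂ} (hf : MemLp f 2 posMeasure) :
    DifferentiableOn ℂ (hF f) upperHalfPlaneSet := fun _ hz =>
  (hasDerivAt_hF hf hz).differentiableAt.differentiableWithinAt

/-! ### Plancherel's identity on horizontal lines -/

theorem norm_sq_eq_integral {α : Type*} [MeasurableSpace α] {μ : Measure α} (f : Lp ℂ 2 μ) :
    ‖f‖ ^ 2 = ∫ x, ‖f x‖ ^ 2 ∂μ := by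
  have h := L2.inner_def (𝕜 := ℂ) f f
  simp only [inner_self_eq_norm_sq_to_K] at h
  have h2 : (∫ x, ((‖f x‖ : ℂ)) ^ 2 ∂μ) = ((∫ x, ‖f x‖ ^ 2 ∂μ : ℝ) : ℂ) := by
    rw [← integral_complex_ofReal]
    push_cast
    rfl
  have h3 : ((‖f‖ ^ 2 : ℝ) : ℂ) = ((∫ x, ‖f x‖ ^ 2 ∂μ : ℝ) : ℂ) := by
    rw [← h2]
    push_cast
    exact h
  exact_mod_cast h3

theorem inner_eq_integral {α : Type*} [MeasurableSpace α] {μ : Measure α} (f g : Lp ℂ 2 μ) :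
    inner ℂ g f = ∫ x, f x * conj (g x) ∂μ := by
  rw [L2.inner_def]
  rfl

/-- The Hilbert space `L²(ℝ⁺)`. -/
abbrev L2pos : Type := Lp ℂ 2 posMeasure

theorem memLp_indicator_pos {f : ℝ → ℂ} (hf : MemLp f 2 posMeasure) :
    MemLp (indicator (Ioi (0 : ℝ)) f) 2 volume :=
  (memLp_indicator_iff_restrict measurableSet_Ioi).2 hf

/-- Extension by zero `L²(ℝ⁺) → L²(ℝ)`. -/
def extZero (f : L2pos) : Lp ℂ 2 (volume : Measure ℝ) :=
  (memLp_indicator_pos (Lp.memLp f)).toLp _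

theorem coeFn_extZero (f : L2pos) : extZero f =ᵐ[volume] indicator (Ioi (0 : ℝ)) f :=
  MemLp.coeFn_toLp _

theorem inner_extZero (f g : L2pos) : inner ℂ (extZero g) (extZero f) = inner ℂ g f := by
  rw [inner_eq_integral, inner_eq_integral, ← integral_indicator measurableSet_Ioi]
  refine integral_congr_ae ?_
  filter_upwards [coeFn_extZero f, coeFn_extZero g] with x h1 h2
  rw [h1, h2]
  by_cases hx : x ∈ Ioi (0 : ℝ) <;> simp [hx]

theorem extZero_sub (f g : L2pos) : extZero (f - g) = extZero f - extZero g := by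
  apply Lp.ext
  have := (ae_restrict_iff' measurableSet_Ioi).1 (Lp.coeFn_sub f g)
  filter_upwards [coeFn_extZero (f - g), coeFn_extZero f, coeFn_extZero g,
    Lp.coeFn_sub (extZero f) (extZero g), this] with x h1 h2 h3 h4 h5
  rw [h1, h4, Pi.sub_apply, h2, h3]
  by_cases hx : x ∈ Ioi (0 : ℝ) <;> simp [hx]
  exact h5 hx

theorem two_pi_ne_zero : (2 * Real.pi : ℝ) ≠ 0 := by positivity

theorem quasiMeasurePreserving_div {a : ℝ} (ha : a ≠ 0) :
    Measure.QuasiMeasurePreserving (fun x : ℝ => x / a) volume volume := by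
  refine ⟨by fun_prop, ?_⟩
  have := Real.map_volume_mul_left (a := a⁻¹) (inv_ne_zero ha)
  have h2 : (fun x : ℝ => x / a) = fun x => a⁻¹ * x := by ext x; rw [div_eq_inv_mul]
  rw [h2, this]
  exact Measure.smul_absolutelyContinuous

/-- The boundary function on `ℝ` of the holomorphic Fourier transform of `f ∈ L²(ℝ⁺)`:
the `L²` Fourier transform of the extension of `f` by zero, in the normalization `e^{itx}`. -/
def bd (f : L2pos) (x : ℝ) : ℂ :=
  (𝓕⁻ (extZero f) : Lp ℂ 2 (volume : Measure ℝ)) (x / (2 * Real.pi))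

theorem aestronglyMeasurable_bd (f : L2pos) : AEStronglyMeasurable (bd f) volume :=
  (Lp.aestronglyMeasurable _).comp_quasiMeasurePreserving
    (quasiMeasurePreserving_div two_pi_ne_zero)

/-- Plancherel's identity. -/
theorem integral_bd_mul_conj (f g : L2pos) :
    ∫ x, bd f x * conj (bd g x) = ((2 * Real.pi : ℝ) : ℂ) * inner ℂ g f := by
  have h := Measure.integral_comp_div (fun x : ℝ =>
    (𝓕⁻ (extZero f) : Lp ℂ 2 (volume : Measure ℝ)) x *
      conj ((𝓕⁻ (extZero g) : Lp ℂ 2 (volume : Measure ℝ)) x)) (2 * Real.pi)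
  rw [← inner_eq_integral] at h
  have h2 : inner ℂ (𝓕⁻ (extZero g) : Lp ℂ 2 (volume : Measure ℝ)) (𝓕⁻ (extZero f))
      = inner ℂ (extZero g) (extZero f) :=
    (Lp.fourierTransformₗᵢ ℝ ℂ).symm.inner_map_map _ _
  rw [h2, inner_extZero, abs_of_pos (by positivity)] at h
  unfold bd
  rw [h, Complex.real_smul]

theorem memLp_bd (f : L2pos) : MemLp (bd f) 2 volume := by
  rw [memLp_two_iff_integrable_sq_norm (aestronglyMeasurable_bd f)]
  have := (memLp_two_iff_integrable_sq_norm (Lp.aestronglyMeasurable _)).1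
    (Lp.memLp (𝓕⁻ (extZero f) : Lp ℂ 2 (volume : Measure ℝ)))
  exact this.comp_div two_pi_ne_zero

theorem integral_norm_sq_bd (f : L2pos) : ∫ x, ‖bd f x‖ ^ 2 = 2 * Real.pi * ‖f‖ ^ 2 := by
  have h := integral_bd_mul_conj f f
  simp only [RCLike.mul_conj, inner_self_eq_norm_sq_to_K] at h
  have h2 : (∫ x, ((‖bd f x‖ : ℂ)) ^ 2) = ((∫ x, ‖bd f x‖ ^ 2 : ℝ) : ℂ) := by
    rw [← integral_complex_ofReal]
    push_cast
    rfl
  have h3 : ((∫ x, ‖bd f x‖ ^ 2 : ℝ) : ℂ) = ((2 * Real.pi * ‖f‖ ^ 2 : ℝ) : ℂ) := by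
    rw [← h2]
    push_cast at h ⊢
    exact h
  exact_mod_cast h3

theorem lintegral_enorm_sq_bd (f : L2pos) :
    ∫⁻ x, ‖bd f x‖ₑ ^ 2 = ENNReal.ofReal (2 * Real.pi * ‖f‖ ^ 2) := by
  rw [← integral_norm_sq_bd, ofReal_integral_eq_lintegral_ofReal
    ((memLp_two_iff_integrable_sq_norm (aestronglyMeasurable_bd f)).1 (memLp_bd f))
    (Eventually.of_forall fun x => by positivity)]
  simp only [ENNReal.ofReal_pow (norm_nonneg _), ofReal_norm]

theorem bd_sub (f g : L2pos) : bd (f - g) =ᵐ[volume] fun x => bd f x - bd g x := by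
  have h : (𝓕⁻ (extZero (f - g)) : Lp ℂ 2 (volume : Measure ℝ)) =
      𝓕⁻ (extZero f) - 𝓕⁻ (extZero g) := by
    rw [extZero_sub]
    exact (Lp.fourierTransformₗᵢ ℝ ℂ).symm.map_sub _ _
  have h2 := (quasiMeasurePreserving_div two_pi_ne_zero).ae_eq_comp
    (Lp.coeFn_sub (𝓕⁻ (extZero f) : Lp ℂ 2 (volume : Measure ℝ)) (𝓕⁻ (extZero g)))
  filter_upwards [h2] with x hx
  unfold bd
  rw [h]
  exact hx

theorem memLp_damp {y : ℝ} (hy : 0 ≤ y) {f : ℝ → ℂ} (hf : MemLp f 2 posMeasure) :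
    MemLp (fun t : ℝ => (Real.exp (-(y * t)) : ℂ) * f t) 2 posMeasure := by
  refine hf.mono (Continuous.aestronglyMeasurable (by fun_prop) |>.mul hf.1) ?_
  refine (ae_restrict_iff' measurableSet_Ioi).2 (Eventually.of_forall fun t ht => ?_)
  have ht0 : (0 : ℝ) < t := ht
  rw [norm_mul, Complex.norm_real, Real.norm_of_nonneg (Real.exp_pos _).le]
  have : Real.exp (-(y * t)) ≤ 1 := Real.exp_le_one_iff.2 (by
    have := mul_nonneg hy ht0.le
    linarith)
  exact mul_le_of_le_one_left (norm_nonneg _) this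

/-- Multiplication by `e^{-yt}` on `L²(ℝ⁺)`, for `y ≥ 0`. -/
def damp (y : ℝ) (hy : 0 ≤ y) (f : L2pos) : L2pos := (memLp_damp hy (Lp.memLp f)).toLp _

theorem coeFn_damp {y : ℝ} (hy : 0 ≤ y) (f : L2pos) :
    damp y hy f =ᵐ[posMeasure] fun t : ℝ => (Real.exp (-(y * t)) : ℂ) * f t :=
  MemLp.coeFn_toLp _

/-- The factor `2π` converts the normalization `e^{itx}` to `e^{2πitx}`. -/
theorem hF_eq_fourierInv (f : ℝ → ℂ) (x y : ℝ) :
    hF f (x + y * Complex.I) =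
      𝓕⁻ (indicator (Ioi (0 : ℝ)) fun t : ℝ => (Real.exp (-(y * t)) : ℂ) * f t)
        (x / (2 * Real.pi)) := by
  rw [Real.fourierInv_eq', hF, ← integral_indicator measurableSet_Ioi]
  refine integral_congr_ae (Eventually.of_forall fun t => ?_)
  by_cases ht : t ∈ Ioi (0 : ℝ)
  · simp only [indicator_of_mem ht, smul_eq_mul, Complex.ofReal_exp]
    rw [← mul_assoc, ← Complex.exp_add, mul_comm]
    congr 2
    have : ((2 * Real.pi * inner ℝ t (x / (2 * Real.pi)) : ℝ) : ℂ) = ((t * x : ℝ) : ℂ) := by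
      congr 1
      rw [RCLike.inner_apply, conj_trivial]
      field_simp
    rw [this]
    push_cast
    linear_combination ((t : ℂ) * y) * Complex.I_sq
  · simp [indicator_of_notMem ht]

theorem integrable_damp {y : ℝ} (hy : 0 < y) {f : ℝ → ℂ} (hf : MemLp f 2 posMeasure) :
    Integrable (fun t : ℝ => (Real.exp (-(y * t)) : ℂ) * f t) posMeasure :=
  (memLp_two_exp_neg hy).ofReal.integrable_mul hf

/-- On the line at height `y`, the holomorphic Fourier transform of `f` is the boundary function of
`e^{-yt} f(t)`. -/
theorem hF_ae_eq_bd (f : L2pos) {y : ℝ} (hy : 0 < y) :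
    (fun x : ℝ => hF f (x + y * Complex.I)) =ᵐ[volume] bd (damp y hy.le f) := by
  have h1 : Integrable (indicator (Ioi (0 : ℝ)) fun t : ℝ => (Real.exp (-(y * t)) : ℂ) * f t) :=
    (integrable_indicator_iff measurableSet_Ioi).2 (integrable_damp hy (Lp.memLp f))
  have h2 := memLp_indicator_pos (memLp_damp hy.le (Lp.memLp f))
  have h3 : extZero (damp y hy.le f) = h2.toLp _ := by
    apply Lp.ext
    filter_upwards [coeFn_extZero (damp y hy.le f), h2.coeFn_toLp,
      (ae_restrict_iff' measurableSet_Ioi).1 (coeFn_damp hy.le f)] with t e1 e2 e3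
    rw [e1, e2]
    by_cases ht : t ∈ Ioi (0 : ℝ)
    · simp only [indicator_of_mem ht, e3 ht]
    · simp [ht]
  have h4 := (quasiMeasurePreserving_div two_pi_ne_zero).ae_eq_comp (fourierInv_toLp_ae_eq h1 h2)
  filter_upwards [h4] with x hx
  rw [hF_eq_fourierInv, bd, h3]
  exact hx.symm

theorem norm_damp_le {y : ℝ} (hy : 0 ≤ y) (f : L2pos) : ‖damp y hy f‖ ≤ ‖f‖ := by
  refine Lp.norm_le_norm_of_ae_le ?_
  filter_upwards [coeFn_damp hy f, ae_restrict_mem measurableSet_Ioi] with t h ht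
  have ht0 : (0 : ℝ) < t := ht
  rw [h, norm_mul, Complex.norm_real, Real.norm_of_nonneg (Real.exp_pos _).le]
  have : Real.exp (-(y * t)) ≤ 1 := Real.exp_le_one_iff.2 (by
    have := mul_nonneg hy ht0.le
    linarith)
  exact mul_le_of_le_one_left (norm_nonneg _) this

/-- `e^{-yt} f → f` in `L²` as `y → 0⁺`. The truncation `max y 0` only serves to make the family
total in `y`. -/
theorem tendsto_norm_damp_sub (f : L2pos) :
    Tendsto (fun y : ℝ => ‖damp (max y 0) (le_max_right _ _) f - f‖) (𝓝[>] 0) (𝓝 0) := by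
  have key : Tendsto (fun y : ℝ => ∫ t, ‖((Real.exp (-(y * t)) : ℂ) - 1) * f t‖ ^ 2 ∂posMeasure)
      (𝓝[>] 0) (𝓝 (∫ _, (0 : ℝ) ∂posMeasure)) := by
    refine tendsto_integral_filter_of_dominated_convergence (fun t => ‖f t‖ ^ 2) ?_ ?_ ?_ ?_
    · refine Eventually.of_forall fun y => ?_
      exact (((Continuous.aestronglyMeasurable (by fun_prop)).mul
        (Lp.aestronglyMeasurable f)).norm.pow 2)
    · filter_upwards [self_mem_nhdsWithin] with y hy
      refine (ae_restrict_iff' measurableSet_Ioi).2 (Eventually.of_forall fun t ht => ?_)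
      have ht0 : (0 : ℝ) < t := ht
      have hy0 : (0 : ℝ) < y := hy
      rw [Real.norm_of_nonneg (by positivity), norm_mul]
      have h1 : Real.exp (-(y * t)) ≤ 1 := Real.exp_le_one_iff.2 (by nlinarith)
      have h2 : ‖(Real.exp (-(y * t)) : ℂ) - 1‖ ≤ 1 := by
        rw [← Complex.ofReal_one, ← Complex.ofReal_sub, Complex.norm_real, Real.norm_eq_abs,
          abs_le]
        constructor <;> linarith [Real.exp_pos (-(y * t))]
      gcongr
      exact mul_le_of_le_one_left (norm_nonneg _) h2
    · exact (memLp_two_iff_integrable_sq_norm (Lp.aestronglyMeasurable f)).1 (Lp.memLp f)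
    · refine Eventually.of_forall fun t => ?_
      have : Continuous fun y : ℝ => ‖((Real.exp (-(y * t)) : ℂ) - 1) * f t‖ ^ 2 := by fun_prop
      have h := (this.tendsto 0).mono_left (nhdsWithin_le_nhds (s := Ioi 0))
      simpa using h
  simp only [integral_zero] at key
  have h2 := key.sqrt
  rw [Real.sqrt_zero] at h2
  refine h2.congr' ?_
  filter_upwards [self_mem_nhdsWithin] with y hy
  rw [← Real.sqrt_sq (norm_nonneg (damp (max y 0) (le_max_right _ _) f - f)), norm_sq_eq_integral]
  congr 1
  refine integral_congr_ae ?_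
  filter_upwards [Lp.coeFn_sub (damp (max y 0) (le_max_right _ _) f) f,
    coeFn_damp (le_max_right y 0) f] with t h h'
  rw [h, Pi.sub_apply, h', max_eq_left (le_of_lt hy), sub_mul, one_mul]

/-- The integrals over horizontal lines tend to the integral over the boundary as `y → 0⁺`, and are
bounded by it. -/
theorem hardySup_hF (f : L2pos) : hardySup (hF f) = ENNReal.ofReal (2 * Real.pi * ‖f‖ ^ 2) := by
  have h (y : ℝ) (hy : 0 < y) : ∫⁻ x : ℝ, ‖hF f (x + y * Complex.I)‖ₑ ^ 2
      = ENNReal.ofReal (2 * Real.pi * ‖damp y hy.le f‖ ^ 2) := by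
    rw [← lintegral_enorm_sq_bd]
    refine lintegral_congr_ae ?_
    filter_upwards [hF_ae_eq_bd f hy] with x hx
    rw [hx]
  apply le_antisymm
  · refine iSup₂_le fun y hy => ?_
    rw [h y hy]
    gcongr
    exact norm_damp_le _ _
  · have h1 : Tendsto (fun y : ℝ => damp (max y 0) (le_max_right _ _) f) (𝓝[>] 0) (𝓝 f) :=
      tendsto_iff_norm_sub_tendsto_zero.2 (tendsto_norm_damp_sub f)
    have h2 := (ENNReal.continuous_ofReal.tendsto _).comp ((h1.norm.pow 2).const_mul (2 * Real.pi))
    refine le_of_tendsto h2 ?_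
    filter_upwards [self_mem_nhdsWithin] with y hy
    have hy' : (0 : ℝ) < y := hy
    have := le_iSup₂ (f := fun (y : ℝ) (_ : 0 < y) =>
      ∫⁻ x : ℝ, ‖hF f (x + y * Complex.I)‖ₑ ^ 2) y hy'
    rw [h y hy'] at this
    refine le_trans (le_of_eq ?_) this
    simp only [Function.comp_apply]
    congr 5
    exact max_eq_left hy'.le

theorem memH2_hF (f : L2pos) : MemH2 (hF f) :=
  ⟨differentiableOn_hF (Lp.memLp f), by rw [hardySup_hF]; exact ENNReal.ofReal_lt_top⟩

/-! ### Convergence of integrals over segments -/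

theorem intervalIntegrable_of_memLp_two {h : ℝ → ℂ} (hh : MemLp h 2 volume) (a b : ℝ) :
    IntervalIntegrable h volume a b :=
  intervalIntegrable_iff.2 (((hh.locallyIntegrable (by norm_num)).integrableOn_isCompact
    isCompact_uIcc).mono_set uIoc_subset_uIcc)

theorem norm_setIntegral_bd_le (f : L2pos) (a b : ℝ) :
    ‖∫ x in Ioc a b, bd f x‖ ≤
      ‖indicatorConstLp 2 (μ := volume) (measurableSet_Ioc (a := a) (b := b))
        (measure_Ioc_lt_top (μ := volume)).ne (1 : ℂ)‖ *
        (√(2 * Real.pi) * ‖f‖) := by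
  have h1 := L2.inner_indicatorConstLp_one (𝕜 := ℂ) (measurableSet_Ioc (a := a) (b := b))
    (measure_Ioc_lt_top (μ := volume)).ne ((memLp_bd f).toLp _)
  have h2 : ∫ x in Ioc a b, bd f x = ∫ x in Ioc a b, ((memLp_bd f).toLp _) x :=
    integral_congr_ae (ae_restrict_of_ae (memLp_bd f).coeFn_toLp.symm)
  have h3 : ‖(memLp_bd f).toLp _‖ = √(2 * Real.pi) * ‖f‖ := by
    rw [← Real.sqrt_sq (norm_nonneg ((memLp_bd f).toLp _)), norm_sq_eq_integral]
    have : ∫ x, ‖((memLp_bd f).toLp _) x‖ ^ 2 = ∫ x, ‖bd f x‖ ^ 2 :=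
      integral_congr_ae ((memLp_bd f).coeFn_toLp.mono fun x hx => by simp only [hx])
    rw [this, integral_norm_sq_bd, Real.sqrt_mul (by positivity), Real.sqrt_sq (norm_nonneg _)]
  rw [h2, ← h1, ← h3]
  exact norm_inner_le_norm _ _

/-- The lines `x ↦ hF f (x + iy)` converge to `bd f` in `L²`, so their integrals over bounded sets
converge. -/
theorem tendsto_setIntegral_hF (f : L2pos) (a b : ℝ) :
    Tendsto (fun y : ℝ => ∫ x in Ioc a b, hF f (x + y * Complex.I)) (𝓝[>] 0)
      (𝓝 (∫ x in Ioc a b, bd f x)) := by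
  rw [tendsto_iff_norm_sub_tendsto_zero]
  have h := ((tendsto_norm_damp_sub f).const_mul (√(2 * Real.pi))).const_mul
    ‖indicatorConstLp 2 (μ := volume) (measurableSet_Ioc (a := a) (b := b))
      (measure_Ioc_lt_top (μ := volume)).ne (1 : ℂ)‖
  rw [mul_zero, mul_zero] at h
  refine squeeze_zero' (Eventually.of_forall fun _ => norm_nonneg _) ?_ h
  filter_upwards [self_mem_nhdsWithin] with y hy
  have hy' : (0 : ℝ) < y := hy
  refine le_trans (le_of_eq ?_) (norm_setIntegral_bd_le _ a b)
  have e1 : ∫ x in Ioc a b, hF f (x + y * Complex.I) =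
      ∫ x in Ioc a b, bd (damp (max y 0) (le_max_right _ _) f) x := by
    refine integral_congr_ae (ae_restrict_of_ae ?_)
    filter_upwards [hF_ae_eq_bd f hy'] with x hx
    rw [hx]
    congr 2
    exact (max_eq_left hy'.le).symm
  have e2 (g : L2pos) : IntegrableOn (bd g) (Ioc a b) :=
    ((memLp_bd g).locallyIntegrable (by norm_num)).integrableOn_isCompact isCompact_Icc
      |>.mono_set Ioc_subset_Icc_self
  rw [e1, ← integral_sub (e2 _) (e2 _)]
  congr 1
  exact integral_congr_ae (ae_restrict_of_ae (bd_sub _ f).symm)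

theorem tendsto_intervalIntegral_hF (f : L2pos) (a b : ℝ) :
    Tendsto (fun y : ℝ => ∫ x in a..b, hF f (x + y * Complex.I)) (𝓝[>] 0)
      (𝓝 (∫ x in a..b, bd f x)) := by
  simp only [intervalIntegral]
  exact (tendsto_setIntegral_hF f a b).sub (tendsto_setIntegral_hF f b a)

/-! ### Poisson integrals -/

theorem integrable_exp_neg_abs {y : ℝ} (hy : 0 < y) :
    Integrable (fun t : ℝ => Real.exp (-(y * |t|))) := by
  have h1 : IntegrableOn (fun t : ℝ => Real.exp (-(y * |t|))) (Ioi 0) := by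
    refine (integrableOn_exp_mul_Ioi (a := -y) (by linarith) 0).congr_fun (fun t ht => ?_)
      measurableSet_Ioi
    have ht0 : (0 : ℝ) < t := ht
    simp [abs_of_pos ht0]
  have h2 : IntegrableOn (fun t : ℝ => Real.exp (-(y * |t|))) (Iic 0) := by
    refine (integrableOn_exp_mul_Iic (a := y) hy 0).congr_fun (fun t ht => ?_)
      measurableSet_Iic
    have ht0 : t ≤ (0 : ℝ) := ht
    simp [abs_of_nonpos ht0]
  rw [← integrableOn_univ, ← Iic_union_Ioi (a := (0 : ℝ))]
  exact h2.union h1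

/-- The kernel whose Fourier transform is the Poisson kernel. -/
def abelKernel (x y t : ℝ) : ℂ := Real.exp (-(y * |t|)) * Complex.exp (-(Complex.I * t * x))

theorem norm_abelKernel (x y t : ℝ) : ‖abelKernel x y t‖ = Real.exp (-(y * |t|)) := by
  rw [abelKernel, norm_mul, Complex.norm_real, Real.norm_of_nonneg (Real.exp_pos _).le,
    Complex.norm_exp]
  simp

theorem continuous_abelKernel (x y : ℝ) : Continuous (abelKernel x y) := by
  unfold abelKernel; fun_prop

theorem integrable_abelKernel (x : ℝ) {y : ℝ} (hy : 0 < y) : Integrable (abelKernel x y) :=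
  (integrable_exp_neg_abs hy).mono' (continuous_abelKernel x y).aestronglyMeasurable
    (Eventually.of_forall fun t => (norm_abelKernel x y t).le)

theorem memLp_abelKernel (x : ℝ) {y : ℝ} (hy : 0 < y) : MemLp (abelKernel x y) 2 volume := by
  rw [memLp_two_iff_integrable_sq_norm (continuous_abelKernel x y).aestronglyMeasurable]
  refine (integrable_exp_neg_abs (y := 2 * y) (by linarith)).congr
    (Eventually.of_forall fun t => ?_)
  simp only [norm_abelKernel, ← Real.exp_nat_mul]
  congr 1; push_cast; ring

theorem fourierInv_abelKernel (x : ℝ) {y : ℝ} (hy : 0 < y) (w : ℝ) :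
    𝓕⁻ (abelKernel x y) w = ((2 * y / (y ^ 2 + (2 * Real.pi * w - x) ^ 2) : ℝ) : ℂ) := by
  set a : ℝ := 2 * Real.pi * w - x with ha
  have hpt (t : ℝ) : Complex.exp (((2 * Real.pi * inner ℝ t w : ℝ) : ℂ) * Complex.I) •
      abelKernel x y t = Complex.exp (-(y * |t|) + Complex.I * t * a) := by
    rw [abelKernel, smul_eq_mul, Complex.ofReal_exp, ← Complex.exp_add, ← Complex.exp_add,
      RCLike.inner_apply, conj_trivial, ha]
    congr 1
    push_cast
    ring
  rw [Real.fourierInv_eq']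
  simp only [hpt]
  have hint : Integrable fun t : ℝ => Complex.exp (-(y * |t|) + Complex.I * t * a) := by
    refine (integrable_exp_neg_abs hy).mono' (Continuous.aestronglyMeasurable (by fun_prop))
      (Eventually.of_forall fun t => ?_)
    rw [Complex.norm_exp]
    simp
  rw [← intervalIntegral.integral_Iic_add_Ioi (b := 0) hint.integrableOn hint.integrableOn]
  have h1 : ∫ t in Iic (0 : ℝ), Complex.exp (-(y * |t|) + Complex.I * t * a) =
      1 / (y + Complex.I * a) := by
    have := integral_exp_mul_complex_Iic (a := y + Complex.I * a) (by simpa using hy) 0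
    rw [Complex.ofReal_zero, mul_zero, Complex.exp_zero] at this
    rw [← this]
    refine setIntegral_congr_fun measurableSet_Iic fun t ht => ?_
    have ht0 : t ≤ (0 : ℝ) := ht
    simp only [abs_of_nonpos ht0]
    congr 1; push_cast; ring
  have h2 : ∫ t in Ioi (0 : ℝ), Complex.exp (-(y * |t|) + Complex.I * t * a) =
      1 / (y - Complex.I * a) := by
    have := integral_exp_mul_complex_Ioi (a := -(y - Complex.I * a)) (by simpa using hy) 0
    rw [Complex.ofReal_zero, mul_zero, Complex.exp_zero, neg_div_neg_eq] at this
    rw [← this]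
    refine setIntegral_congr_fun measurableSet_Ioi fun t ht => ?_
    have ht0 : (0 : ℝ) < t := ht
    simp only [abs_of_pos ht0]
    congr 1; ring
  rw [h1, h2]
  have e1 : (y + Complex.I * a : ℂ) ≠ 0 := fun h => by
    have := congrArg Complex.re h; simp at this; exact hy.ne' this
  have e2 : (y - Complex.I * a : ℂ) ≠ 0 := fun h => by
    have := congrArg Complex.re h; simp at this; exact hy.ne' this
  have e3 : (y ^ 2 + a ^ 2 : ℂ) = (y + Complex.I * a) * (y - Complex.I * a) := by
    linear_combination ((a : ℂ) ^ 2) * Complex.I_sq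
  push_cast
  rw [e3]
  field_simp
  ring

/-- The Poisson formula for the holomorphic Fourier transform, from Parseval's identity. -/
theorem hF_eq_poisson (f : L2pos) (x : ℝ) {y : ℝ} (hy : 0 < y) :
    hF f (x + y * Complex.I) =
      (Real.pi : ℂ)⁻¹ * ∫ u : ℝ, bd f (x + y * u) * ((1 / (1 + u ^ 2) : ℝ) : ℂ) := by
  have hk := memLp_abelKernel x hy
  have h1 : inner ℂ (𝓕⁻ (hk.toLp _) : Lp ℂ 2 (volume : Measure ℝ)) (𝓕⁻ (extZero f))
      = inner ℂ (hk.toLp _) (extZero f) :=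
    (Lp.fourierTransformₗᵢ ℝ ℂ).symm.inner_map_map _ _
  have h2 : inner ℂ (hk.toLp _) (extZero f) = hF f (x + y * Complex.I) := by
    rw [inner_eq_integral, hF, ← integral_indicator measurableSet_Ioi]
    refine integral_congr_ae ?_
    filter_upwards [coeFn_extZero f, hk.coeFn_toLp] with t e1 e2
    rw [e1, e2]
    by_cases ht : t ∈ Ioi (0 : ℝ)
    · have ht0 : (0 : ℝ) < t := ht
      simp only [indicator_of_mem ht, abelKernel, abs_of_pos ht0, map_mul, Complex.conj_ofReal,
        ← Complex.exp_conj, map_neg, Complex.conj_I]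
      rw [Complex.ofReal_exp, ← Complex.exp_add]
      congr 2
      push_cast
      linear_combination (-(t : ℂ) * y) * Complex.I_sq
    · simp [indicator_of_notMem ht]
  have h3 : inner ℂ (𝓕⁻ (hk.toLp _) : Lp ℂ 2 (volume : Measure ℝ)) (𝓕⁻ (extZero f)) =
      ∫ w : ℝ, bd f (2 * Real.pi * w) *
        ((2 * y / (y ^ 2 + (2 * Real.pi * w - x) ^ 2) : ℝ) : ℂ) := by
    rw [inner_eq_integral]
    refine integral_congr_ae ?_
    filter_upwards [fourierInv_toLp_ae_eq (integrable_abelKernel x hy) hk] with w hw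
    rw [hw, fourierInv_abelKernel x hy, Complex.conj_ofReal, bd]
    congr 3
    field_simp
  rw [← h2, ← h1, h3]
  have h4 := Measure.integral_comp_mul_left (fun s : ℝ => bd f s *
        ((2 * y / (y ^ 2 + (s - x) ^ 2) : ℝ) : ℂ)) (2 * Real.pi)
  rw [h4, ← integral_add_left_eq_self _ x]
  have h5 := Measure.integral_comp_mul_left (fun s : ℝ => bd f (x + s) *
        ((2 * y / (y ^ 2 + (x + s - x) ^ 2) : ℝ) : ℂ)) y
  have h6 : ∫ s : ℝ, bd f (x + s) * ((2 * y / (y ^ 2 + (x + s - x) ^ 2) : ℝ) : ℂ) =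
      y • ∫ u : ℝ, bd f (x + y * u) * ((2 * y / (y ^ 2 + (x + y * u - x) ^ 2) : ℝ) : ℂ) := by
    rw [h5, abs_of_pos (by positivity), smul_smul, mul_inv_cancel₀ hy.ne', one_smul]
  rw [h6, abs_of_pos (by positivity), smul_smul, ← integral_smul, ← integral_const_mul]
  refine integral_congr_ae (Eventually.of_forall fun u => ?_)
  simp only [Complex.real_smul]
  have : ((2 * Real.pi)⁻¹ * y * (2 * y / (y ^ 2 + (x + y * u - x) ^ 2)) : ℝ) =
      Real.pi⁻¹ * (1 / (1 + u ^ 2)) := by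
    have : y ^ 2 + (x + y * u - x) ^ 2 = y ^ 2 * (1 + u ^ 2) := by ring
    rw [this]
    have h7 : (1 + u ^ 2 : ℝ) ≠ 0 := by positivity
    have := hy.ne'
    field_simp
  have h8 := congrArg (fun r : ℝ => (r : ℂ)) this
  simp only [Complex.ofReal_mul] at h8
  calc _ = bd f (x + y * u) * ((((2 * Real.pi)⁻¹ * y : ℝ) : ℂ) *
        ((2 * y / (y ^ 2 + (x + y * u - x) ^ 2) : ℝ) : ℂ)) := by ring
    _ = _ := by
      rw [Complex.ofReal_mul, h8, Complex.ofReal_inv]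
      ring

/-! ### Boundary values almost everywhere -/

/-- The density of the representation of `1 / (1 + u²)` as a mixture of indicators of `(-r, r)`. -/
def mixDensity (r : ℝ) : ℝ := 2 * r / (1 + r ^ 2) ^ 2

theorem continuous_mixDensity : Continuous mixDensity := by
  unfold mixDensity
  exact Continuous.div (by fun_prop) (by fun_prop) fun r => by positivity

theorem hasDerivAt_neg_inv (r : ℝ) :
    HasDerivAt (fun r : ℝ => -(1 / (1 + r ^ 2))) (mixDensity r) r := by
  have h : HasDerivAt (fun r : ℝ => 1 + r ^ 2) (2 * r) r := by
    simpa using (hasDerivAt_pow 2 r).const_add 1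
  have := (h.inv (by positivity)).neg
  convert! this using 1
  · ext s; simp
  · rw [mixDensity]; field_simp

theorem tendsto_neg_inv : Tendsto (fun r : ℝ => -(1 / (1 + r ^ 2))) atTop (𝓝 0) := by
  have h : Tendsto (fun r : ℝ => 1 + r ^ 2) atTop atTop :=
    tendsto_atTop_add_const_left _ _ (tendsto_pow_atTop two_ne_zero)
  simpa using h.inv_tendsto_atTop.neg

theorem mixDensity_nonneg {r : ℝ} (hr : 0 ≤ r) : 0 ≤ mixDensity r := by
  unfold mixDensity; positivity

theorem integrableOn_mixDensity {a : ℝ} (ha : 0 ≤ a) : IntegrableOn mixDensity (Ioi a) :=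
  integrableOn_Ioi_deriv_of_nonneg' (fun r _ => hasDerivAt_neg_inv r)
    (fun _ hr => mixDensity_nonneg (ha.trans (le_of_lt hr))) tendsto_neg_inv

theorem integral_mixDensity {a : ℝ} (ha : 0 ≤ a) :
    ∫ r in Ioi a, mixDensity r = 1 / (1 + a ^ 2) := by
  rw [integral_Ioi_of_hasDerivAt_of_nonneg' (fun r _ => hasDerivAt_neg_inv r)
    (fun _ hr => mixDensity_nonneg (ha.trans (le_of_lt hr))) tendsto_neg_inv]
  ring

theorem hasDerivAt_arctan_sub (r : ℝ) :
    HasDerivAt (fun r : ℝ => 2 * (Real.arctan r - r / (1 + r ^ 2))) (mixDensity r * (2 * r)) r := by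
  have h : HasDerivAt (fun r : ℝ => 1 + r ^ 2) (2 * r) r := by
    simpa using (hasDerivAt_pow 2 r).const_add 1
  have := ((Real.hasDerivAt_arctan r).sub ((hasDerivAt_id r).div h (by positivity))).const_mul 2
  convert! this using 1
  rw [mixDensity]
  simp only [id]
  field_simp
  ring

theorem tendsto_arctan_sub :
    Tendsto (fun r : ℝ => 2 * (Real.arctan r - r / (1 + r ^ 2))) atTop (𝓝 Real.pi) := by
  have h1 := (Real.tendsto_arctan_atTop).mono_right nhdsWithin_le_nhds
  have h2 : Tendsto (fun r : ℝ => r / (1 + r ^ 2)) atTop (𝓝 0) := by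
    refine squeeze_zero' ((eventually_ge_atTop 0).mono fun r hr => by positivity) ?_
      tendsto_inv_atTop_zero
    filter_upwards [eventually_gt_atTop 0] with r hr
    rw [div_le_iff₀ (by positivity)]
    field_simp
    linarith
  have := (h1.sub h2).const_mul 2
  convert! this using 2
  ring

theorem integrableOn_mixDensity_mul :
    IntegrableOn (fun r => mixDensity r * (2 * r)) (Ioi 0) :=
  integrableOn_Ioi_deriv_of_nonneg' (fun r _ => hasDerivAt_arctan_sub r)
    (fun r hr => mul_nonneg (mixDensity_nonneg (le_of_lt hr)) (by have : 0 < r := hr; linarith))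
    tendsto_arctan_sub

theorem integral_mixDensity_mul : ∫ r in Ioi (0 : ℝ), mixDensity r * (2 * r) = Real.pi := by
  rw [integral_Ioi_of_hasDerivAt_of_nonneg' (fun r _ => hasDerivAt_arctan_sub r)
    (fun r hr => mul_nonneg (mixDensity_nonneg (le_of_lt hr)) (by have : 0 < r := hr; linarith))
    tendsto_arctan_sub]
  simp

theorem memLp_inv_one_add_sq : MemLp (fun u : ℝ => ((1 / (1 + u ^ 2) : ℝ) : ℂ)) 2 volume := by
  have hc : Continuous fun u : ℝ => ((1 / (1 + u ^ 2) : ℝ) : ℂ) :=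
    Complex.continuous_ofReal.comp
      (Continuous.div (by fun_prop) (by fun_prop) fun r => by positivity)
  rw [memLp_two_iff_integrable_sq_norm hc.aestronglyMeasurable]
  refine integrable_inv_one_add_sq.mono' (hc.norm.pow 2).aestronglyMeasurable
    (Eventually.of_forall fun u => ?_)
  rw [Complex.norm_real, norm_pow, norm_norm, Real.norm_of_nonneg (by positivity), one_div]
  have : (1 + u ^ 2)⁻¹ ≤ 1 := inv_le_one_of_one_le₀ (by nlinarith)
  exact pow_le_of_le_one (by positivity) this two_ne_zero

theorem memLp_comp_add_mul {h : ℝ → ℂ} (hh : MemLp h 2 volume) (x : ℝ) {y : ℝ} (hy : 0 < y) :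
    MemLp (fun u => h (x + y * u)) 2 volume := by
  have hq : Measure.QuasiMeasurePreserving (fun u : ℝ => x + y * u) volume volume := by
    have h1 := quasiMeasurePreserving_div (inv_ne_zero hy.ne')
    have h2 := (measurePreserving_add_left volume x).quasiMeasurePreserving.comp h1
    convert! h2 using 1
    ext u
    simp [mul_comm]
  have hm : AEStronglyMeasurable (fun u => h (x + y * u)) volume :=
    hh.1.comp_quasiMeasurePreserving hq
  rw [memLp_two_iff_integrable_sq_norm hm]
  have h1 := (memLp_two_iff_integrable_sq_norm hh.1).1 hh
  exact (h1.comp_add_left x).comp_mul_left' hy.ne'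

/-- Poisson integrals as averages of symmetric means. -/
theorem poisson_eq_mix {h : ℝ → ℂ} (hh : MemLp h 2 volume) (x : ℝ) {y : ℝ} (hy : 0 < y) :
    ∫ u : ℝ, h (x + y * u) * ((1 / (1 + u ^ 2) : ℝ) : ℂ) =
      ∫ r in Ioi (0 : ℝ), (mixDensity r : ℂ) *
        ((y : ℂ)⁻¹ * ∫ s in (x - y * r)..(x + y * r), h s) := by
  set k : ℝ → ℂ := fun u => h (x + y * u) with hk
  have hkL : MemLp k 2 volume := memLp_comp_add_mul hh x hy
  set K : ℝ → ℝ → ℂ := fun u r => indicator {r : ℝ | |u| < r} (fun r => k u * mixDensity r) r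
    with hK
  have hKm : AEStronglyMeasurable (Function.uncurry K) (volume.prod (volume.restrict (Ioi 0))) := by
    have : Function.uncurry K = indicator {p : ℝ × ℝ | |p.1| < p.2}
        (fun p => k p.1 * mixDensity p.2) := by
      ext p
      simp only [Function.uncurry, hK, indicator, mem_ofPred_eq]
    rw [this]
    refine AEStronglyMeasurable.indicator ?_ (measurableSet_lt (by fun_prop) (by fun_prop))
    refine (hkL.1.comp_fst).mul ?_
    exact (Complex.continuous_ofReal.comp
      (continuous_mixDensity.comp continuous_snd)).aestronglyMeasurable
  have hsub (u : ℝ) : {r : ℝ | |u| < r} ∩ Ioi 0 = Ioi |u| := by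
    ext r
    simp only [mem_inter_iff, mem_ofPred_eq, mem_Ioi, and_iff_left_iff_imp]
    exact fun hr => (abs_nonneg u).trans_lt hr
  have hmeas (u : ℝ) : MeasurableSet {r : ℝ | |u| < r} := measurableSet_Ioi
  have hin (u : ℝ) : ∫ r in Ioi 0, K u r = k u * ((1 / (1 + u ^ 2) : ℝ) : ℂ) := by
    simp only [hK]
    rw [setIntegral_indicator (hmeas u), inter_comm, hsub, integral_const_mul]
    congr 1
    rw [integral_complex_ofReal, integral_mixDensity (abs_nonneg u), sq_abs]
  have hKi : Integrable (Function.uncurry K) (volume.prod (volume.restrict (Ioi 0))) := by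
    rw [integrable_prod_iff hKm]
    constructor
    · refine Eventually.of_forall fun u => ?_
      simp only [Function.uncurry, hK]
      rw [integrable_indicator_iff (hmeas u), IntegrableOn, Measure.restrict_restrict (hmeas u),
        hsub]
      exact ((integrableOn_mixDensity (abs_nonneg u)).ofReal).const_mul _
    · have : ∀ u, ∫ r in Ioi 0, ‖Function.uncurry K (u, r)‖ =
          ‖k u * ((1 / (1 + u ^ 2) : ℝ) : ℂ)‖ := by
        intro u
        simp only [Function.uncurry, hK, norm_indicator_eq_indicator_norm, norm_mul,
          Complex.norm_real]
        rw [setIntegral_indicator (hmeas u), inter_comm, hsub, integral_const_mul]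
        congr 1
        rw [Real.norm_of_nonneg (by positivity), ← sq_abs, ← integral_mixDensity (abs_nonneg u)]
        refine setIntegral_congr_fun measurableSet_Ioi fun r hr => ?_
        exact Real.norm_of_nonneg (mixDensity_nonneg ((abs_nonneg u).trans (le_of_lt hr)))
      simp only [this]
      exact (hkL.integrable_mul memLp_inv_one_add_sq).norm
  have hswap := integral_integral_swap hKi
  simp only [hin] at hswap
  rw [hswap]
  refine setIntegral_congr_fun measurableSet_Ioi fun r hr => ?_
  have hr0 : (0 : ℝ) < r := hr
  have e1 : (fun u => K u r) = indicator (Ioo (-r) r) fun u => k u * mixDensity r := by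
    ext u
    simp only [hK, indicator, mem_ofPred_eq, mem_Ioo, abs_lt]
  have e2 : ∫ u in (-r)..r, h (x + y * u) = y⁻¹ • ∫ s in (x + y * -r)..(x + y * r), h s :=
    intervalIntegral.integral_comp_add_mul h hy.ne' x
  rw [e1, integral_indicator measurableSet_Ioo, ← integral_Ioc_eq_integral_Ioo,
    ← intervalIntegral.integral_of_le (by linarith), intervalIntegral.integral_mul_const, e2,
    Complex.real_smul, Complex.ofReal_inv, mul_comm, mul_neg, ← sub_eq_add_neg]

/-- Symmetric means of an `L²` function at a differentiability point of its primitive are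
bounded. -/
theorem exists_bound_symm {h : ℝ → ℂ} (hh : MemLp h 2 volume) {x : ℝ} {c : ℂ}
    (hx : HasDerivAt (fun v => ∫ s in (0 : ℝ)..v, h s) c x) :
    ∃ C : ℝ, ∀ ρ > 0, ‖∫ s in (x - ρ)..(x + ρ), h s‖ ≤ C * ρ := by
  set A : ℝ → ℂ := fun v => ∫ s in (0 : ℝ)..v, h s with hA
  have hAsub (a b : ℝ) : ∫ s in a..b, h s = A b - A a :=
    (intervalIntegral.integral_interval_sub_left (intervalIntegrable_of_memLp_two hh _ _)
      (intervalIntegrable_of_memLp_two hh _ _)).symm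
  obtain ⟨C₁, hC₁⟩ := hx.isBigO_sub.bound
  obtain ⟨δ, hδ, hball⟩ := Metric.eventually_nhds_iff.1 hC₁
  have hsq := (memLp_two_iff_integrable_sq_norm hh.1).1 hh
  set M := ∫ s, ‖h s‖ ^ 2 with hM
  have hM0 : 0 ≤ M := integral_nonneg fun s => by positivity
  refine ⟨max (2 * C₁) (2 + M / δ), fun ρ hρ => ?_⟩
  -- for small `ρ` by differentiability at `x`, for large `ρ` by `‖h‖ ≤ 1 + ‖h‖²`
  rcases lt_or_ge ρ δ with hlt | hge
  · have h1 := hball (y := x + ρ) (by simpa [abs_of_pos hρ] using hlt)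
    have h2 := hball (y := x - ρ) (by simpa [abs_of_pos hρ] using hlt)
    rw [add_sub_cancel_left, Real.norm_of_nonneg hρ.le] at h1
    rw [sub_sub_cancel_left, norm_neg, Real.norm_of_nonneg hρ.le] at h2
    calc ‖∫ s in (x - ρ)..(x + ρ), h s‖ = ‖(A (x + ρ) - A x) - (A (x - ρ) - A x)‖ := by
          rw [hAsub]; congr 1; ring
      _ ≤ C₁ * ρ + C₁ * ρ := (norm_sub_le _ _).trans (add_le_add h1 h2)
      _ = 2 * C₁ * ρ := by ring
      _ ≤ _ := by gcongr; exact le_max_left _ _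
  · have hab : x - ρ ≤ x + ρ := by linarith
    have hi : IntervalIntegrable (fun s => 1 + ‖h s‖ ^ 2) volume (x - ρ) (x + ρ) :=
      intervalIntegrable_const.add hsq.intervalIntegrable
    calc ‖∫ s in (x - ρ)..(x + ρ), h s‖
        ≤ ∫ s in (x - ρ)..(x + ρ), (1 + ‖h s‖ ^ 2) := by
          refine intervalIntegral.norm_integral_le_of_norm_le hab ?_ hi
          exact Eventually.of_forall fun s _ => by nlinarith [sq_nonneg (‖h s‖ - 1)]
      _ = 2 * ρ + ∫ s in (x - ρ)..(x + ρ), ‖h s‖ ^ 2 := by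
          rw [intervalIntegral.integral_add intervalIntegrable_const hsq.intervalIntegrable]
          simp only [intervalIntegral.integral_const, smul_eq_mul]
          ring
      _ ≤ 2 * ρ + M := by
          gcongr
          rw [intervalIntegral.integral_of_le hab]
          exact setIntegral_le_integral hsq (Eventually.of_forall fun s => by positivity)
      _ ≤ (2 + M / δ) * ρ := by
          have : M ≤ M / δ * ρ := by
            rw [div_mul_eq_mul_div, le_div_iff₀ hδ]
            gcongr
          linarith
      _ ≤ _ := by gcongr; exact le_max_right _ _

/-- Poisson integrals converge at every differentiability point of the primitive. -/
theorem tendsto_poisson {h : ℝ → ℂ} (hh : MemLp h 2 volume) {x : ℝ} {c : ℂ}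
    (hx : HasDerivAt (fun v => ∫ s in (0 : ℝ)..v, h s) c x) :
    Tendsto (fun y : ℝ => (Real.pi : ℂ)⁻¹ * ∫ u : ℝ, h (x + y * u) * ((1 / (1 + u ^ 2) : ℝ) : ℂ))
      (𝓝[>] 0) (𝓝 c) := by
  obtain ⟨C, hC⟩ := exists_bound_symm hh hx
  set A : ℝ → ℂ := fun v => ∫ s in (0 : ℝ)..v, h s with hA
  have hAsub (a b : ℝ) : ∫ s in a..b, h s = A b - A a :=
    (intervalIntegral.integral_interval_sub_left (intervalIntegrable_of_memLp_two hh _ _)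
      (intervalIntegrable_of_memLp_two hh _ _)).symm
  have hAc : Continuous A := intervalIntegral.continuous_primitive
    (fun a b => intervalIntegrable_of_memLp_two hh a b) 0
  have key : Tendsto (fun y : ℝ => ∫ r in Ioi (0 : ℝ), (mixDensity r : ℂ) *
        ((y : ℂ)⁻¹ * ∫ s in (x - y * r)..(x + y * r), h s)) (𝓝[>] 0)
      (𝓝 (∫ r in Ioi (0 : ℝ), (mixDensity r : ℂ) * (2 * r * c))) := by
    refine tendsto_integral_filter_of_dominated_convergence
      (fun r => mixDensity r * (2 * r) * (C / 2)) ?_ ?_ (integrableOn_mixDensity_mul.mul_const _) ?_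
    · refine Eventually.of_forall fun y => Continuous.aestronglyMeasurable ?_
      have h1 : Continuous fun r : ℝ => (mixDensity r : ℂ) :=
        Complex.continuous_ofReal.comp continuous_mixDensity
      simp only [hAsub]
      fun_prop
    -- the bound `‖∫ h‖ ≤ C y r` on the symmetric means gives an integrable majorant
    · filter_upwards [self_mem_nhdsWithin] with y hy
      have hy0 : (0 : ℝ) < y := hy
      refine (ae_restrict_iff' measurableSet_Ioi).2 (Eventually.of_forall fun r hr => ?_)
      have hr0 : (0 : ℝ) < r := hr
      rw [norm_mul, Complex.norm_real, Real.norm_of_nonneg (mixDensity_nonneg hr0.le), norm_mul,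
        norm_inv, Complex.norm_real, Real.norm_of_nonneg hy0.le, mul_assoc]
      refine mul_le_mul_of_nonneg_left ?_ (mixDensity_nonneg hr0.le)
      calc y⁻¹ * ‖∫ s in (x - y * r)..(x + y * r), h s‖ ≤ y⁻¹ * (C * (y * r)) := by
            gcongr; exact hC _ (by positivity)
        _ = 2 * r * (C / 2) := by field_simp
    · refine (ae_restrict_iff' measurableSet_Ioi).2 (Eventually.of_forall fun r hr => ?_)
      refine Tendsto.const_mul _ ?_
      have d1 : HasDerivAt (fun y : ℝ => A (x + y * r)) (r * c) 0 := by
        have hin : HasDerivAt (fun y : ℝ => x + y * r) r 0 := by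
          simpa using ((hasDerivAt_id (0 : ℝ)).mul_const r).const_add x
        have := HasDerivAt.scomp (𝕜' := ℝ) (h := fun y : ℝ => x + y * r) (g₁ := A) (0 : ℝ)
          (by simpa using hx) hin
        simpa [Function.comp_def] using this
      have d2 : HasDerivAt (fun y : ℝ => A (x - y * r)) (-(r * c)) 0 := by
        have hin : HasDerivAt (fun y : ℝ => x - y * r) (-r) 0 := by
          simpa using ((hasDerivAt_id (0 : ℝ)).mul_const r).const_sub x
        have := HasDerivAt.scomp (𝕜' := ℝ) (h := fun y : ℝ => x - y * r) (g₁ := A) (0 : ℝ)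
          (by simpa using hx) hin
        simpa [Function.comp_def] using this
      have d3 := (d1.sub d2).tendsto_slope_zero_right
      have e : (r : ℂ) * c - -(r * c) = 2 * r * c := by ring
      rw [e] at d3
      refine d3.congr fun y => ?_
      simp [hAsub, Complex.real_smul]
  have h2 : ∫ r in Ioi (0 : ℝ), (mixDensity r : ℂ) * (2 * r * c) = Real.pi * c := by
    have : ∀ r : ℝ, (mixDensity r : ℂ) * (2 * r * c) = ((mixDensity r * (2 * r) : ℝ) : ℂ) * c := by
      intro r; push_cast; ring
    simp only [this]
    rw [integral_mul_const, integral_complex_ofReal, integral_mixDensity_mul]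
  rw [h2] at key
  have h3 := key.const_mul (Real.pi : ℂ)⁻¹
  rw [← mul_assoc, inv_mul_cancel₀ (by exact_mod_cast Real.pi_ne_zero), one_mul] at h3
  refine h3.congr' ?_
  filter_upwards [self_mem_nhdsWithin] with y hy
  rw [poisson_eq_mix hh x hy]

/-- Boundary values exist at every differentiability point of the primitive of `bd f`, hence almost
everywhere by Lebesgue's theorem. -/
theorem ae_tendsto_hF (f : L2pos) :
    ∀ᵐ x : ℝ, Tendsto (fun y : ℝ => hF f (x + y * Complex.I)) (𝓝[>] 0) (𝓝 (bd f x)) := by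
  filter_upwards [LocallyIntegrable.ae_hasDerivAt_integral
    ((memLp_bd f).locallyIntegrable (by norm_num))] with x hx
  refine (tendsto_poisson (memLp_bd f) (hx 0)).congr' ?_
  filter_upwards [self_mem_nhdsWithin] with y hy
  exact (hF_eq_poisson f x hy).symm

theorem bdry_hF_ae_eq (f : L2pos) : bdry (hF f) =ᵐ[volume] bd f := by
  filter_upwards [ae_tendsto_hF f] with x hx
  exact hx.limUnder_eq

/-! ### Holomorphic functions on horizontal lines -/

theorem lintegral_enorm_sq_eq {α : Type*} [MeasurableSpace α] {μ : Measure α} (f : Lp ℂ 2 μ) :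
    ∫⁻ x, ‖f x‖ₑ ^ 2 ∂μ = ENNReal.ofReal (‖f‖ ^ 2) := by
  rw [norm_sq_eq_integral, ofReal_integral_eq_lintegral_ofReal
    ((memLp_two_iff_integrable_sq_norm (Lp.aestronglyMeasurable f)).1 (Lp.memLp f))
    (Eventually.of_forall fun x => by positivity)]
  simp only [ENNReal.ofReal_pow (norm_nonneg _), ofReal_norm]

theorem memLp_two_of_lintegral {α : Type*} [MeasurableSpace α] {μ : Measure α} {f : α → ℂ}
    (hm : AEStronglyMeasurable f μ) (h : ∫⁻ x, ‖f x‖ₑ ^ 2 ∂μ < ∞) : MemLp f 2 μ := by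
  refine ⟨hm, ?_⟩
  rw [eLpNorm_lt_top_iff_lintegral_rpow_enorm_lt_top (by norm_num) (by norm_num)]
  simpa using h

theorem mem_upper {x y : ℝ} (hy : 0 < y) : (x + y * Complex.I : ℂ) ∈ upperHalfPlaneSet := by
  simpa [upperHalfPlaneSet] using hy

theorem continuous_line {F : ℂ → ℂ} (hF : ContinuousOn F upperHalfPlaneSet) {y : ℝ} (hy : 0 < y) :
    Continuous fun x : ℝ => F (x + y * Complex.I) :=
  hF.comp_continuous (by fun_prop) fun _ => mem_upper hy

theorem MemH2.memLp_line {F : ℂ → ℂ} (hF : MemH2 F) {y : ℝ} (hy : 0 < y) :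
    MemLp (fun x : ℝ => F (x + y * Complex.I)) 2 volume :=
  memLp_two_of_lintegral (continuous_line hF.1.continuousOn hy).aestronglyMeasurable
    ((le_iSup₂ (f := fun (y : ℝ) (_ : 0 < y) =>
      ∫⁻ x : ℝ, ‖F (x + y * Complex.I)‖ₑ ^ 2) y hy).trans_lt hF.2)

theorem memLp_strip {G : ℂ → ℂ} (hG : ContinuousOn G upperHalfPlaneSet) {a b : ℝ} (ha : 0 < a)
    {C : ℝ≥0∞} (hC : C < ∞)
    (h : ∀ y ∈ Icc a b, ∫⁻ x : ℝ, ‖G (x + y * Complex.I)‖ₑ ^ 2 ≤ C) :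
    MemLp (fun p : ℝ × ℝ => G (p.1 + p.2 * Complex.I)) 2
      (volume.prod (volume.restrict (Icc a b))) := by
  have hm : AEStronglyMeasurable (fun p : ℝ × ℝ => G (p.1 + p.2 * Complex.I))
      (volume.prod (volume.restrict (Icc a b))) := by
    have : (volume : Measure ℝ).prod ((volume : Measure ℝ).restrict (Icc a b)) =
        (volume.prod volume).restrict (univ ×ˢ Icc a b) := by
      rw [← Measure.prod_restrict, Measure.restrict_univ]
    rw [this]
    refine ContinuousOn.aestronglyMeasurable ?_ (MeasurableSet.univ.prod measurableSet_Icc)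
    exact hG.comp (by fun_prop) fun p hp => mem_upper (ha.trans_le hp.2.1)
  refine memLp_two_of_lintegral hm ?_
  rw [lintegral_prod_symm _ (hm.enorm.pow_const 2)]
  calc ∫⁻ y in Icc a b, ∫⁻ x : ℝ, ‖G (x + y * Complex.I)‖ₑ ^ 2
      ≤ ∫⁻ y in Icc a b, C := setLIntegral_mono' measurableSet_Icc h
    _ < ∞ := by
      rw [setLIntegral_const]
      exact ENNReal.mul_lt_top hC measure_Icc_lt_top

/-- The integral over a horizontal line of a holomorphic function that is integrable over a strip
does not depend on the line. -/
theorem integral_line_eq {G : ℂ → ℂ} (hG : DifferentiableOn ℂ G upperHalfPlaneSet) {a b : ℝ}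
    (ha : 0 < a) (hab : a ≤ b)
    (hi : Integrable (fun p : ℝ × ℝ => G (p.1 + p.2 * Complex.I))
      (volume.prod (volume.restrict (Icc a b))))
    (hia : Integrable fun x : ℝ => G (x + a * Complex.I))
    (hib : Integrable fun x : ℝ => G (x + b * Complex.I)) :
    ∫ x : ℝ, G (x + a * Complex.I) = ∫ x : ℝ, G (x + b * Complex.I) := by
  set s : ℝ → ℂ := fun R => ∫ y in Icc a b, G (R + y * Complex.I) with hs
  have hsi : Integrable s := hi.integral_prod_left
  have hrect (R : ℝ) : (∫ x in (-R)..R, G (x + a * Complex.I)) -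
      (∫ x in (-R)..R, G (x + b * Complex.I)) = Complex.I * (s (-R) - s R) := by
    have h := Complex.integral_boundary_rect_eq_zero_of_differentiableOn G (⟨-R, a⟩ : ℂ)
      (⟨R, b⟩ : ℂ)
      (hG.mono fun z hz => by
        have h2 : z.im ∈ uIcc a b := hz.2
        rw [uIcc_of_le hab] at h2
        exact ha.trans_le h2.1)
    simp only [smul_eq_mul, intervalIntegral.integral_of_le hab,
      ← integral_Icc_eq_integral_Ioc] at h
    simp only [hs]
    linear_combination h
  have hlim := (intervalIntegral_tendsto_integral hia tendsto_neg_atTop_atBot tendsto_id).sub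
    (intervalIntegral_tendsto_integral hib tendsto_neg_atTop_atBot tendsto_id)
  simp only [id, hrect] at hlim
  have hint : Integrable fun R : ℝ => Complex.I * (s (-R) - s R) :=
    (hsi.comp_neg.sub hsi).const_mul _
  -- the side integrals have a limit and are integrable in `R`, so the limit is zero
  have hz := IntegrableAtFilter.eq_zero_of_tendsto (hint.integrableAtFilter atTop) (fun u hu => ?_)
    hlim
  · exact sub_eq_zero.1 hz
  · obtain ⟨c, hc⟩ := mem_atTop_sets.1 hu
    exact eq_top_mono (measure_mono (t := u) (s := Ici c) hc) Real.volume_Ici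

/-- The entire function `z ↦ ∫ θ(t) e^{-itz} dt`, for a test function `θ`. -/
def testTransform (θ : ℝ → ℝ) (z : ℂ) : ℂ := ∫ t : ℝ, (θ t : ℂ) * Complex.exp (-(Complex.I * t * z))

theorem differentiable_testTransform {θ : ℝ → ℝ} (hc : Continuous θ) (hs : HasCompactSupport θ) :
    Differentiable ℂ (testTransform θ) := by
  intro z
  have hint {k : ℝ → ℂ} (hk : Continuous k) : Integrable fun t => (θ t : ℂ) * k t :=
    Continuous.integrable_of_hasCompactSupport (by fun_prop)
      ((hs.comp_left (g := fun x : ℝ => (x : ℂ)) rfl).mul_right)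
  refine (hasDerivAt_integral_of_dominated_loc_of_deriv_le (s := Metric.ball z 1)
    (bound := fun t => ‖(θ t : ℂ) * (t * Real.exp (|t| * (‖z‖ + 1)) : ℝ)‖)
    (F' := fun w t => (θ t : ℂ) * (-(Complex.I * t) * Complex.exp (-(Complex.I * t * w))))
    (Metric.ball_mem_nhds z one_pos) ?_ (hint (by fun_prop)) ?_ ?_ (hint (by fun_prop)).norm
    ?_).2.differentiableAt
  · exact Eventually.of_forall fun w => (hint (by fun_prop)).1
  · exact (hint (by fun_prop)).1
  · refine Eventually.of_forall fun t w hw => ?_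
    have hw' : ‖w‖ ≤ ‖z‖ + 1 := by
      have h1 : ‖w - z‖ < 1 := by simpa [dist_eq_norm] using hw
      have h2 := norm_sub_norm_le w z
      linarith
    simp only [norm_mul, norm_neg, Complex.norm_I, one_mul, Complex.norm_real, Real.norm_eq_abs,
      Complex.norm_exp]
    rw [abs_of_pos (Real.exp_pos _)]
    gcongr
    have h3 : (-(Complex.I * t * w)).re ≤ ‖Complex.I * t * w‖ := by
      rw [← norm_neg]; exact Complex.re_le_norm _
    refine h3.trans ?_
    simp only [norm_mul, Complex.norm_I, one_mul, Complex.norm_real, Real.norm_eq_abs]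
    gcongr
  · refine Eventually.of_forall fun t w _ => ?_
    have := (((hasDerivAt_id w).const_mul (Complex.I * t)).neg).cexp.const_mul (θ t : ℂ)
    convert! this using 1
    simp only [id, mul_one, Pi.neg_apply]
    ring

theorem testTransform_eq (θ : ℝ → ℝ) (w y : ℝ) :
    testTransform θ ((2 * Real.pi * w : ℝ) + y * Complex.I) =
      conj (𝓕⁻ (fun t : ℝ => ((Real.exp (y * t) * θ t : ℝ) : ℂ)) w) := by
  rw [Real.fourierInv_eq', testTransform, ← integral_conj]
  refine integral_congr_ae (Eventually.of_forall fun t => ?_)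
  simp only [smul_eq_mul, map_mul, Complex.conj_ofReal, ← Complex.exp_conj, Complex.conj_I]
  rw [Complex.ofReal_mul (Real.exp _), Complex.ofReal_exp, ← mul_assoc, ← Complex.exp_add, mul_comm]
  congr 2
  rw [RCLike.inner_apply, conj_trivial]
  push_cast
  linear_combination (-(t : ℂ) * y) * Complex.I_sq

theorem integrable_exp_mul_test {θ : ℝ → ℝ} (hc : Continuous θ)
    (hs : HasCompactSupport θ) (y : ℝ) :
    Integrable (fun t : ℝ => ((Real.exp (y * t) * θ t : ℝ) : ℂ)) :=
  (Continuous.integrable_of_hasCompactSupport (by fun_prop) hs.mul_left).ofReal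

theorem memLp_exp_mul_test {θ : ℝ → ℝ} (hc : Continuous θ)
    (hs : HasCompactSupport θ) (y : ℝ) :
    MemLp (fun t : ℝ => ((Real.exp (y * t) * θ t : ℝ) : ℂ)) 2 volume :=
  (Continuous.memLp_of_hasCompactSupport (μ := volume) (p := 2)
    (f := fun t : ℝ => Real.exp (y * t) * θ t) (by fun_prop) hs.mul_left).ofReal

theorem testTransform_ae_eq {θ : ℝ → ℝ} (hc : Continuous θ)
    (hs : HasCompactSupport θ) (y : ℝ) :
    (fun w : ℝ => testTransform θ ((2 * Real.pi * w : ℝ) + y * Complex.I)) =ᵐ[volume]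
      fun w => conj ((𝓕⁻ ((memLp_exp_mul_test hc hs y).toLp _) :
        Lp ℂ 2 (volume : Measure ℝ)) w) := by
  filter_upwards [fourierInv_toLp_ae_eq (integrable_exp_mul_test hc hs y)
    (memLp_exp_mul_test hc hs y)] with w hw
  rw [hw, testTransform_eq]

/-! ### The Paley–Wiener theorem -/

theorem lintegral_enorm_sq_scale {h : ℝ → ℂ} (hh : MemLp h 2 volume) :
    ∫⁻ x : ℝ, ‖h x‖ₑ ^ 2 = ENNReal.ofReal (2 * Real.pi) * ∫⁻ w : ℝ, ‖h (2 * Real.pi * w)‖ₑ ^ 2 := by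
  have h1 := (memLp_two_iff_integrable_sq_norm hh.1).1 hh
  have h2 := h1.comp_mul_left' two_pi_ne_zero
  have key : ∫ x : ℝ, ‖h x‖ ^ 2 = 2 * Real.pi * ∫ w : ℝ, ‖h (2 * Real.pi * w)‖ ^ 2 := by
    rw [Measure.integral_comp_mul_left (fun x => ‖h x‖ ^ 2) (2 * Real.pi),
      abs_of_pos (by positivity), smul_eq_mul]
    field_simp
  have e (k : ℝ → ℂ) : ∀ x, ‖k x‖ₑ ^ 2 = ENNReal.ofReal (‖k x‖ ^ 2) := fun x => by
    rw [ENNReal.ofReal_pow (norm_nonneg _), ofReal_norm]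
  simp only [e h]
  rw [← ofReal_integral_eq_lintegral_ofReal h1 (Eventually.of_forall fun x => by positivity),
    ← ofReal_integral_eq_lintegral_ofReal h2 (Eventually.of_forall fun x => by positivity),
    key, ENNReal.ofReal_mul (by positivity)]

theorem lintegral_testTransform_le {θ : ℝ → ℝ} (hc : Continuous θ) (hs : HasCompactSupport θ)
    (a b : ℝ) : ∃ C < ∞, ∀ y ∈ Icc a b,
      ∫⁻ x : ℝ, ‖testTransform θ (x + y * Complex.I)‖ₑ ^ 2 ≤ C := by
  set bnd : ℝ → ℝ := fun t => (Real.exp (a * t) + Real.exp (b * t)) * θ t with hb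
  have hbL : MemLp (fun t => ((bnd t : ℝ) : ℂ)) 2 volume :=
    (Continuous.memLp_of_hasCompactSupport (μ := volume) (p := 2) (f := bnd) (by fun_prop)
      hs.mul_left).ofReal
  have hbi : ∫⁻ t, ‖((bnd t : ℝ) : ℂ)‖ₑ ^ 2 < ∞ := by
    have := (eLpNorm_lt_top_iff_lintegral_rpow_enorm_lt_top (by norm_num) (by norm_num)).1 hbL.2
    simpa using this
  refine ⟨ENNReal.ofReal (2 * Real.pi) * ∫⁻ t, ‖((bnd t : ℝ) : ℂ)‖ₑ ^ 2,
    ENNReal.mul_lt_top ENNReal.ofReal_lt_top hbi, fun y hy => ?_⟩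
  set u : Lp ℂ 2 (volume : Measure ℝ) := (memLp_exp_mul_test hc hs y).toLp _ with hu
  have hnorm : ∫⁻ w : ℝ, ‖testTransform θ ((2 * Real.pi * w : ℝ) + y * Complex.I)‖ₑ ^ 2 ≤
      ∫⁻ t, ‖((bnd t : ℝ) : ℂ)‖ₑ ^ 2 := by
    calc ∫⁻ w : ℝ, ‖testTransform θ ((2 * Real.pi * w : ℝ) + y * Complex.I)‖ₑ ^ 2
        = ∫⁻ w : ℝ, ‖(𝓕⁻ u : Lp ℂ 2 (volume : Measure ℝ)) w‖ₑ ^ 2 := by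
          refine lintegral_congr_ae ?_
          filter_upwards [testTransform_ae_eq hc hs y] with w hw
          rw [hw, RCLike.enorm_conj]
      _ = ∫⁻ t, ‖u t‖ₑ ^ 2 := by
          rw [lintegral_enorm_sq_eq, lintegral_enorm_sq_eq]
          congr 2
          exact (Lp.fourierTransformₗᵢ ℝ ℂ).symm.norm_map u
      _ ≤ ∫⁻ t, ‖((bnd t : ℝ) : ℂ)‖ₑ ^ 2 := by
          refine lintegral_mono_ae ?_
          filter_upwards [(memLp_exp_mul_test hc hs y).coeFn_toLp] with t ht
          rw [hu, ht, hb]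
          gcongr
          rw [enorm_le_iff_norm_le, Complex.norm_real, Complex.norm_real, norm_mul, norm_mul,
            Real.norm_of_nonneg (Real.exp_pos (y * t)).le,
            Real.norm_of_nonneg (show 0 ≤ Real.exp (a * t) + Real.exp (b * t) by positivity)]
          gcongr
          rcases le_total 0 t with h0 | h0
          · have : Real.exp (y * t) ≤ Real.exp (b * t) :=
              Real.exp_le_exp.2 (mul_le_mul_of_nonneg_right hy.2 h0)
            linarith [Real.exp_pos (a * t)]
          · have : Real.exp (y * t) ≤ Real.exp (a * t) :=
              Real.exp_le_exp.2 (mul_le_mul_of_nonpos_right hy.1 h0)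
            linarith [Real.exp_pos (b * t)]
  by_cases hfin : MemLp (fun x : ℝ => testTransform θ (x + y * Complex.I)) 2 volume
  · rw [lintegral_enorm_sq_scale hfin]
    gcongr
  · exfalso
    apply hfin
    have hm : Continuous fun x : ℝ => testTransform θ (x + y * Complex.I) :=
      (differentiable_testTransform hc hs).continuous.comp (by fun_prop)
    have h1 : MemLp (fun w : ℝ => testTransform θ ((2 * Real.pi * w : ℝ) + y * Complex.I)) 2
        volume :=
      memLp_two_of_lintegral (hm.comp (f := fun w : ℝ => 2 * Real.pi * w)
        (by fun_prop)).aestronglyMeasurable (hnorm.trans_lt hbi)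
    have h2 := memLp_comp_add_mul h1 0 (y := (2 * Real.pi)⁻¹) (by positivity)
    refine h2.congr_norm hm.aestronglyMeasurable (Eventually.of_forall fun x => ?_)
    congr 3
    have := Real.pi_ne_zero
    field_simp
    simp

section

variable {F : ℂ → ℂ}

theorem MemH2.memLp_scaled (hF : MemH2 F) {y : ℝ} (hy : 0 < y) :
    MemLp (fun w : ℝ => F ((2 * Real.pi * w : ℝ) + y * Complex.I)) 2 volume := by
  have := memLp_comp_add_mul (hF.memLp_line hy) 0 (y := 2 * Real.pi) (by positivity)
  simpa only [zero_add] using this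

/-- The spectral function of `F ∈ H₂` on the line at height `y`: the `L²` Fourier transform of
`w ↦ F(2πw + iy)`. -/
def spec (hF : MemH2 F) {y : ℝ} (hy : 0 < y) : Lp ℂ 2 (volume : Measure ℝ) :=
  𝓕 ((hF.memLp_scaled hy).toLp _)

theorem fourierInv_spec (hF : MemH2 F) {y : ℝ} (hy : 0 < y) :
    𝓕⁻ (spec hF hy) = (hF.memLp_scaled hy).toLp _ :=
  (Lp.fourierTransformₗᵢ ℝ ℂ).symm_apply_apply _

theorem integral_spec_mul_test (hF : MemH2 F) {θ : ℝ → ℝ} (hc : Continuous θ)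
    (hs : HasCompactSupport θ) {y : ℝ} (hy : 0 < y) :
    ∫ t, θ t • ((Real.exp (y * t) : ℂ) * spec hF hy t) =
      ((2 * Real.pi : ℝ) : ℂ)⁻¹ *
        ∫ x : ℝ, (F * testTransform θ) (x + y * Complex.I) := by
  set u : Lp ℂ 2 (volume : Measure ℝ) := (memLp_exp_mul_test hc hs y).toLp _ with hu
  have h1 : inner ℂ (𝓕⁻ u) (𝓕⁻ (spec hF hy)) = inner ℂ u (spec hF hy) :=
    (Lp.fourierTransformₗᵢ ℝ ℂ).symm.inner_map_map _ _
  have h2 : inner ℂ u (spec hF hy) = ∫ t, θ t • ((Real.exp (y * t) : ℂ) * spec hF hy t) := by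
    rw [inner_eq_integral]
    refine integral_congr_ae ?_
    filter_upwards [(memLp_exp_mul_test hc hs y).coeFn_toLp] with t ht
    rw [hu, ht, Complex.conj_ofReal, Complex.real_smul]
    push_cast
    ring
  have h3 : inner ℂ (𝓕⁻ u) (𝓕⁻ (spec hF hy)) =
      ∫ w : ℝ, (F * testTransform θ) ((2 * Real.pi * w : ℝ) + y * Complex.I) := by
    rw [inner_eq_integral, fourierInv_spec]
    refine integral_congr_ae ?_
    filter_upwards [(hF.memLp_scaled hy).coeFn_toLp, testTransform_ae_eq hc hs y] with w e1 e2
    rw [e1, Pi.mul_apply, e2]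
  rw [← h2, ← h1, h3, Measure.integral_comp_mul_left
    (fun x : ℝ => (F * testTransform θ) (x + y * Complex.I)) (2 * Real.pi),
    abs_of_pos (by positivity), Complex.real_smul, Complex.ofReal_inv]

/-- Pairings of `F` with the transform of a test function do not depend on the height of the line:
the transform is entire and square integrable on lines, locally uniformly in the height. -/
theorem integral_mul_testTransform_eq (hF : MemH2 F) {θ : ℝ → ℝ} (hc : Continuous θ)
    (hs : HasCompactSupport θ) {a b : ℝ} (ha : 0 < a) (hab : a ≤ b) :
    ∫ x : ℝ, (F * testTransform θ) (x + a * Complex.I) =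
      ∫ x : ℝ, (F * testTransform θ) (x + b * Complex.I) := by
  obtain ⟨C, hC, hle⟩ := lintegral_testTransform_le hc hs a b
  have hd := differentiable_testTransform hc hs
  have hl (y : ℝ) (hy : y ∈ Icc a b) :
      Integrable fun x : ℝ => (F * testTransform θ) (x + y * Complex.I) :=
    (hF.memLp_line (ha.trans_le hy.1)).integrable_mul
      (memLp_two_of_lintegral (hd.continuous.comp
        (f := fun x : ℝ => (x + y * Complex.I : ℂ)) (by fun_prop)).aestronglyMeasurable
        ((hle y hy).trans_lt hC))
  refine integral_line_eq (hF.1.mul hd.differentiableOn) ha hab ?_ (hl a (left_mem_Icc.2 hab))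
    (hl b (right_mem_Icc.2 hab))
  exact (memLp_strip hF.1.continuousOn ha hF.2 fun y hy =>
    le_iSup₂ (f := fun (y : ℝ) (_ : 0 < y) => ∫⁻ x : ℝ, ‖F (x + y * Complex.I)‖ₑ ^ 2) y
      (ha.trans_le hy.1)).integrable_mul (memLp_strip hd.continuous.continuousOn ha hC hle)

/-- The function `e^{yt} spec(t)` does not depend on `y`, because its pairings with test
functions do not. -/
theorem exp_mul_spec_ae_eq (hF : MemH2 F) {a b : ℝ} (ha : 0 < a) (hb : 0 < b) :
    (fun t : ℝ => (Real.exp (a * t) : ℂ) * spec hF ha t) =ᵐ[volume]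
      fun t : ℝ => (Real.exp (b * t) : ℂ) * spec hF hb t := by
  wlog hab : a ≤ b generalizing a b
  · exact (this hb ha (le_of_not_ge hab)).symm
  have hli (y : ℝ) (hy : 0 < y) :
      LocallyIntegrable (fun t : ℝ => (Real.exp (y * t) : ℂ) * spec hF hy t) volume := by
    have := ((Lp.memLp (spec hF hy)).locallyIntegrable (by norm_num))
    rw [← locallyIntegrableOn_univ] at this ⊢
    exact this.continuousOn_mul (Continuous.continuousOn (by fun_prop)) isOpen_univ.isLocallyClosed
  refine ae_eq_of_integral_contDiff_smul_eq (hli a ha) (hli b hb) fun θ hθ hs => ?_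
  rw [integral_spec_mul_test hF hθ.continuous hs, integral_spec_mul_test hF hθ.continuous hs,
    integral_mul_testTransform_eq hF hθ.continuous hs ha hab]

theorem lintegral_spec_le (hF : MemH2 F) {y : ℝ} (hy : 0 < y) :
    ∫⁻ t, ‖spec hF hy t‖ₑ ^ 2 ≤ (ENNReal.ofReal (2 * Real.pi))⁻¹ * hardySup F := by
  have h1 : ∫⁻ t, ‖spec hF hy t‖ₑ ^ 2 =
      ∫⁻ w : ℝ, ‖F ((2 * Real.pi * w : ℝ) + y * Complex.I)‖ₑ ^ 2 := by
    calc ∫⁻ t, ‖spec hF hy t‖ₑ ^ 2 = ∫⁻ w, ‖((hF.memLp_scaled hy).toLp _) w‖ₑ ^ 2 := by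
          rw [lintegral_enorm_sq_eq, lintegral_enorm_sq_eq]
          congr 2
          exact (Lp.fourierTransformₗᵢ ℝ ℂ).norm_map _
      _ = _ := lintegral_congr_ae ((hF.memLp_scaled hy).coeFn_toLp.mono fun w hw => by
          simp only [hw])
  have h2 := lintegral_enorm_sq_scale (hF.memLp_line hy)
  have h3 := le_iSup₂ (f := fun (y : ℝ) (_ : 0 < y) =>
    ∫⁻ x : ℝ, ‖F (x + y * Complex.I)‖ₑ ^ 2) y hy
  simp only [h2] at h3
  have hp : ENNReal.ofReal (2 * Real.pi) ≠ 0 := by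
    rw [Ne, ENNReal.ofReal_eq_zero, not_le]; positivity
  rw [h1, mul_comm (ENNReal.ofReal _)⁻¹, ← div_eq_mul_inv,
    ENNReal.le_div_iff_mul_le (Or.inl hp) (Or.inl ENNReal.ofReal_ne_top)]
  exact (mul_comm _ _).trans_le h3

/-- The Paley–Wiener theorem: every function in `H₂` is a holomorphic Fourier transform. -/
theorem MemH2.exists_hF_eq (hF : MemH2 F) :
    ∃ f : L2pos, EqOn F (PaleyWiener.hF f) upperHalfPlaneSet := by
  set C : ℝ≥0∞ := (ENNReal.ofReal (2 * Real.pi))⁻¹ * hardySup F with hC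
  have hCfin : C < ∞ := by
    refine ENNReal.mul_lt_top ?_ hF.2
    rw [ENNReal.inv_lt_top, ENNReal.ofReal_pos]; positivity
  -- the factor `1 *` is the height `y = 1` in the form of `exp_mul_spec_ae_eq`
  set f : ℝ → ℂ := fun t => (Real.exp (1 * t) : ℂ) * spec hF one_pos t with hf
  have hfm : Measurable f := by
    have h := (Lp.stronglyMeasurable (spec hF one_pos)).measurable
    exact Measurable.mul (by fun_prop) h
  have hspec (y : ℝ) (hy : 0 < y) :
      (fun t : ℝ => (Real.exp (-(y * t)) : ℂ) * f t) =ᵐ[volume] spec hF hy := by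
    filter_upwards [exp_mul_spec_ae_eq hF one_pos hy] with t ht
    rw [hf]
    simp only [ht]
    rw [← mul_assoc, ← Complex.ofReal_mul, ← Real.exp_add]
    simp
  clear_value f
  have hle (y : ℝ) (hy : 0 < y) : ∫⁻ t, ‖(Real.exp (-(y * t)) : ℂ) * f t‖ₑ ^ 2 ≤ C := by
    refine le_trans (le_of_eq ?_) (lintegral_spec_le hF hy)
    exact lintegral_congr_ae ((hspec y hy).mono fun t ht => by simp only [ht])
  have hmeas (y : ℝ) : Measurable fun t : ℝ => ‖(Real.exp (-(y * t)) : ℂ) * f t‖ₑ ^ 2 :=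
    ((Measurable.mul (by fun_prop) hfm).enorm).pow_const 2
  -- letting `y → ∞`, `f` vanishes on the negative half-line
  have hneg : ∀ᵐ t : ℝ, t < 0 → f t = 0 := by
    have hlim : ∫⁻ t, liminf (fun n : ℕ => ‖(Real.exp (-((n + 1 : ℝ) * t)) : ℂ) * f t‖ₑ ^ 2) atTop
        ≤ C := by
      refine (lintegral_liminf_le fun n => hmeas _).trans ?_
      refine liminf_le_of_le (by isBoundedDefault) fun b hb => ?_
      obtain ⟨n, hn⟩ := hb.exists
      exact hn.trans (hle _ (by positivity))
    have hfin := ae_lt_top (Measurable.liminf fun n => hmeas _) (hlim.trans_lt hCfin).ne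
    filter_upwards [hfin] with t ht ht0
    by_contra hne
    apply ht.ne
    apply Tendsto.liminf_eq
    have h1 : Tendsto (fun n : ℕ => Real.exp (-((n + 1 : ℝ) * t)) * ‖f t‖) atTop atTop := by
      refine Tendsto.atTop_mul_const (norm_pos_iff.2 hne) (Real.tendsto_exp_atTop.comp ?_)
      have : Tendsto (fun n : ℕ => (n + 1 : ℝ) * (-t)) atTop atTop :=
        (tendsto_atTop_add_const_right _ _ tendsto_natCast_atTop_atTop).atTop_mul_const
          (by linarith)
      simpa only [mul_neg] using this
    have h2 := ENNReal.tendsto_ofReal_atTop.comp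
      ((tendsto_pow_atTop (α := ℝ) two_ne_zero).comp h1)
    refine h2.congr fun n => ?_
    simp only [Function.comp_apply]
    rw [ENNReal.ofReal_pow (by positivity), ← ofReal_norm, norm_mul, Complex.norm_real,
      Real.norm_of_nonneg (Real.exp_pos _).le]
  -- letting `y → 0`, `f` is square integrable
  have hL2 : MemLp f 2 volume := by
    refine memLp_two_of_lintegral hfm.aestronglyMeasurable (lt_of_le_of_lt ?_ hCfin)
    have hlim : ∫⁻ t, liminf (fun n : ℕ => ‖(Real.exp (-((1 / (n + 1) : ℝ) * t)) : ℂ) * f t‖ₑ ^ 2)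
        atTop ≤ C := by
      refine (lintegral_liminf_le fun n => hmeas _).trans ?_
      refine liminf_le_of_le (by isBoundedDefault) fun b hb => ?_
      obtain ⟨n, hn⟩ := hb.exists
      exact hn.trans (hle _ (by positivity))
    refine le_trans (le_of_eq ?_) hlim
    refine lintegral_congr fun t => (Tendsto.liminf_eq ?_).symm
    have hc : Continuous fun y : ℝ => ‖(Real.exp (-(y * t)) : ℂ) * f t‖ₑ ^ 2 := by fun_prop
    have h2 := (hc.tendsto 0).comp (tendsto_one_div_add_atTop_nhds_zero_nat (𝕜 := ℝ))
    simpa [Function.comp_def] using h2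
  have hL2' : MemLp f 2 posMeasure := hL2.restrict _
  set g : L2pos := hL2'.toLp f with hg
  refine ⟨g, ?_⟩
  have hline (y : ℝ) (hy : 0 < y) : (fun x : ℝ => F (x + y * Complex.I)) =
      fun x : ℝ => PaleyWiener.hF g (x + y * Complex.I) := by
    refine (Continuous.ae_eq_iff_eq volume (continuous_line hF.1.continuousOn hy)
      (continuous_line (differentiableOn_hF (Lp.memLp g)).continuousOn hy)).1 ?_
    have hext : extZero (damp y hy.le g) = spec hF hy := by
      apply Lp.ext
      filter_upwards [coeFn_extZero (damp y hy.le g), hspec y hy, hneg,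
        (ae_restrict_iff' measurableSet_Ioi).1 (coeFn_damp hy.le g),
        (ae_restrict_iff' measurableSet_Ioi).1 hL2'.coeFn_toLp, Measure.ae_ne volume (0 : ℝ)]
        with t e1 e2 e3 e4 e5 e6
      rw [e1, ← e2]
      by_cases ht : t ∈ Ioi (0 : ℝ)
      · rw [indicator_of_mem ht, e4 ht, hg, e5 ht]
      · rw [indicator_of_notMem ht, e3 (lt_of_le_of_ne (not_lt.1 ht) e6), mul_zero]
    have h4 := (quasiMeasurePreserving_div two_pi_ne_zero).ae_eq_comp
      (hF.memLp_scaled hy).coeFn_toLp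
    filter_upwards [hF_ae_eq_bd g hy, h4] with x e1 e2
    rw [e1, bd, hext, fourierInv_spec]
    refine Eq.trans ?_ e2.symm
    simp only [Function.comp_apply]
    rw [mul_div_cancel₀ x two_pi_ne_zero]
  intro z hz
  have := congrFun (hline z.im hz) z.re
  simpa [Complex.re_add_im] using this

end

/-- The boundary function determines `f`, by Plancherel's identity. -/
theorem hF_injective {f g : L2pos} (h : EqOn (hF f) (hF g) upperHalfPlaneSet) : f = g := by
  have h1 : bd f =ᵐ[volume] bd g := by
    filter_upwards [ae_tendsto_hF f, ae_tendsto_hF g] with x e1 e2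
    refine tendsto_nhds_unique (e1.congr' ?_) e2
    filter_upwards [self_mem_nhdsWithin] with y hy
    exact h (mem_upper hy)
  have h2 := integral_norm_sq_bd (f - g)
  have h3 : ∫ x, ‖bd (f - g) x‖ ^ 2 = 0 := by
    have : (fun x => ‖bd (f - g) x‖ ^ 2) =ᵐ[volume] fun _ => (0 : ℝ) := by
      filter_upwards [bd_sub f g, h1] with x e1 e2
      rw [e1, e2, sub_self, norm_zero]
      norm_num
    rw [integral_congr_ae this, integral_zero]
  rw [h3] at h2
  have h4 : ‖f - g‖ ^ 2 = 0 := by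
    have := Real.pi_pos
    by_contra hne
    have h5 : 0 < ‖f - g‖ ^ 2 := lt_of_le_of_ne (sq_nonneg _) (Ne.symm hne)
    have : 0 < 2 * Real.pi * ‖f - g‖ ^ 2 := by positivity
    linarith
  exact sub_eq_zero.1 (norm_eq_zero.1 (pow_eq_zero_iff two_ne_zero |>.1 h4))

end Fourier

/-! ### Fubini on the triangle `a < t < s` -/

theorem lintegral_mul_tail {κ ω : ℝ → ℝ≥0∞} (a : ℝ) (hκ : AEMeasurable κ (volume.restrict (Ioi a)))
    (hω : AEMeasurable ω (volume.restrict (Ioi a))) :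
    ∫⁻ t in Ioi a, κ t * ∫⁻ s in Ioi t, ω s = ∫⁻ s in Ioi a, ω s * ∫⁻ t in Ioo a s, κ t := by
  have hmeas : AEMeasurable (Function.uncurry fun t s : ℝ =>
      indicator {p : ℝ × ℝ | p.1 < p.2} (fun p => κ p.1 * ω p.2) (t, s))
      ((volume.restrict (Ioi a)).prod (volume.restrict (Ioi a))) := by
    refine AEMeasurable.indicator ?_ (measurableSet_lt measurable_fst measurable_snd)
    exact (hκ.comp_fst).mul (hω.comp_snd)
  have h := lintegral_lintegral_swap hmeas
  have e1 : ∀ t ∈ Ioi a, ∫⁻ s in Ioi a, indicator {p : ℝ × ℝ | p.1 < p.2}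
      (fun p => κ p.1 * ω p.2) (t, s) = κ t * ∫⁻ s in Ioi t, ω s := by
    intro t ht
    have : (fun s => indicator {p : ℝ × ℝ | p.1 < p.2} (fun p => κ p.1 * ω p.2) (t, s)) =
        indicator (Ioi t) fun s => κ t * ω s := by
      ext s; simp [indicator]
    rw [this, setLIntegral_indicator measurableSet_Ioi,
      inter_eq_left.2 (Ioi_subset_Ioi (le_of_lt ht)), lintegral_const_mul'']
    exact hω.mono_measure (Measure.restrict_mono (Ioi_subset_Ioi (le_of_lt ht)) le_rfl)
  have e2 : ∀ s ∈ Ioi a, ∫⁻ t in Ioi a, indicator {p : ℝ × ℝ | p.1 < p.2}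
      (fun p => κ p.1 * ω p.2) (t, s) = ω s * ∫⁻ t in Ioo a s, κ t := by
    intro s hs
    have : (fun t => indicator {p : ℝ × ℝ | p.1 < p.2} (fun p => κ p.1 * ω p.2) (t, s)) =
        indicator (Iio s) fun t => ω s * κ t := by
      ext t; simp [indicator, mul_comm]
    rw [this, setLIntegral_indicator measurableSet_Iio, inter_comm, Ioi_inter_Iio,
      lintegral_const_mul'']
    exact hκ.mono_measure (Measure.restrict_mono Ioo_subset_Ioi_self le_rfl)
  rw [setLIntegral_congr_fun measurableSet_Ioi e1, setLIntegral_congr_fun measurableSet_Ioi e2] at h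
  exact h

theorem integral_tail_swap {k : ℝ → ℝ → ℂ} {a : ℝ}
    (hi : Integrable (indicator {p : ℝ × ℝ | p.1 < p.2} (Function.uncurry k))
      ((volume.restrict (Ioi a)).prod (volume.restrict (Ioi a)))) :
    (∫ t in Ioi a, ∫ s in Ioi t, k t s = ∫ s in Ioi a, ∫ t in Ioo a s, k t s) ∧
      IntegrableOn (fun s => ∫ t in Ioo a s, k t s) (Ioi a) := by
  have e1 : ∀ t ∈ Ioi a, ∫ s in Ioi a, indicator {p : ℝ × ℝ | p.1 < p.2}
      (Function.uncurry k) (t, s) = ∫ s in Ioi t, k t s := by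
    intro t ht
    have : (fun s => indicator {p : ℝ × ℝ | p.1 < p.2} (Function.uncurry k) (t, s)) =
        indicator (Ioi t) fun s => k t s := by
      ext s; simp [indicator]
    rw [this, setIntegral_indicator measurableSet_Ioi,
      inter_eq_right.2 (Ioi_subset_Ioi (le_of_lt ht))]
  have e2 : ∀ s ∈ Ioi a, ∫ t in Ioi a, indicator {p : ℝ × ℝ | p.1 < p.2}
      (Function.uncurry k) (t, s) = ∫ t in Ioo a s, k t s := by
    intro s hs
    have : (fun t => indicator {p : ℝ × ℝ | p.1 < p.2} (Function.uncurry k) (t, s)) =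
        indicator (Iio s) fun t => k t s := by
      ext t; simp [indicator]
    rw [this, setIntegral_indicator measurableSet_Iio, Ioi_inter_Iio]
  refine ⟨?_, ?_⟩
  · have h := integral_integral_swap
      (f := fun t s => indicator {p : ℝ × ℝ | p.1 < p.2} (Function.uncurry k) (t, s)) hi
    rw [setIntegral_congr_fun measurableSet_Ioi e1, setIntegral_congr_fun measurableSet_Ioi e2] at h
    exact h
  · exact IntegrableOn.congr_fun hi.integral_prod_right e2 measurableSet_Ioi

theorem integral_mul_tail {κ ω : ℝ → ℂ} {a : ℝ}
    (hκ : AEStronglyMeasurable κ (volume.restrict (Ioi a)))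
    (hω : AEStronglyMeasurable ω (volume.restrict (Ioi a)))
    (h1 : ∀ t > a, IntegrableOn ω (Ioi t))
    (h2 : IntegrableOn (fun t => ‖κ t‖ * ∫ s in Ioi t, ‖ω s‖) (Ioi a)) :
    (∫ t in Ioi a, κ t * ∫ s in Ioi t, ω s = ∫ s in Ioi a, ω s * ∫ t in Ioo a s, κ t) ∧
      IntegrableOn (fun s => ω s * ∫ t in Ioo a s, κ t) (Ioi a) := by
  have hm : AEStronglyMeasurable (indicator {p : ℝ × ℝ | p.1 < p.2}
      (Function.uncurry fun t s => κ t * ω s))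
      ((volume.restrict (Ioi a)).prod (volume.restrict (Ioi a))) :=
    AEStronglyMeasurable.indicator ((hκ.comp_fst).mul (hω.comp_snd))
      (measurableSet_lt measurable_fst measurable_snd)
  have e0 (t : ℝ) : (fun s => indicator {p : ℝ × ℝ | p.1 < p.2}
      (Function.uncurry fun t s => κ t * ω s) (t, s)) = indicator (Ioi t) fun s => κ t * ω s := by
    ext s; simp [indicator]
  have hi : Integrable (indicator {p : ℝ × ℝ | p.1 < p.2}
      (Function.uncurry fun t s => κ t * ω s))
      ((volume.restrict (Ioi a)).prod (volume.restrict (Ioi a))) := by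
    rw [integrable_prod_iff hm]
    constructor
    · refine (ae_restrict_iff' measurableSet_Ioi).2 (Eventually.of_forall fun t ht => ?_)
      rw [e0, integrable_indicator_iff measurableSet_Ioi, IntegrableOn,
        Measure.restrict_restrict measurableSet_Ioi,
        inter_eq_left.2 (Ioi_subset_Ioi (le_of_lt ht))]
      exact (h1 t ht).const_mul _
    · refine IntegrableOn.congr_fun h2 (fun t ht => ?_) measurableSet_Ioi
      have hE : ∀ s, ‖indicator {p : ℝ × ℝ | p.1 < p.2}
          (Function.uncurry fun t s => κ t * ω s) (t, s)‖ =
          indicator (Ioi t) (fun s => ‖κ t‖ * ‖ω s‖) s := fun s => by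
        rw [norm_indicator_eq_indicator_norm]; simp [indicator]
      simp only [hE]
      rw [setIntegral_indicator measurableSet_Ioi,
        inter_eq_right.2 (Ioi_subset_Ioi (le_of_lt ht)), integral_const_mul]
  obtain ⟨h3, h4⟩ := integral_tail_swap hi
  simp only [integral_const_mul, integral_mul_const] at h3 h4
  simp only [mul_comm (∫ t in Ioo a _, κ t)] at h3 h4
  exact ⟨h3, h4⟩

theorem tail_eq {ω : ℝ → ℂ} (h1 : ∀ t > 0, IntegrableOn ω (Ioi t)) {a t : ℝ} (ha : 0 < a)
    (ht : 0 < t) : ∫ s in Ioi t, ω s = (∫ s in Ioi a, ω s) - ∫ s in a..t, ω s := by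
  rw [← intervalIntegral.integral_Ioi_sub_Ioi' (h1 a ha) (h1 t ht)]
  ring

theorem intervalIntegrable_of_tail {ω : ℝ → ℂ} (h1 : ∀ t > 0, IntegrableOn ω (Ioi t)) {a b : ℝ}
    (ha : 0 < a) (hb : 0 < b) : IntervalIntegrable ω volume a b := by
  rw [intervalIntegrable_iff]
  refine (h1 _ (lt_min ha hb)).mono_set fun x hx => hx.1

theorem continuousOn_tail {ω : ℝ → ℂ} (h1 : ∀ t > 0, IntegrableOn ω (Ioi t)) :
    ContinuousOn (fun t => ∫ s in Ioi t, ω s) (Ioi 0) := by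
  intro t ht
  have ht0 : (0 : ℝ) < t := ht
  have h : ContinuousOn (fun u => ∫ s in (t / 2)..u, ω s) (uIcc (t / 2) (t + 1)) := by
    refine intervalIntegral.continuousOn_primitive_interval ?_
    rw [uIcc_of_le (by linarith)]
    exact (h1 (t / 3) (by linarith)).mono_set fun x hx => by
      simp only [mem_Ioi, mem_Icc] at *; linarith
  have h2 : ContinuousAt (fun u => ∫ s in (t / 2)..u, ω s) t := by
    refine h.continuousAt ?_
    rw [uIcc_of_le (by linarith)]
    exact Icc_mem_nhds (by linarith) (by linarith)
  have h3 : ContinuousAt (fun u => (∫ s in Ioi (t / 2), ω s) - ∫ s in (t / 2)..u, ω s) t :=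
    continuousAt_const.sub h2
  refine (h3.congr ?_).continuousWithinAt
  filter_upwards [Ioi_mem_nhds ht0] with u hu
  exact (tail_eq h1 (half_pos ht0) hu).symm

/-! ### The Hardy operators -/

/-- The Hardy-type operator `g ↦ tʲ ∫_t^∞ s^{-j-1} g(s) ds`, the inverse of `j - t d/dt`. -/
def hardyFun (j : ℕ) (g : ℝ → ℂ) (t : ℝ) : ℂ :=
  (t : ℂ) ^ j * ∫ s in Ioi t, ((s : ℂ) ^ (j + 1))⁻¹ * g s

theorem hardyFun_congr {j : ℕ} {g h : ℝ → ℂ} (hgh : g =ᵐ[posMeasure] h) {t : ℝ} (ht : 0 < t) :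
    hardyFun j g t = hardyFun j h t := by
  unfold hardyFun
  congr 1
  refine integral_congr_ae ?_
  have : g =ᵐ[volume.restrict (Ioi t)] h :=
    ae_mono (Measure.restrict_mono (Ioi_subset_Ioi ht.le) le_rfl) hgh
  filter_upwards [this] with s hs
  rw [hs]

theorem aestronglyMeasurable_weight (j : ℕ) (μ : Measure ℝ) :
    AEStronglyMeasurable (fun s : ℝ => ((s : ℂ) ^ (j + 1))⁻¹) μ :=
  (Measurable.inv (by fun_prop)).aestronglyMeasurable

theorem integrableOn_weight_mul {g : ℝ → ℂ} (hg : MemLp g 2 posMeasure) (j : ℕ) :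
    ∀ t > 0, IntegrableOn (fun s : ℝ => ((s : ℂ) ^ (j + 1))⁻¹ * g s) (Ioi t) := by
  intro t ht
  have h1 : MemLp g 2 (volume.restrict (Ioi t)) :=
    hg.mono_measure (Measure.restrict_mono (Ioi_subset_Ioi ht.le) le_rfl)
  have h0 : MemLp (fun s : ℝ => s⁻¹) 2 (volume.restrict (Ioi t)) := by
    rw [memLp_two_iff_integrable_sq (by fun_prop)]
    have h := integrableOn_Ioi_rpow_of_lt (a := -2) (by norm_num) ht
    refine h.congr_fun (fun s hs => ?_) measurableSet_Ioi
    have hs0 : 0 < s := ht.trans hs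
    simp only
    rw [Real.rpow_neg hs0.le, inv_pow]
    norm_num
  have h2 : MemLp (fun s : ℝ => ((s : ℂ) ^ (j + 1))⁻¹) 2 (volume.restrict (Ioi t)) := by
    refine h0.of_le_mul (c := (t ^ j)⁻¹) (aestronglyMeasurable_weight j _) ?_
    refine (ae_restrict_iff' measurableSet_Ioi).2 (Eventually.of_forall fun s hs => ?_)
    have hs0 : 0 < s := ht.trans hs
    rw [norm_inv, norm_pow, Complex.norm_real, Real.norm_of_nonneg hs0.le,
      Real.norm_of_nonneg (by positivity), pow_succ, mul_inv]
    gcongr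
    exact le_of_lt hs
  exact h2.integrable_mul h1

theorem aestronglyMeasurable_hardyFun {g : ℝ → ℂ} (hg : MemLp g 2 posMeasure) (j : ℕ) :
    AEStronglyMeasurable (hardyFun j g) posMeasure :=
  (Continuous.aestronglyMeasurable (by fun_prop)).mul
    ((continuousOn_tail (integrableOn_weight_mul hg j)).aestronglyMeasurable measurableSet_Ioi)

theorem lintegral_rpow_Ioi {t : ℝ} (ht : 0 < t) :
    ∫⁻ s in Ioi t, ENNReal.ofReal (s ^ (-(3 / 2) : ℝ)) =
      ENNReal.ofReal (2 * t ^ (-(1 / 2) : ℝ)) := by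
  rw [← ofReal_integral_eq_lintegral_ofReal (integrableOn_Ioi_rpow_of_lt (by norm_num) ht)
    ((ae_restrict_iff' measurableSet_Ioi).2 (Eventually.of_forall fun s hs =>
      Real.rpow_nonneg (ht.trans hs).le _)), integral_Ioi_rpow_of_lt (by norm_num) ht]
  congr 1
  norm_num
  ring

theorem lintegral_rpow_Ioo {s : ℝ} (hs : 0 < s) :
    ∫⁻ t in Ioo 0 s, ENNReal.ofReal (2 * t ^ (-(1 / 2) : ℝ)) =
      ENNReal.ofReal (4 * s ^ (1 / 2 : ℝ)) := by
  have hi : IntervalIntegrable (fun t : ℝ => t ^ (-(1 / 2) : ℝ)) volume 0 s :=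
    intervalIntegral.intervalIntegrable_rpow' (by norm_num)
  have hi' : IntegrableOn (fun t : ℝ => 2 * t ^ (-(1 / 2) : ℝ)) (Ioo 0 s) :=
    (((intervalIntegrable_iff_integrableOn_Ioo_of_le hs.le).1 hi)).const_mul 2
  rw [← ofReal_integral_eq_lintegral_ofReal hi'
    ((ae_restrict_iff' measurableSet_Ioo).2 (Eventually.of_forall fun t ht =>
      mul_nonneg two_pos.le (Real.rpow_nonneg ht.1.le _))), ← integral_Ioc_eq_integral_Ioo,
    ← intervalIntegral.integral_of_le hs.le, intervalIntegral.integral_const_mul,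
    integral_rpow (Or.inl (by norm_num))]
  congr 1
  norm_num
  ring

/-- Hardy's inequality, by the Schur test with weight `s^{-1/2}`. -/
theorem lintegral_hardy_le {u : ℝ → ℝ≥0∞} (hu : AEMeasurable u posMeasure) :
    ∫⁻ t in Ioi (0 : ℝ), (∫⁻ s in Ioi t, ENNReal.ofReal s⁻¹ * u s) ^ 2 ≤
      4 * ∫⁻ s in Ioi (0 : ℝ), u s ^ 2 := by
  have hm (p : ℝ) : Measurable fun s : ℝ => ENNReal.ofReal (s ^ p) := by fun_prop
  have step (t : ℝ) (ht : t ∈ Ioi (0 : ℝ)) : (∫⁻ s in Ioi t, ENNReal.ofReal s⁻¹ * u s) ^ 2 ≤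
      ENNReal.ofReal (2 * t ^ (-(1 / 2) : ℝ)) *
        ∫⁻ s in Ioi t, ENNReal.ofReal (s ^ (-(1 / 2) : ℝ)) * u s ^ 2 := by
    have ht0 : (0 : ℝ) < t := ht
    have hu' : AEMeasurable u (volume.restrict (Ioi t)) :=
      hu.mono_measure (Measure.restrict_mono (Ioi_subset_Ioi ht0.le) le_rfl)
    have hcs := ENNReal.lintegral_mul_le_Lp_mul_Lq (volume.restrict (Ioi t))
      Real.HolderConjugate.two_two (hm (-(3 / 4))).aemeasurable
      ((hm (-(1 / 4))).aemeasurable.mul hu')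
    have e0 : ∫⁻ s in Ioi t, ENNReal.ofReal s⁻¹ * u s = ∫⁻ s in Ioi t,
        ((fun s : ℝ => ENNReal.ofReal (s ^ (-(3 / 4) : ℝ))) *
          ((fun s : ℝ => ENNReal.ofReal (s ^ (-(1 / 4) : ℝ))) * u)) s := by
      refine setLIntegral_congr_fun measurableSet_Ioi fun s hs => ?_
      have hs0 : 0 < s := ht0.trans hs
      simp only [Pi.mul_apply]
      rw [← mul_assoc, ← ENNReal.ofReal_mul (by positivity), ← Real.rpow_add hs0,
        ← Real.rpow_neg_one]
      norm_num
    have e1 : ∫⁻ s in Ioi t, ENNReal.ofReal (s ^ (-(3 / 4) : ℝ)) ^ (2 : ℝ) =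
        ENNReal.ofReal (2 * t ^ (-(1 / 2) : ℝ)) := by
      rw [← lintegral_rpow_Ioi ht0]
      refine setLIntegral_congr_fun measurableSet_Ioi fun s hs => ?_
      have hs0 : 0 < s := ht0.trans hs
      rw [ENNReal.ofReal_rpow_of_nonneg (by positivity) (by norm_num), ← Real.rpow_mul hs0.le]
      norm_num
    have e2 : ∫⁻ s in Ioi t, ((fun s : ℝ => ENNReal.ofReal (s ^ (-(1 / 4) : ℝ))) * u) s ^ (2 : ℝ) =
        ∫⁻ s in Ioi t, ENNReal.ofReal (s ^ (-(1 / 2) : ℝ)) * u s ^ 2 := by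
      refine setLIntegral_congr_fun measurableSet_Ioi fun s hs => ?_
      have hs0 : 0 < s := ht0.trans hs
      simp only [Pi.mul_apply]
      rw [ENNReal.mul_rpow_of_nonneg _ _ (by norm_num),
        ENNReal.ofReal_rpow_of_nonneg (by positivity) (by norm_num), ← Real.rpow_mul hs0.le]
      norm_num
    rw [e0]
    rw [e1, e2] at hcs
    calc _ ≤ _ := pow_le_pow_left' hcs 2
      _ = _ := by
        rw [mul_pow, ← ENNReal.rpow_natCast, ← ENNReal.rpow_natCast, ← ENNReal.rpow_mul,
          ← ENNReal.rpow_mul]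
        norm_num
  calc ∫⁻ t in Ioi (0 : ℝ), (∫⁻ s in Ioi t, ENNReal.ofReal s⁻¹ * u s) ^ 2
      ≤ ∫⁻ t in Ioi (0 : ℝ), ENNReal.ofReal (2 * t ^ (-(1 / 2) : ℝ)) *
        ∫⁻ s in Ioi t, ENNReal.ofReal (s ^ (-(1 / 2) : ℝ)) * u s ^ 2 :=
        setLIntegral_mono' measurableSet_Ioi step
    _ = ∫⁻ s in Ioi (0 : ℝ), (ENNReal.ofReal (s ^ (-(1 / 2) : ℝ)) * u s ^ 2) *
        ∫⁻ t in Ioo 0 s, ENNReal.ofReal (2 * t ^ (-(1 / 2) : ℝ)) :=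
        lintegral_mul_tail 0 (by fun_prop) ((hm _).aemeasurable.mul (hu.pow_const 2))
    _ = ∫⁻ s in Ioi (0 : ℝ), 4 * u s ^ 2 := by
        refine setLIntegral_congr_fun measurableSet_Ioi fun s hs => ?_
        have hs0 : (0 : ℝ) < s := hs
        rw [lintegral_rpow_Ioo hs0, mul_right_comm, ← ENNReal.ofReal_mul (by positivity)]
        congr 1
        rw [mul_left_comm, ← Real.rpow_add hs0]
        norm_num
    _ = 4 * ∫⁻ s in Ioi (0 : ℝ), u s ^ 2 := lintegral_const_mul' _ _ (by norm_num)

theorem memLp_hardyFun (j : ℕ) {g : ℝ → ℂ} (hg : MemLp g 2 posMeasure) :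
    MemLp (hardyFun j g) 2 posMeasure := by
  refine memLp_two_of_lintegral (aestronglyMeasurable_hardyFun hg j) ?_
  have hfin : ∫⁻ s in Ioi (0 : ℝ), ‖g s‖ₑ ^ 2 < ∞ := by
    have := (eLpNorm_lt_top_iff_lintegral_rpow_enorm_lt_top (by norm_num) (by norm_num)).1 hg.2
    simpa using this
  refine lt_of_le_of_lt ((setLIntegral_mono' measurableSet_Ioi fun t ht => ?_).trans
    (lintegral_hardy_le hg.1.enorm)) (ENNReal.mul_lt_top (by norm_num) hfin)
  have ht0 : (0 : ℝ) < t := ht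
  gcongr
  rw [hardyFun, ← integral_const_mul]
  refine (enorm_integral_le_lintegral_enorm _).trans (setLIntegral_mono' measurableSet_Ioi
    fun s hs => ?_)
  have hs0 : (0 : ℝ) < s := ht0.trans hs
  rw [← mul_assoc, enorm_mul]
  gcongr
  rw [← ofReal_norm]
  gcongr
  rw [norm_mul, norm_inv, norm_pow, norm_pow, Complex.norm_real, Complex.norm_real,
    Real.norm_of_nonneg ht0.le, Real.norm_of_nonneg hs0.le, pow_succ, mul_inv, ← mul_assoc]
  refine mul_le_of_le_one_left (by positivity) ?_
  rw [mul_inv_le_iff₀ (by positivity), one_mul]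
  exact pow_le_pow_left₀ ht0.le (le_of_lt hs) j

/-! ### Identities for the Hardy operators -/

theorem memLp_absHardy (j : ℕ) {g : ℝ → ℂ} (hg : MemLp g 2 posMeasure) :
    MemLp (fun t : ℝ => t ^ j * ∫ s in Ioi t, ‖((s : ℂ) ^ (j + 1))⁻¹ * g s‖) 2 posMeasure := by
  have h := (memLp_hardyFun j (hg.norm.ofReal (K := ℂ))).norm
  refine (memLp_congr_ae ?_).1 h
  refine (ae_restrict_iff' measurableSet_Ioi).2 (Eventually.of_forall fun t ht => ?_)
  have ht0 : (0 : ℝ) < t := ht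
  have e : ∫ s in Ioi t, ((s : ℂ) ^ (j + 1))⁻¹ * ((‖g s‖ : ℝ) : ℂ) =
      ((∫ s in Ioi t, ‖((s : ℂ) ^ (j + 1))⁻¹ * g s‖ : ℝ) : ℂ) := by
    rw [← integral_complex_ofReal]
    refine setIntegral_congr_fun measurableSet_Ioi fun s hs => ?_
    have hs0 : (0 : ℝ) < s := ht0.trans hs
    simp only [norm_mul, norm_inv, norm_pow, Complex.norm_real, Real.norm_of_nonneg hs0.le]
    push_cast
    rfl
  have e2 : hardyFun j (fun s => ((‖g s‖ : ℝ) : ℂ)) t =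
      (t : ℂ) ^ j * ((∫ s in Ioi t, ‖((s : ℂ) ^ (j + 1))⁻¹ * g s‖ : ℝ) : ℂ) := by
    rw [← e]; rfl
  change ‖hardyFun j (fun s => ((‖g s‖ : ℝ) : ℂ)) t‖ = _
  rw [e2, norm_mul, norm_pow, Complex.norm_real, Complex.norm_real, Real.norm_of_nonneg ht0.le,
    Real.norm_of_nonneg (integral_nonneg fun s => norm_nonneg _)]

/-- Fubini for the Hardy operator tested against `tʲ k(t)` with `k ∈ L²`. -/
theorem integral_mul_hardy (j : ℕ) {g k : ℝ → ℂ} (hg : MemLp g 2 posMeasure)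
    (hk : MemLp k 2 posMeasure) :
    (∫ t in Ioi (0 : ℝ), k t * hardyFun j g t =
      ∫ s in Ioi (0 : ℝ), (((s : ℂ) ^ (j + 1))⁻¹ * g s) * ∫ t in Ioo 0 s, (t : ℂ) ^ j * k t) ∧
    IntegrableOn (fun s : ℝ => (((s : ℂ) ^ (j + 1))⁻¹ * g s) * ∫ t in Ioo 0 s, (t : ℂ) ^ j * k t)
      (Ioi 0) := by
  have h := integral_mul_tail (a := 0) (κ := fun t : ℝ => (t : ℂ) ^ j * k t)
    (ω := fun s : ℝ => ((s : ℂ) ^ (j + 1))⁻¹ * g s)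
    ((Continuous.aestronglyMeasurable (by fun_prop)).mul hk.1)
    ((aestronglyMeasurable_weight j _).mul hg.1) (integrableOn_weight_mul hg j) (by
      refine IntegrableOn.congr_fun (hk.norm.integrable_mul (memLp_absHardy j hg)) (fun t ht => ?_)
        measurableSet_Ioi
      have ht0 : (0 : ℝ) < t := ht
      simp only [Pi.mul_apply, norm_mul, norm_pow, Complex.norm_real, Real.norm_of_nonneg ht0.le]
      ring)
  refine ⟨?_, h.2⟩
  rw [← h.1]
  refine setIntegral_congr_fun measurableSet_Ioi fun t _ => ?_
  simp only [hardyFun]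
  ring

/-- Integration by parts on `(0, s)` for `f = hardyFun j g`, in the form of Fubini's theorem: the
integral of `(t^(j+1) f)' = (2j + 1) tʲ f - tʲ g`. -/
theorem integral_Ioo_pow_mul_hardy (j : ℕ) {g : ℝ → ℂ} (hg : MemLp g 2 posMeasure) {s : ℝ}
    (hs : 0 < s) :
    (2 * j + 1) * ∫ t in Ioo 0 s, (t : ℂ) ^ j * hardyFun j g t =
      (s : ℂ) ^ (j + 1) * hardyFun j g s + ∫ t in Ioo 0 s, (t : ℂ) ^ j * g t := by
  set ω : ℝ → ℂ := fun s => ((s : ℂ) ^ (j + 1))⁻¹ * g s with hω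
  have hωt : ∀ t > 0, IntegrableOn ω (Ioi t) := integrableOn_weight_mul hg j
  have hpowk (m : ℕ) {k : ℝ → ℂ} (hk : MemLp k 2 posMeasure) :
      IntegrableOn (fun t : ℝ => (t : ℂ) ^ m * k t) (Ioo 0 s) := by
    have h1 : MemLp k 2 (volume.restrict (Ioo 0 s)) :=
      hk.mono_measure (Measure.restrict_mono Ioo_subset_Ioi_self le_rfl)
    have h2 : MemLp (fun t : ℝ => (t : ℂ) ^ m) 2 (volume.restrict (Ioo 0 s)) := by
      refine MemLp.of_bound (Continuous.aestronglyMeasurable (by fun_prop)) (s ^ m) ?_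
      refine (ae_restrict_iff' measurableSet_Ioo).2 (Eventually.of_forall fun t ht => ?_)
      rw [norm_pow, Complex.norm_real, Real.norm_of_nonneg ht.1.le]
      exact pow_le_pow_left₀ ht.1.le ht.2.le m
    exact h2.integrable_mul h1
  -- Fubini for the truncation of `ω` to `(0, s)`
  have hind (t : ℝ) (ht : 0 < t) : ∫ r in Ioi t, indicator (Iio s) ω r =
      if t < s then (∫ r in Ioi t, ω r) - ∫ r in Ioi s, ω r else 0 := by
    rw [setIntegral_indicator measurableSet_Iio, Ioi_inter_Iio]
    split_ifs with hts
    · rw [intervalIntegral.integral_Ioi_sub_Ioi (hωt t ht) hts.le,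
        intervalIntegral.integral_of_le hts.le, integral_Ioc_eq_integral_Ioo]
    · rw [Ioo_eq_empty hts]; simp
  have hnind (t : ℝ) : (fun r => ‖indicator (Iio s) ω r‖) = indicator (Iio s) fun r => ‖ω r‖ := by
    ext r; rw [norm_indicator_eq_indicator_norm]
  have h := integral_mul_tail (a := 0) (κ := fun t : ℝ => (t : ℂ) ^ (2 * j))
    (ω := indicator (Iio s) ω)
    (Continuous.aestronglyMeasurable (by fun_prop))
    (((aestronglyMeasurable_weight j _).mul hg.1).indicator measurableSet_Iio)
    (fun t ht => (hωt t ht).indicator measurableSet_Iio) (by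
      have hA : IntegrableOn (indicator (Iio s)
          (fun t : ℝ => t ^ j * (t ^ j * ∫ r in Ioi t, ‖ω r‖))) (Ioi 0) := by
        rw [IntegrableOn, integrable_indicator_iff measurableSet_Iio, IntegrableOn,
          Measure.restrict_restrict measurableSet_Iio, Iio_inter_Ioi]
        have h1 := (memLp_absHardy j hg).ofReal (K := ℂ)
        have h2 := (hpowk j h1).norm
        refine IntegrableOn.congr_fun h2 (fun t ht => ?_) measurableSet_Ioo
        have hnn : 0 ≤ t ^ j * ∫ r in Ioi t, ‖ω r‖ :=
          mul_nonneg (pow_nonneg ht.1.le _) (integral_nonneg fun r => norm_nonneg _)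
        change ‖(t : ℂ) ^ j * _‖ = _
        rw [norm_mul, norm_pow, Complex.norm_real, Real.norm_of_nonneg ht.1.le]
        congr 1
        exact (RCLike.norm_ofReal _).trans (abs_of_nonneg hnn)
      refine hA.mono' ?_ ?_
      · refine (Continuous.aestronglyMeasurable (by fun_prop)).mul ?_
        refine ContinuousOn.aestronglyMeasurable ?_ measurableSet_Ioi
        have := continuousOn_tail (ω := fun r => ((‖indicator (Iio s) ω r‖ : ℝ) : ℂ))
          (fun t ht => ((hωt t ht).indicator measurableSet_Iio).norm.ofReal)
        have h2 := Complex.continuous_re.comp_continuousOn this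
        refine h2.congr fun t _ => ?_
        simp only [Function.comp_apply]
        rw [integral_complex_ofReal, Complex.ofReal_re]
      · refine (ae_restrict_iff' measurableSet_Ioi).2 (Eventually.of_forall fun t ht => ?_)
        have ht0 : (0 : ℝ) < t := ht
        rw [Real.norm_of_nonneg
            (mul_nonneg (norm_nonneg _) (integral_nonneg fun r => norm_nonneg _)),
          hnind t, setIntegral_indicator measurableSet_Iio, Ioi_inter_Iio, norm_pow,
          Complex.norm_real, Real.norm_of_nonneg ht0.le]
        by_cases hts : t < s
        · rw [indicator_of_mem (show t ∈ Iio s from hts), two_mul, pow_add, mul_assoc]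
          gcongr
          · exact (Eventually.of_forall fun r => norm_nonneg _)
          · exact (hωt t ht0).norm
          · exact Ioo_subset_Ioi_self
        · rw [indicator_of_notMem (show t ∉ Iio s from hts), Ioo_eq_empty hts]; simp)
  have hpow (r : ℝ) (hr : 0 < r) : ∫ t in Ioo 0 r, (t : ℂ) ^ (2 * j) =
      (r : ℂ) ^ (2 * j + 1) / (2 * j + 1) := by
    rw [← integral_Ioc_eq_integral_Ioo, ← intervalIntegral.integral_of_le hr.le]
    have := integral_pow (a := 0) (b := r) (2 * j)
    have h2 : ∫ t in (0 : ℝ)..r, (t : ℂ) ^ (2 * j) =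
        ((∫ t in (0 : ℝ)..r, t ^ (2 * j) : ℝ) : ℂ) := by
      rw [← intervalIntegral.integral_ofReal]
      push_cast
      rfl
    rw [h2, this]
    push_cast
    simp
  have hne : (2 * j + 1 : ℂ) ≠ 0 := by exact_mod_cast (Nat.succ_ne_zero (2 * j))
  -- the right side of Fubini
  have hR : ∫ r in Ioi (0 : ℝ), indicator (Iio s) ω r * ∫ t in Ioo 0 r, (t : ℂ) ^ (2 * j) =
      (∫ t in Ioo 0 s, (t : ℂ) ^ j * g t) / (2 * j + 1) := by
    have : ∀ r ∈ Ioi (0 : ℝ), indicator (Iio s) ω r * ∫ t in Ioo 0 r, (t : ℂ) ^ (2 * j) =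
        indicator (Iio s) (fun t => (t : ℂ) ^ j * g t / (2 * j + 1)) r := by
      intro r hr
      have hr0 : (0 : ℝ) < r := hr
      have hrc : (r : ℂ) ≠ 0 := by exact_mod_cast hr0.ne'
      by_cases hrs : r ∈ Iio s
      · rw [indicator_of_mem hrs, indicator_of_mem hrs, hpow r hr0, hω]
        field_simp
        ring
      · rw [indicator_of_notMem hrs, indicator_of_notMem hrs, zero_mul]
    rw [setIntegral_congr_fun measurableSet_Ioi this, setIntegral_indicator measurableSet_Iio,
      Ioi_inter_Iio, integral_div]
  have hL : ∫ t in Ioi (0 : ℝ), (t : ℂ) ^ (2 * j) * ∫ r in Ioi t, indicator (Iio s) ω r =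
      (∫ t in Ioo 0 s, (t : ℂ) ^ j * hardyFun j g t) -
        (s : ℂ) ^ (2 * j + 1) / (2 * j + 1) * ∫ r in Ioi s, ω r := by
    have : ∀ t ∈ Ioi (0 : ℝ), (t : ℂ) ^ (2 * j) * ∫ r in Ioi t, indicator (Iio s) ω r =
        indicator (Iio s) (fun t => (t : ℂ) ^ j * hardyFun j g t -
          (t : ℂ) ^ (2 * j) * ∫ r in Ioi s, ω r) t := by
      intro t ht
      rw [hind t ht]
      by_cases hts : t < s
      · rw [indicator_of_mem (show t ∈ Iio s from hts), if_pos hts, hardyFun]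
        ring
      · rw [indicator_of_notMem (show t ∉ Iio s from hts), if_neg hts, mul_zero]
    rw [setIntegral_congr_fun measurableSet_Ioi this, setIntegral_indicator measurableSet_Iio,
      Ioi_inter_Iio, integral_sub (hpowk j (memLp_hardyFun j hg)) ?_, integral_mul_const, hpow s hs]
    have hI : IntegrableOn (fun t : ℝ => (t : ℂ) ^ (2 * j)) (Ioo 0 s) :=
      (Continuous.integrableOn_Icc (a := 0) (b := s) (by fun_prop)).mono_set Ioo_subset_Icc_self
    exact hI.mul_const _
  have h1 := h.1
  rw [hL, hR] at h1
  rw [sub_eq_iff_eq_add] at h1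
  rw [h1]
  have e : (s : ℂ) ^ (j + 1) * hardyFun j g s = (s : ℂ) ^ (2 * j + 1) * ∫ r in Ioi s, ω r := by
    rw [hardyFun]; ring
  rw [e]
  field_simp
  ring

/-- `(2j + 1) ‖f‖² = 2 Re ⟨f, g⟩` for `f` the Hardy transform of `g`. Formally this is
the integral of `d/dt (t |f|²)` over `ℝ⁺`; Fubini's theorem avoids boundary terms. -/
theorem integral_hardy_mul_conj (j : ℕ) {g : ℝ → ℂ} (hg : MemLp g 2 posMeasure) :
    (2 * j + 1) * ∫ t in Ioi (0 : ℝ), conj (hardyFun j g t) * hardyFun j g t =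
      (∫ t in Ioi (0 : ℝ), g t * conj (hardyFun j g t)) +
        ∫ t in Ioi (0 : ℝ), conj (g t) * hardyFun j g t := by
  have hf := memLp_hardyFun j hg
  have hfc : MemLp (fun t => conj (hardyFun j g t)) 2 posMeasure := hf.star
  have hgc : MemLp (fun t => conj (g t)) 2 posMeasure := hg.star
  have hgf : IntegrableOn (fun t => g t * conj (hardyFun j g t)) (Ioi 0) := hg.integrable_mul hfc
  rw [(integral_mul_hardy j hg hfc).1, (integral_mul_hardy j hg hgc).1, ← integral_const_mul,
    ← integral_add hgf (integral_mul_hardy j hg hgc).2]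
  refine setIntegral_congr_fun measurableSet_Ioi fun s hs => ?_
  have hs0 : (0 : ℝ) < s := hs
  have hsc : (s : ℂ) ≠ 0 := by exact_mod_cast hs0.ne'
  have key := congrArg conj (integral_Ioo_pow_mul_hardy j hg hs0)
  simp only [map_mul, map_add, ← integral_conj, map_pow, Complex.conj_ofReal, map_natCast,
    map_one, map_ofNat] at key
  calc _ = (((s : ℂ) ^ (j + 1))⁻¹ * g s) *
        ((2 * j + 1) * ∫ t in Ioo 0 s, (t : ℂ) ^ j * conj (hardyFun j g t)) := by ring
    _ = _ := by
      rw [key]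
      field_simp

/-- The Hardy operator on the side of the holomorphic Fourier transform:
`z F' + (j + 1) F = G`. -/
theorem hF_hardyFun (j : ℕ) {g : ℝ → ℂ} (hg : MemLp g 2 posMeasure) {z : ℂ} (hz : 0 < z.im) :
    z * deriv (hF (hardyFun j g)) z + (j + 1) * hF (hardyFun j g) z = hF g z := by
  have hf := memLp_hardyFun j hg
  rw [(hasDerivAt_hF hf hz).deriv, hF, ← integral_const_mul, ← integral_const_mul,
    ← integral_add]
  · have hk : MemLp (fun t : ℝ => (Complex.I * t * z + (j + 1)) *
        Complex.exp (Complex.I * t * z)) 2 posMeasure := by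
      have := ((memLp_two_pow_mul_exp 1 hz).const_mul (Complex.I * z)).add
        ((memLp_two_pow_mul_exp 0 hz).const_mul (j + 1 : ℂ))
      refine (memLp_congr_ae (Eventually.of_forall fun t => ?_)).1 this
      simp only [Pi.add_apply]
      ring
    have h := (integral_mul_hardy j hg hk).1
    calc _ = ∫ t in Ioi (0 : ℝ), ((Complex.I * t * z + (j + 1)) *
        Complex.exp (Complex.I * t * z)) * hardyFun j g t := by
          refine integral_congr_ae (Eventually.of_forall fun t => ?_)
          simp only
          ring
      _ = _ := h
      _ = _ := by
        refine setIntegral_congr_fun measurableSet_Ioi fun s hs => ?_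
        have hs0 : (0 : ℝ) < s := hs
        have hsc : (s : ℂ) ≠ 0 := by exact_mod_cast hs0.ne'
        have hder (t : ℝ) : HasDerivAt (fun t : ℝ => (t : ℂ) ^ (j + 1) *
            Complex.exp (Complex.I * t * z)) ((t : ℂ) ^ j * ((Complex.I * t * z + (j + 1)) *
              Complex.exp (Complex.I * t * z))) t := by
          have h1 : HasDerivAt (fun t : ℝ => (t : ℂ)) 1 t := Complex.ofRealCLM.hasDerivAt
          have h2 := (h1.pow (j + 1)).mul ((h1.const_mul Complex.I).mul_const z).cexp
          convert! h2 using 1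
          push_cast
          simp only [Pi.pow_apply]
          ring
        have hint := intervalIntegral.integral_eq_sub_of_hasDerivAt (a := 0) (b := s)
          (fun t _ => hder t) (Continuous.intervalIntegrable (by fun_prop) _ _)
        rw [← integral_Ioc_eq_integral_Ioo, ← intervalIntegral.integral_of_le hs0.le, hint]
        simp only [Complex.ofReal_zero, ne_eq, Nat.add_eq_zero_iff, one_ne_zero, and_false,
          not_false_eq_true, zero_pow, zero_mul, sub_zero]
        field_simp
  · refine Integrable.const_mul ?_ _
    refine ((integrable_mul_pow_exp hf 1 hz).const_mul Complex.I).congr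
      (Eventually.of_forall fun t => ?_)
    simp only
    ring
  · exact (integrable_hF hf hz).const_mul _

/-! ### The equation `z F' + a F = G` and the algebra of Hardy operators -/

theorem hF_sub {f g : L2pos} {z : ℂ} (hz : z ∈ upperHalfPlaneSet) :
    hF (f - g : L2pos) z = hF f z - hF g z := by
  rw [hF_congr (Lp.coeFn_sub f g)]
  unfold hF
  rw [← integral_sub (integrable_hF (Lp.memLp f) hz) (integrable_hF (Lp.memLp g) hz)]
  simp only [Pi.sub_apply, sub_mul]

theorem hF_add {f g : L2pos} {z : ℂ} (hz : z ∈ upperHalfPlaneSet) :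
    hF (f + g : L2pos) z = hF f z + hF g z := by
  rw [hF_congr (Lp.coeFn_add f g)]
  unfold hF
  rw [← integral_add (integrable_hF (Lp.memLp f) hz) (integrable_hF (Lp.memLp g) hz)]
  simp only [Pi.add_apply, add_mul]

theorem hF_smul (c : ℂ) (f : L2pos) (z : ℂ) : hF (c • f : L2pos) z = c * hF f z := by
  rw [hF_congr (Lp.coeFn_smul c f)]
  unfold hF
  rw [← integral_const_mul]
  simp only [Pi.smul_apply, smul_eq_mul, mul_assoc]

theorem differentiableAt_hF (f : L2pos) {z : ℂ} (hz : z ∈ upperHalfPlaneSet) :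
    DifferentiableAt ℂ (hF f) z := (hasDerivAt_hF (Lp.memLp f) hz).differentiableAt

theorem eventually_upper {z : ℂ} (hz : z ∈ upperHalfPlaneSet) :
    ∀ᶠ w in 𝓝 z, w ∈ upperHalfPlaneSet := isOpen_upperHalfPlaneSet.mem_nhds hz

theorem deriv_eq_of_eqOn {F G : ℂ → ℂ} (h : EqOn F G upperHalfPlaneSet) {z : ℂ}
    (hz : z ∈ upperHalfPlaneSet) : deriv F z = deriv G z :=
  Filter.EventuallyEq.deriv_eq ((eventually_upper hz).mono fun _ hw => h hw)

/-- The relation `z F' + a F = G` between the holomorphic Fourier transforms `F` and `G` of `f`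
and `g`. -/
def Euler (a : ℂ) (f g : L2pos) : Prop :=
  ∀ z ∈ upperHalfPlaneSet, z * deriv (hF f) z + a * hF f z = hF g z

theorem Euler.sub {a : ℂ} {f₁ f₂ g₁ g₂ : L2pos} (h₁ : Euler a f₁ g₁) (h₂ : Euler a f₂ g₂) :
    Euler a (f₁ - f₂) (g₁ - g₂) := by
  intro z hz
  have : deriv (hF (f₁ - f₂ : L2pos)) z = deriv (hF f₁) z - deriv (hF f₂) z := by
    rw [deriv_eq_of_eqOn (G := hF f₁ - hF f₂) (fun w hw => hF_sub hw) hz,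
      deriv_sub (differentiableAt_hF _ hz) (differentiableAt_hF _ hz)]
  rw [this, hF_sub hz, hF_sub hz]
  linear_combination h₁ z hz - h₂ z hz

theorem Euler.add {a : ℂ} {f₁ f₂ g₁ g₂ : L2pos} (h₁ : Euler a f₁ g₁) (h₂ : Euler a f₂ g₂) :
    Euler a (f₁ + f₂) (g₁ + g₂) := by
  intro z hz
  have : deriv (hF (f₁ + f₂ : L2pos)) z = deriv (hF f₁) z + deriv (hF f₂) z := by
    rw [deriv_eq_of_eqOn (G := hF f₁ + hF f₂) (fun w hw => hF_add hw) hz,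
      deriv_add (differentiableAt_hF _ hz) (differentiableAt_hF _ hz)]
  rw [this, hF_add hz, hF_add hz]
  linear_combination h₁ z hz + h₂ z hz

theorem Euler.smul {a : ℂ} {f g : L2pos} (h : Euler a f g) (c : ℂ) :
    Euler a (c • f) (c • g) := by
  intro z hz
  have : deriv (hF (c • f : L2pos)) z = c * deriv (hF f) z := by
    rw [deriv_eq_of_eqOn (G := fun w => c * hF f w) (fun w _ => hF_smul c f w) hz,
      deriv_const_mul _ (differentiableAt_hF _ hz)]
  rw [this, hF_smul, hF_smul]
  linear_combination c * h z hz

theorem Euler.shift {a : ℂ} {f g : L2pos} (h : Euler a f g) (b : ℂ) :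
    Euler b f (g + (b - a) • f) := by
  intro z hz
  rw [hF_add hz, hF_smul]
  linear_combination h z hz

/-- The point evaluation bound `‖F(iy)‖ ≤ ‖f‖ / √(2y)` in the Hardy space. -/
theorem norm_hF_I_sq_le (f : L2pos) {y : ℝ} (hy : 0 < y) :
    ‖hF f (y * Complex.I)‖ ^ 2 * (2 * y) ≤ ‖f‖ ^ 2 := by
  have hm := (memLp_two_exp_neg hy).ofReal (K := ℂ)
  set e : L2pos := hm.toLp _ with he
  have h1 : hF f (y * Complex.I) = inner ℂ e f := by
    rw [inner_eq_integral, hF]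
    refine integral_congr_ae ?_
    filter_upwards [hm.coeFn_toLp] with t ht
    rw [he, ht]
    congr 1
    change _ = conj ((Real.exp (-(y * t)) : ℝ) : ℂ)
    rw [Complex.conj_ofReal, Complex.ofReal_exp]
    congr 1
    push_cast
    linear_combination ((t : ℂ) * y) * Complex.I_sq
  have h2 : ‖e‖ ^ 2 = 1 / (2 * y) := by
    rw [norm_sq_eq_integral]
    calc ∫ t, ‖e t‖ ^ 2 ∂posMeasure = ∫ t in Ioi (0 : ℝ), Real.exp (-(2 * y) * t) := by
          refine integral_congr_ae ?_
          filter_upwards [hm.coeFn_toLp] with t ht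
          rw [he, ht, RCLike.norm_ofReal, abs_of_pos (Real.exp_pos _), ← Real.exp_nat_mul]
          congr 1
          push_cast
          ring
      _ = 1 / (2 * y) := by
          rw [integral_exp_mul_Ioi (by linarith)]
          simp
  have h3 := norm_inner_le_norm (𝕜 := ℂ) e f
  rw [h1]
  calc ‖inner ℂ e f‖ ^ 2 * (2 * y) ≤ (‖e‖ * ‖f‖) ^ 2 * (2 * y) := by gcongr
    _ = ‖f‖ ^ 2 := by rw [mul_pow, h2]; field_simp

/-- A solution of `z F' + (j + 1) F = 0` is `c z^{-j-1}`, which grows faster at `0` than the point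
evaluation bound permits, unless `c = 0`. -/
theorem Euler.eq_zero {j : ℕ} {f : L2pos} (h : Euler (j + 1) f 0) : f = 0 := by
  have h0 : ∀ z : ℂ, hF (0 : L2pos) z = 0 := fun z => by
    have := hF_smul 0 (0 : L2pos) z
    simpa using this
  have hder : ∀ z ∈ upperHalfPlaneSet, HasDerivAt (fun z => z ^ (j + 1) * hF f z) 0 z := by
    intro z hz
    have h1 := (hasDerivAt_pow (j + 1) z).mul (differentiableAt_hF f hz).hasDerivAt
    convert! h1 using 1
    have h2 := h z hz
    rw [h0] at h2
    push_cast
    linear_combination (-z ^ j) * h2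
  have hconv : Convex ℝ upperHalfPlaneSet := convex_halfSpace_im_gt 0
  obtain ⟨c, hc⟩ := isOpen_upperHalfPlaneSet.exists_is_const_of_deriv_eq_zero hconv.isPreconnected
    (fun z hz => (hder z hz).differentiableAt.differentiableWithinAt)
    (fun z hz => (hder z hz).deriv)
  have hI (y : ℝ) (hy : 0 < y) : (y * Complex.I : ℂ) ∈ upperHalfPlaneSet := by
    simpa [upperHalfPlaneSet] using hy
  have hc0 : c = 0 := by
    have hb : ∀ y : ℝ, 0 < y → y < 1 → ‖c‖ ^ 2 ≤ y * ‖f‖ ^ 2 := by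
      intro y hy hy1
      have h1 := hc _ (hI y hy)
      have h2 := norm_hF_I_sq_le f hy
      have h3 : ‖c‖ = y ^ (j + 1) * ‖hF f (y * Complex.I)‖ := by
        rw [← h1, norm_mul, norm_pow, norm_mul, Complex.norm_I, Complex.norm_real,
          Real.norm_of_nonneg hy.le, mul_one]
      have h4 : y ^ (2 * j) ≤ 1 := pow_le_one₀ hy.le hy1.le
      calc ‖c‖ ^ 2 = y ^ (2 * j) * (y / 2 * (‖hF f (y * Complex.I)‖ ^ 2 * (2 * y))) := by
            rw [h3]; ring
        _ ≤ 1 * (y / 2 * ‖f‖ ^ 2) := by gcongr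
        _ ≤ y * ‖f‖ ^ 2 := by nlinarith [mul_nonneg hy.le (sq_nonneg ‖f‖)]
    have ht : Tendsto (fun y : ℝ => y * ‖f‖ ^ 2) (𝓝[>] 0) (𝓝 0) := by
      have : Continuous fun y : ℝ => y * ‖f‖ ^ 2 := by fun_prop
      simpa using (this.tendsto 0).mono_left (nhdsWithin_le_nhds (s := Ioi 0))
    have h5 : ‖c‖ ^ 2 ≤ 0 := by
      refine ge_of_tendsto ht ?_
      filter_upwards [Ioo_mem_nhdsGT (zero_lt_one (α := ℝ))] with y hy
      exact hb y hy.1 hy.2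
    have h6 := pow_eq_zero_iff two_ne_zero |>.1 (le_antisymm h5 (sq_nonneg _))
    exact norm_eq_zero.1 h6
  refine hF_injective fun z hz => ?_
  have h1 := hc z hz
  have hz0 : z ≠ 0 := fun h => by
    have : (0 : ℝ) < z.im := hz
    rw [h] at this
    simp at this
  rw [hc0] at h1
  rw [h0]
  exact (mul_eq_zero.1 h1).resolve_left (pow_ne_zero _ hz0)

theorem Euler.unique {j : ℕ} {f f' g : L2pos} (h : Euler (j + 1) f g) (h' : Euler (j + 1) f' g) :
    f = f' := by
  have := h.sub h'
  rw [sub_self] at this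
  exact sub_eq_zero.1 this.eq_zero

theorem euler_toLp_hardyFun (j : ℕ) (g : L2pos) :
    Euler (j + 1) ((memLp_hardyFun j (Lp.memLp g)).toLp (hardyFun j g)) g := by
  intro z hz
  have h : hF ((memLp_hardyFun j (Lp.memLp g)).toLp (hardyFun j g)) = hF (hardyFun j g) := by
    ext w; exact hF_congr (MemLp.coeFn_toLp (memLp_hardyFun j (Lp.memLp g))) w
  rw [h]
  exact hF_hardyFun j (Lp.memLp g) hz

/-- The Hardy operator `R_j = (j - t d/dt)⁻¹` on `L²(ℝ⁺)`. Linearity and all algebraic relations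
are read off from the equation `z F' + (j + 1) F = G`, which determines it. -/
def hardyOp (j : ℕ) : L2pos →ₗ[ℂ] L2pos where
  toFun g := (memLp_hardyFun j (Lp.memLp g)).toLp (hardyFun j g)
  map_add' g h := (euler_toLp_hardyFun j (g + h)).unique
    ((euler_toLp_hardyFun j g).add (euler_toLp_hardyFun j h))
  map_smul' c g := (euler_toLp_hardyFun j (c • g)).unique ((euler_toLp_hardyFun j g).smul c)

theorem coeFn_hardyOp (j : ℕ) (g : L2pos) : hardyOp j g =ᵐ[posMeasure] hardyFun j g :=
  MemLp.coeFn_toLp (memLp_hardyFun j (Lp.memLp g))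

theorem euler_hardyOp (j : ℕ) (g : L2pos) : Euler (j + 1) (hardyOp j g) g :=
  euler_toLp_hardyFun j g

theorem hardyOp_injective (j : ℕ) : Function.Injective (hardyOp j) := by
  intro g h hgh
  refine hF_injective fun z hz => ?_
  rw [← euler_hardyOp j g z hz, ← euler_hardyOp j h z hz, hgh]

/-- Both sides solve the same Euler equation. -/
theorem hardyOp_comm (i j : ℕ) (g : L2pos) : hardyOp i (hardyOp j g) = hardyOp j (hardyOp i g) := by
  set f := hardyOp i (hardyOp j g) with hf
  have h1 : Euler (i + 1) f (hardyOp j g) := euler_hardyOp i _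
  have h2 := h1.shift (j + 1)
  set w := hardyOp j g + ((j + 1 : ℂ) - (i + 1)) • f with hw
  have h3 : Euler (i + 1) w g := by
    have h4 := ((euler_hardyOp j g).shift (i + 1)).add (h1.smul ((j + 1 : ℂ) - (i + 1)))
    convert! h4 using 1
    module
  have h5 : w = hardyOp i g := h3.unique (euler_hardyOp i g)
  rw [h5] at h2
  exact h2.unique (euler_hardyOp j _)

/-- The Cayley transform `(j + 1 + t d/dt) (j - t d/dt)⁻¹`. -/
def cayleyOp (j : ℕ) : L2pos →ₗ[ℂ] L2pos := (2 * j + 1 : ℂ) • hardyOp j - LinearMap.id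

theorem cayleyOp_apply (j : ℕ) (g : L2pos) :
    cayleyOp j g = (2 * j + 1 : ℂ) • hardyOp j g - g := rfl

theorem inner_hardyOp (j : ℕ) (g : L2pos) :
    (2 * j + 1 : ℂ) * inner ℂ (hardyOp j g) (hardyOp j g) =
      inner ℂ (hardyOp j g) g + inner ℂ g (hardyOp j g) := by
  have h := integral_hardy_mul_conj j (Lp.memLp g)
  rw [inner_eq_integral, inner_eq_integral, inner_eq_integral]
  have e := coeFn_hardyOp j g
  have e1 : ∫ t, hardyOp j g t * conj (hardyOp j g t) ∂posMeasure =
      ∫ t in Ioi (0 : ℝ), conj (hardyFun j g t) * hardyFun j g t :=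
    integral_congr_ae (e.mono fun t ht => by simp only [ht]; ring)
  have e2 : ∫ t, g t * conj (hardyOp j g t) ∂posMeasure =
      ∫ t in Ioi (0 : ℝ), g t * conj (hardyFun j g t) :=
    integral_congr_ae (e.mono fun t ht => by simp only [ht])
  have e3 : ∫ t, hardyOp j g t * conj (g t) ∂posMeasure =
      ∫ t in Ioi (0 : ℝ), conj (g t) * hardyFun j g t :=
    integral_congr_ae (e.mono fun t ht => by simp only [ht]; ring)
  rw [e1, e2, e3]
  exact h

/-- The Cayley transform is isometric: `j - t d/dt` and `j + 1 + t d/dt` are formally adjoint and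
commute. -/
theorem norm_cayleyOp (j : ℕ) (g : L2pos) : ‖cayleyOp j g‖ = ‖g‖ := by
  have h : inner ℂ (cayleyOp j g) (cayleyOp j g) = inner ℂ g g := by
    rw [cayleyOp_apply]
    simp only [inner_sub_left, inner_sub_right, inner_smul_left, inner_smul_right, map_add,
      map_mul, map_natCast, map_one, map_ofNat]
    linear_combination (2 * j + 1 : ℂ) * inner_hardyOp j g
  rw [inner_self_eq_norm_sq_to_K, inner_self_eq_norm_sq_to_K] at h
  have h2 : ‖cayleyOp j g‖ ^ 2 = ‖g‖ ^ 2 := by exact_mod_cast h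
  exact (sq_eq_sq₀ (norm_nonneg _) (norm_nonneg _)).1 h2

/-- The product `∏_{i < n} -(i + 1 + t d/dt) (i - t d/dt)⁻¹` of Cayley transforms. -/
def cayleyProd : ℕ → L2pos →ₗ[ℂ] L2pos
  | 0 => LinearMap.id
  | n + 1 => -(cayleyOp n ∘ₗ cayleyProd n)

theorem norm_cayleyProd (n : ℕ) (g : L2pos) : ‖cayleyProd n g‖ = ‖g‖ := by
  induction n with
  | zero => rfl
  | succ n ih => rw [cayleyProd, LinearMap.neg_apply, norm_neg, LinearMap.comp_apply,
      norm_cayleyOp, ih]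

theorem inner_cayleyProd (n : ℕ) (g h : L2pos) :
    inner ℂ (cayleyProd n g) (cayleyProd n h) = inner ℂ g h :=
  (LinearMap.norm_map_iff_inner_map_map (cayleyProd n)).1 (norm_cayleyProd n) g h

theorem cayleyProd_hardyOp (n j : ℕ) (g : L2pos) :
    cayleyProd n (hardyOp j g) = hardyOp j (cayleyProd n g) := by
  induction n with
  | zero => rfl
  | succ n ih =>
    simp only [cayleyProd, LinearMap.neg_apply, LinearMap.comp_apply, ih, cayleyOp_apply, map_neg,
      map_sub, map_smul, hardyOp_comm n j]

/-- The composition `R_j R_{j+1} ⋯ R_{j+m-1}` of Hardy operators. -/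
def hardyProd : ℕ → ℕ → L2pos →ₗ[ℂ] L2pos
  | _, 0 => LinearMap.id
  | j, m + 1 => hardyOp j ∘ₗ hardyProd (j + 1) m

theorem hardyProd_succ (j m : ℕ) (g : L2pos) :
    hardyProd j (m + 1) g = hardyProd j m (hardyOp (j + m) g) := by
  induction m generalizing j with
  | zero => rfl
  | succ m ih =>
    rw [hardyProd, LinearMap.comp_apply, ih, hardyProd, LinearMap.comp_apply,
      show j + 1 + m = j + (m + 1) by omega]

theorem hardyProd_injective (j m : ℕ) : Function.Injective (hardyProd j m) := by
  induction m generalizing j with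
  | zero => exact Function.injective_id
  | succ m ih => exact (hardyOp_injective j).comp (ih (j + 1))

theorem exists_hardyProd_eq (j : ℕ) {k n : ℕ} (hkn : k ≤ n) (g : L2pos) :
    ∃ h, hardyProd j n g = hardyProd j k h := by
  induction n, hkn using Nat.le_induction generalizing g with
  | base => exact ⟨g, rfl⟩
  | succ n _ ih => rw [hardyProd_succ]; exact ih _

/-! ### The spaces `H₂⁽ⁿ⁾` -/

/-- The function `z ↦ zᵏ F⁽ᵏ⁾(z)` for `F` defined on `ℂ`. -/
def zD (k : ℕ) (F : ℂ → ℂ) (z : ℂ) : ℂ := z ^ k * iteratedDeriv k F z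

theorem zDeriv_eq_zD (k : ℕ) (F : ℍ → ℂ) : zDeriv k F = zD k (F ∘ ofComplex) := rfl

theorem zD_congr {F G : ℂ → ℂ} (h : EqOn F G upperHalfPlaneSet) (k : ℕ) :
    EqOn (zD k F) (zD k G) upperHalfPlaneSet := by
  intro z hz
  have : iteratedDeriv k F z = iteratedDeriv k G z :=
    Filter.EventuallyEq.iteratedDeriv_eq k ((eventually_upper hz).mono fun w hw => h hw)
  rw [zD, zD, this]

theorem differentiableAt_iteratedDeriv {F : ℂ → ℂ} (hF : DifferentiableOn ℂ F upperHalfPlaneSet)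
    (k : ℕ) {z : ℂ} (hz : z ∈ upperHalfPlaneSet) : DifferentiableAt ℂ (iteratedDeriv k F) z := by
  rw [iteratedDeriv_eq_iterate]
  exact ((hF.analyticAt (isOpen_upperHalfPlaneSet.mem_nhds hz)).iterated_deriv k).differentiableAt

theorem differentiableAt_zD {F : ℂ → ℂ} (hF : DifferentiableOn ℂ F upperHalfPlaneSet)
    (k : ℕ) {z : ℂ} (hz : z ∈ upperHalfPlaneSet) : DifferentiableAt ℂ (zD k F) z :=
  (differentiableAt_id.pow k).mul (differentiableAt_iteratedDeriv hF k hz)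

theorem mul_deriv_zD {F : ℂ → ℂ} (hF : DifferentiableOn ℂ F upperHalfPlaneSet)
    (k : ℕ) {z : ℂ} (hz : z ∈ upperHalfPlaneSet) :
    z * deriv (zD k F) z = k * zD k F z + zD (k + 1) F z := by
  have h := ((hasDerivAt_pow k z).mul (differentiableAt_iteratedDeriv hF k hz).hasDerivAt).deriv
  have h2 : deriv (zD k F) z = k * z ^ (k - 1) * iteratedDeriv k F z +
      z ^ k * deriv (iteratedDeriv k F) z := h
  rw [h2, zD, zD, iteratedDeriv_succ]
  rcases k with _ | k
  · simp
  · simp only [Nat.add_sub_cancel]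
    ring

theorem zD_zero (F : ℂ → ℂ) : zD 0 F = F := by
  ext z; simp [zD]

/-- `zⁿ dⁿ/dzⁿ = ∏_{i<n} (z d/dz - i)`, and `z d/dz - i` is `-(i + 1 + t d/dt)` on the side of
`L²(ℝ⁺)`. -/
theorem zD_hF_hardyProd (n : ℕ) (g : L2pos) :
    EqOn (zD n (hF (hardyProd 0 n g))) (hF (cayleyProd n g)) upperHalfPlaneSet := by
  induction n generalizing g with
  | zero => rw [zD_zero]; exact fun _ _ => rfl
  | succ n ih =>
    intro z hz
    have h1 : EqOn (zD n (hF (hardyProd 0 (n + 1) g))) (hF (hardyOp n (cayleyProd n g)))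
        upperHalfPlaneSet := by
      rw [hardyProd_succ, zero_add, ← cayleyProd_hardyOp]
      exact ih _
    have h2 := mul_deriv_zD (differentiableOn_hF (Lp.memLp (hardyProd 0 (n + 1) g))) n hz
    have h3 := euler_hardyOp n (cayleyProd n g) z hz
    rw [h1 hz, deriv_eq_of_eqOn h1 hz] at h2
    have h4 : hF (cayleyProd (n + 1) g) z = -((2 * n + 1) * hF (hardyOp n (cayleyProd n g)) z -
        hF (cayleyProd n g) z) := by
      have : cayleyProd (n + 1) g = (-1 : ℂ) • ((2 * n + 1 : ℂ) • hardyOp n (cayleyProd n g) -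
          cayleyProd n g) := by
        rw [neg_one_smul]; rfl
      rw [this, hF_smul, hF_sub hz, hF_smul]
      ring
    rw [h4]
    linear_combination h3 - h2

/-- Commutation of `zᵏ dᵏ/dzᵏ` with the Euler operator `z d/dz + a`. -/
theorem zD_euler {F : ℂ → ℂ} (hF : DifferentiableOn ℂ F upperHalfPlaneSet) (a : ℂ) (k : ℕ) :
    EqOn (zD k fun z => z * deriv F z + a * F z)
      (fun z => zD (k + 1) F z + (k + a) * zD k F z) upperHalfPlaneSet := by
  have hG : DifferentiableOn ℂ (fun z => z * deriv F z + a * F z) upperHalfPlaneSet :=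
    (differentiableOn_id.mul (hF.deriv isOpen_upperHalfPlaneSet)).add (hF.const_mul a)
  induction k with
  | zero =>
    intro z hz
    have := mul_deriv_zD hF 0 hz
    simp only [zD_zero, Nat.cast_zero, zero_mul, zero_add] at this ⊢
    rw [this]
  | succ k ih =>
    intro z hz
    have h1 := mul_deriv_zD hG k hz
    have h2 : deriv (fun z => zD (k + 1) F z + (k + a) * zD k F z) z =
        deriv (zD (k + 1) F) z + (k + a) * deriv (zD k F) z := by
      rw [deriv_fun_add (differentiableAt_zD hF _ hz) ((differentiableAt_zD hF _ hz).const_mul _),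
        deriv_const_mul _ (differentiableAt_zD hF _ hz)]
    rw [deriv_eq_of_eqOn ih hz, h2, ih hz] at h1
    have h3 := mul_deriv_zD hF k hz
    have h4 := mul_deriv_zD hF (k + 1) hz
    push_cast at h4 ⊢
    linear_combination h4 + (k + a) * h3 - h1

/-- If `zᵏ F⁽ᵏ⁾ ∈ H₂` for `k ≤ m`, then `F` is the Fourier transform of a function in the range of
`R_j ⋯ R_{j+m-1}`: `z F' + (j + 1) F` satisfies the hypothesis with `m - 1`. -/
theorem exists_hF_hardyProd (m j : ℕ) {F : ℂ → ℂ} (hF : DifferentiableOn ℂ F upperHalfPlaneSet)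
    (h : ∀ k ≤ m, MemH2 (zD k F)) :
    ∃ g : L2pos, EqOn F (PaleyWiener.hF (hardyProd j m g)) upperHalfPlaneSet := by
  induction m generalizing j F with
  | zero =>
    have h0 := h 0 le_rfl
    rw [zD_zero] at h0
    exact h0.exists_hF_eq
  | succ m ih =>
    have h0 := h 0 (Nat.zero_le _)
    rw [zD_zero] at h0
    obtain ⟨f, hf⟩ := h0.exists_hF_eq
    have hG : DifferentiableOn ℂ (fun z => z * deriv F z + (j + 1 : ℂ) * F z) upperHalfPlaneSet :=
      (differentiableOn_id.mul (hF.deriv isOpen_upperHalfPlaneSet)).add (hF.const_mul _)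
    obtain ⟨g, hg⟩ := ih (j + 1) hG fun k hk =>
      ((h (k + 1) (by omega)).add ((h k (by omega)).const_smul (k + (j + 1) : ℂ))).congr
        (zD_euler hF _ k)
    refine ⟨g, ?_⟩
    have he : Euler (j + 1) f (hardyProd (j + 1) m g) := by
      intro z hz
      rw [← hg hz, ← hf hz, ← deriv_eq_of_eqOn hf hz]
    have : f = hardyProd j (m + 1) g := he.unique (euler_hardyOp j _)
    rw [← this]
    exact hf

theorem holFourier_comp_ofComplex (f : ℝ → ℂ) :
    EqOn (holFourier f ∘ ofComplex) (hF f) upperHalfPlaneSet := by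
  intro z hz
  simp only [Function.comp_apply, holFourier_eq]
  rw [ofComplex_apply_of_im_pos hz]

/-- On the range of `hardyProd`, the operator `zⁿ dⁿ/dzⁿ` becomes an isometry of `L²(ℝ⁺)`. -/
theorem zDeriv_holFourier (n : ℕ) (g : L2pos) :
    EqOn (zDeriv n (holFourier (hardyProd 0 n g))) (hF (cayleyProd n g)) upperHalfPlaneSet := by
  rw [zDeriv_eq_zD]
  exact (zD_congr (holFourier_comp_ofComplex _) n).trans (zD_hF_hardyProd n g)

/-- `H₂⁽ⁿ⁾` consists of the Fourier transforms of the range of a product of Hardy operators. -/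
theorem mem_HS_iff {n : ℕ} {F : ℍ → ℂ} :
    F ∈ HS n ↔ ∃ g : L2pos, F = holFourier (hardyProd 0 n g) := by
  constructor
  · intro hF
    have hF' : ∀ k ≤ n, MemH2 (zDeriv k F) := hF
    have hd : DifferentiableOn ℂ (F ∘ ofComplex) upperHalfPlaneSet :=
      (hF' 0 n.zero_le).1.congr fun w _ => by simp [zDeriv]
    obtain ⟨g, hg⟩ := exists_hF_hardyProd n 0 hd hF'
    refine ⟨g, funext fun z => ?_⟩
    have := hg z.2
    rw [holFourier_eq]
    rw [← this]
    simp [ofComplex_apply]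
  · rintro ⟨g, rfl⟩ k hk
    obtain ⟨h, hh⟩ := exists_hardyProd_eq 0 hk g
    rw [hh]
    exact (memH2_hF _).congr (zDeriv_holFourier k h)

/-! ### The operators `W⁻ⁿ` -/

/-- If `G 0, …, G n` is a chain of derivatives on an open set, the last derivative only existing
almost everywhere, then `G n` is the `n`-th iterated derivative of any extension of `G 0`. -/
theorem iteratedDeriv_chain {I : Set ℝ} (hI : IsOpen I) {n : ℕ} {G : ℕ → ℝ → ℂ}
    (h1 : ∀ k, k + 1 < n → ∀ x ∈ I, HasDerivAt (G k) (G (k + 1) x) x)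
    (h2 : ∀ k, k + 1 = n → ∀ᵐ x ∂volume.restrict I, HasDerivAt (G k) (G (k + 1) x) x)
    {f : ℝ → ℂ} (hf : EqOn f (G 0) I) :
    ∀ᵐ x ∂volume.restrict I, (∀ k < n, DifferentiableAt ℝ (iteratedDeriv k f) x) ∧
      iteratedDeriv n f x = G n x := by
  have key : ∀ k, k < n → EqOn (iteratedDeriv k f) (G k) I := by
    intro k
    induction k with
    | zero => intro _ x hx; rw [iteratedDeriv_zero, hf hx]
    | succ k ih =>
      intro hk x hx
      rw [iteratedDeriv_succ]
      have he : iteratedDeriv k f =ᶠ[𝓝 x] G k :=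
        Filter.eventuallyEq_of_mem (hI.mem_nhds hx) (ih (by omega))
      rw [he.deriv_eq, (h1 k hk x hx).deriv]
  have hd : ∀ k < n, ∀ x ∈ I, ∀ d, HasDerivAt (G k) d x → HasDerivAt (iteratedDeriv k f) d x :=
    fun k hk x hx d h => h.congr_of_eventuallyEq
      (Filter.eventuallyEq_of_mem (hI.mem_nhds hx) (key k hk))
  rcases n with _ | m
  · filter_upwards [ae_restrict_mem hI.measurableSet] with x hx
    exact ⟨fun k hk => absurd hk (Nat.not_lt_zero k), by rw [iteratedDeriv_zero, hf hx]⟩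
  · filter_upwards [ae_restrict_mem hI.measurableSet, h2 m rfl] with x hx h
    refine ⟨fun k hk => ?_, ?_⟩
    · rcases (Nat.lt_succ_iff_lt_or_eq.1 hk) with h' | rfl
      · exact (hd k hk x hx _ (h1 k (by omega) x hx)).differentiableAt
      · exact (hd k hk x hx _ h).differentiableAt
    · rw [iteratedDeriv_succ, (hd m (by omega) x hx _ h).deriv]

/-- The operator `W⁻¹`: the tail integral `∫_t^∞ φ(s) ds`. -/
def tailInt (φ : ℝ → ℂ) (t : ℝ) : ℂ := ∫ s in Ioi t, φ s

theorem MemL2t.integrableOn_Ioi {m : ℕ} {φ : ℝ → ℂ} (hφ : MemL2t (m + 1) φ) :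
    ∀ t > 0, IntegrableOn φ (Ioi t) := by
  intro t ht
  refine (integrableOn_weight_mul hφ m t ht).congr_fun (fun s hs => ?_) measurableSet_Ioi
  have hs0 : (s : ℂ) ≠ 0 := by exact_mod_cast (ht.trans hs).ne'
  field_simp

theorem pow_mul_tailInt {m : ℕ} {φ g : ℝ → ℂ}
    (hg : g =ᵐ[posMeasure] fun t : ℝ => (t : ℂ) ^ (m + 1) * φ t) {t : ℝ} (ht : 0 < t) :
    (t : ℂ) ^ m * tailInt φ t = hardyFun m g t := by
  rw [hardyFun_congr hg ht, hardyFun, tailInt]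
  congr 1
  refine setIntegral_congr_fun measurableSet_Ioi fun s hs => ?_
  have hs0 : (s : ℂ) ≠ 0 := by exact_mod_cast (ht.trans hs).ne'
  field_simp

theorem MemL2t.tailInt {m : ℕ} {φ : ℝ → ℂ} (hφ : MemL2t (m + 1) φ) : MemL2t m (tailInt φ) := by
  refine (memLp_hardyFun m hφ).ae_eq ?_
  filter_upwards [ae_restrict_mem measurableSet_Ioi] with t ht
  exact (pow_mul_tailInt (ae_eq_refl _) ht).symm

/-- The function `t^m` does not vanish on `ℝ⁺`, so measurability passes from `t^m φ` to `φ`. -/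
theorem MemL2t.norm {m : ℕ} {φ : ℝ → ℂ} (hφ : MemL2t m φ) : MemL2t m (fun t => (‖φ t‖ : ℂ)) := by
  have hm : AEStronglyMeasurable φ posMeasure := by
    have h1 : AEStronglyMeasurable (fun t : ℝ => ((t : ℂ) ^ m)⁻¹) posMeasure :=
      (Measurable.inv (by fun_prop)).aestronglyMeasurable
    refine (h1.mul hφ.1).congr ?_
    filter_upwards [ae_restrict_mem measurableSet_Ioi] with t ht
    have ht0 : (t : ℂ) ≠ 0 := by exact_mod_cast (show (0 : ℝ) < t from ht).ne'
    simp only [Pi.mul_apply]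
    field_simp
  refine MemLp.of_le hφ ?_ (Eventually.of_forall fun t => by simp)
  exact (Continuous.aestronglyMeasurable (by fun_prop)).mul
    (Complex.continuous_ofReal.comp_aestronglyMeasurable hm.norm)

theorem integral_sub_pow (m : ℕ) {t s : ℝ} (hts : t ≤ s) :
    ∫ r in Ioo t s, (((r - t) ^ m : ℝ) : ℂ) = (((s - t) ^ (m + 1) / (m + 1) : ℝ) : ℂ) := by
  rw [integral_complex_ofReal, ← integral_Ioc_eq_integral_Ioo,
    ← intervalIntegral.integral_of_le hts,
    intervalIntegral.integral_comp_sub_right (fun r => r ^ m) t, integral_pow]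
  simp

/-- Composing `W⁻ᵐ` with `W⁻¹` gives `W⁻⁽ᵐ⁺¹⁾`: Fubini's theorem. -/
theorem Wneg_tailInt (m : ℕ) {φ : ℝ → ℂ} (hφ : MemL2t (m + 1) φ) {t : ℝ} (ht : 0 < t) :
    Wneg (m + 1) φ t = Wneg m (tailInt φ) t := by
  rcases m with _ | m
  · simp [Wneg, tailInt]
  have h1 : ∀ r > t, IntegrableOn φ (Ioi r) := fun r hr => hφ.integrableOn_Ioi r (ht.trans hr)
  have h2 : IntegrableOn (fun r => ‖(((r - t) ^ m : ℝ) : ℂ)‖ * ∫ s in Ioi r, ‖φ s‖) (Ioi t) := by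
    refine (integrableOn_Wneg hφ.norm.tailInt ht).norm.congr ?_
    refine Eventually.of_forall fun r => ?_
    simp only [norm_mul, PaleyWiener.tailInt, integral_complex_ofReal]
    rw [Complex.norm_real (∫ s in Ioi r, ‖φ s‖),
      Real.norm_of_nonneg (integral_nonneg fun _ => norm_nonneg _)]
  have h := (integral_mul_tail (κ := fun r => (((r - t) ^ m : ℝ) : ℂ))
    (Continuous.aestronglyMeasurable (by fun_prop)) (hφ.integrableOn_Ioi t ht).1 h1 h2).1
  have e : ∫ s in Ioi t, φ s * ∫ r in Ioo t s, (((r - t) ^ m : ℝ) : ℂ) =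
      (m + 1 : ℂ)⁻¹ * ∫ s in Ioi t, (((s - t) ^ (m + 1) : ℝ) : ℂ) * φ s := by
    rw [← integral_const_mul]
    refine setIntegral_congr_fun measurableSet_Ioi fun s hs => ?_
    rw [integral_sub_pow m (le_of_lt hs)]
    push_cast
    ring
  simp only [Wneg, PaleyWiener.tailInt]
  rw [h, e, Nat.factorial_succ]
  push_cast
  rw [mul_inv]
  ring

theorem MemL2t.iterate_tailInt {n : ℕ} {φ : ℝ → ℂ} (hφ : MemL2t n φ) {j : ℕ} (hj : j ≤ n) :
    MemL2t (n - j) (PaleyWiener.tailInt^[j] φ) := by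
  induction j with
  | zero => exact hφ
  | succ j ih =>
    rw [Function.iterate_succ_apply']
    have := ih (by omega)
    rw [show n - j = n - (j + 1) + 1 by omega] at this
    exact this.tailInt

/-- `W⁻ⁿ` is the `n`-th power of `W⁻¹`. -/
theorem Wneg_eq_iterate {n : ℕ} {φ : ℝ → ℂ} (hφ : MemL2t n φ) :
    EqOn (Wneg n φ) (tailInt^[n] φ) (Ioi 0) := by
  induction n generalizing φ with
  | zero => exact fun _ _ => rfl
  | succ n ih =>
    intro t ht
    rw [Wneg_tailInt n hφ ht, Function.iterate_succ_apply]
    exact ih hφ.tailInt ht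

/-- `W⁻ⁿ` in terms of Hardy operators. -/
theorem Wneg_ae_eq {n : ℕ} {φ : ℝ → ℂ} (hφ : MemL2t n φ) {g : L2pos}
    (hg : g =ᵐ[posMeasure] fun t : ℝ => (t : ℂ) ^ n * φ t) :
    Wneg n φ =ᵐ[posMeasure] hardyProd 0 n g := by
  induction n generalizing φ g with
  | zero =>
    filter_upwards [hg] with t ht
    simpa [Wneg] using! ht.symm
  | succ n ih =>
    rw [hardyProd_succ, zero_add]
    have h1 : hardyOp n g =ᵐ[posMeasure] fun t : ℝ => (t : ℂ) ^ n * tailInt φ t := by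
      filter_upwards [coeFn_hardyOp n g, ae_restrict_mem measurableSet_Ioi] with t h ht
      rw [h, pow_mul_tailInt hg ht]
    filter_upwards [ih hφ.tailInt h1, ae_restrict_mem measurableSet_Ioi] with t h ht
    rw [Wneg_tailInt n hφ ht, h]

theorem hasDerivAt_tailInt {φ : ℝ → ℂ} (h1 : ∀ t > 0, IntegrableOn φ (Ioi t)) {t : ℝ} (ht : 0 < t)
    (hc : ContinuousOn φ (Ioi 0)) : HasDerivAt (tailInt φ) (-φ t) t := by
  have h2 : HasDerivAt (fun u => (∫ s in Ioi (1 : ℝ), φ s) - ∫ s in (1 : ℝ)..u, φ s) (-φ t) t := by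
    rw [← zero_sub]
    refine (hasDerivAt_const _ _).sub ?_
    refine intervalIntegral.integral_hasDerivAt_right
      (intervalIntegrable_of_tail h1 one_pos ht) ?_ (hc.continuousAt (Ioi_mem_nhds ht))
    exact hc.stronglyMeasurableAtFilter isOpen_Ioi t ht
  refine h2.congr_of_eventuallyEq ?_
  filter_upwards [Ioi_mem_nhds ht] with u hu
  exact tail_eq h1 one_pos hu

theorem ae_hasDerivAt_tailInt {φ : ℝ → ℂ} (h1 : ∀ t > 0, IntegrableOn φ (Ioi t)) :
    ∀ᵐ t ∂posMeasure, HasDerivAt (tailInt φ) (-φ t) t := by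
  have hU : Ioi (0 : ℝ) = ⋃ k : ℕ, Ioo (1 / (k + 1 : ℝ)) (k + 1) := by
    ext x
    simp only [mem_Ioi, mem_iUnion, mem_Ioo]
    constructor
    · intro hx
      obtain ⟨k, hk⟩ := exists_nat_gt (max x⁻¹ x)
      have h2 := (le_max_left _ _).trans_lt hk
      have h3 := (le_max_right _ _).trans_lt hk
      refine ⟨k, ?_, by linarith⟩
      rw [one_div]
      exact inv_lt_of_inv_lt₀ hx (by linarith)
    · rintro ⟨k, hk, -⟩
      exact lt_trans (by positivity) hk
  rw [posMeasure, hU, ae_restrict_iUnion_iff]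
  intro k
  rw [ae_restrict_iff' measurableSet_Ioo]
  have hk0 : (0 : ℝ) < 1 / (k + 1) := by positivity
  have hk1 : (0 : ℝ) < k + 1 := by positivity
  filter_upwards [(intervalIntegrable_of_tail h1 hk0 hk1).ae_hasDerivAt_integral] with t h ht
  have ht0 : 0 < t := hk0.trans ht.1
  have hle : (1 / (k + 1) : ℝ) ≤ k + 1 := (ht.1.trans ht.2).le
  have h2 : HasDerivAt (fun u => (∫ s in Ioi (1 / (k + 1) : ℝ), φ s) -
      ∫ s in (1 / (k + 1) : ℝ)..u, φ s) (-φ t) t := by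
    rw [← zero_sub]
    refine (hasDerivAt_const _ _).sub (h ?_ _ left_mem_uIcc)
    rw [uIcc_of_le hle]
    exact Ioo_subset_Icc_self ht
  refine h2.congr_of_eventuallyEq ?_
  filter_upwards [Ioi_mem_nhds ht0] with u hu
  exact tail_eq h1 hk0 hu

/-- The `n`-th derivative of `W⁻ⁿ φ` is `(-1)ⁿ φ`. -/
theorem iteratedDeriv_Wneg {n : ℕ} {φ : ℝ → ℂ} (hφ : MemL2t n φ) :
    ∀ᵐ t ∂posMeasure, (∀ k < n, DifferentiableAt ℝ (iteratedDeriv k (Wneg n φ)) t) ∧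
      iteratedDeriv n (Wneg n φ) t = (-1) ^ n * φ t := by
  have hint : ∀ j < n, ∀ t > 0, IntegrableOn (tailInt^[j] φ) (Ioi t) := fun j hj => by
    have := hφ.iterate_tailInt hj.le
    rw [show n - j = n - (j + 1) + 1 by omega] at this
    exact this.integrableOn_Ioi
  have h := iteratedDeriv_chain (isOpen_Ioi (a := (0 : ℝ))) (n := n)
    (G := fun k t => (-1) ^ k * tailInt^[n - k] φ t) (f := Wneg n φ) ?_ ?_ ?_
  · filter_upwards [h] with t ht
    simpa using! ht
  · intro k hk t ht
    obtain ⟨j, rfl⟩ : ∃ j, n = j + (k + 1) + 1 := ⟨n - k - 2, by omega⟩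
    have hc : ContinuousOn (tailInt^[j + 1] φ) (Ioi 0) := by
      rw [Function.iterate_succ', Function.comp_def]
      exact continuousOn_tail (hint j (by omega))
    have := (hasDerivAt_tailInt (hint (j + 1) (by omega)) ht hc).const_mul ((-1 : ℂ) ^ k)
    rw [show j + (k + 1) + 1 - k = (j + 1) + 1 by omega,
      show j + (k + 1) + 1 - (k + 1) = j + 1 by omega, Function.iterate_succ']
    convert! this using 1
    ring
  · rintro k rfl
    filter_upwards [ae_hasDerivAt_tailInt (hint 0 (by omega))] with t h
    have := h.const_mul ((-1 : ℂ) ^ k)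
    simp only [Nat.add_sub_cancel_left, Nat.sub_self]
    convert! this using 1
    simp only [Function.iterate_zero, id]
    ring
  · intro t ht
    simpa using! Wneg_eq_iterate hφ ht

/-- The inner product of `𝒯₂⁽ⁿ⁾` is that of the functions `tⁿ φ`; the signs `(-1)ⁿ` cancel. -/
theorem innerT_Wneg {n : ℕ} {φ ψ : ℝ → ℂ} (hφ : MemL2t n φ) (hψ : MemL2t n ψ) {f g : L2pos}
    (hf : f =ᵐ[posMeasure] fun t : ℝ => (t : ℂ) ^ n * φ t)
    (hg : g =ᵐ[posMeasure] fun t : ℝ => (t : ℂ) ^ n * ψ t) :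
    innerT n (Wneg n φ) (Wneg n ψ) = inner ℂ g f := by
  rw [inner_eq_integral, innerT]
  refine integral_congr_ae ?_
  filter_upwards [iteratedDeriv_Wneg hφ, iteratedDeriv_Wneg hψ, hf, hg] with t h1 h2 h3 h4
  rw [h1.2, h2.2, h3, h4]
  simp only [map_mul, map_pow, map_neg, map_one, Complex.conj_ofReal]
  have : ((-1 : ℂ) ^ n) * (-1) ^ n = 1 := by rw [← mul_pow]; simp
  linear_combination (φ t * conj (ψ t) * (t : ℂ) ^ (2 * n)) * this

/-- `𝒯₂⁽ⁿ⁾` is the range of a product of Hardy operators. -/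
theorem mem_T2_iff {n : ℕ} {f : L2pos} : f ∈ T2 n ↔ ∃ g, hardyProd 0 n g = f := by
  constructor
  · rintro ⟨φ, hφ, hf⟩
    exact ⟨MemLp.toLp _ hφ, Lp.ext ((Wneg_ae_eq hφ (MemLp.coeFn_toLp hφ)).symm.trans hf.symm)⟩
  · rintro ⟨g, rfl⟩
    have hg : g =ᵐ[posMeasure] fun t : ℝ => (t : ℂ) ^ n * (((t : ℂ) ^ n)⁻¹ * g t) := by
      filter_upwards [ae_restrict_mem measurableSet_Ioi] with t ht
      have ht0 : (t : ℂ) ≠ 0 := by exact_mod_cast (show (0 : ℝ) < t from ht).ne'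
      field_simp
    have hφ : MemL2t n fun t : ℝ => ((t : ℂ) ^ n)⁻¹ * g t := (Lp.memLp g).ae_eq hg
    exact ⟨_, hφ, (Wneg_ae_eq hφ hg).symm⟩

/-! ### Derivatives of boundary functions -/

/-- Boundary functions only depend on the values in the upper half-plane. -/
theorem bdry_congr {F G : ℂ → ℂ} (h : EqOn F G upperHalfPlaneSet) : bdry F = bdry G := by
  ext x
  have : (fun y : ℝ => F (x + y * Complex.I)) =ᶠ[𝓝[>] 0] fun y : ℝ => G (x + y * Complex.I) := by
    filter_upwards [self_mem_nhdsWithin] with y hy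
    exact h (mem_upper hy)
  rw [bdry, bdry, limUnder, limUnder, Filter.map_congr this]

theorem tendsto_congr_upper {F G : ℂ → ℂ} (h : EqOn F G upperHalfPlaneSet) {x : ℝ} {l : Filter ℂ}
    (hG : Tendsto (fun y : ℝ => G (x + y * Complex.I)) (𝓝[>] 0) l) :
    Tendsto (fun y : ℝ => F (x + y * Complex.I)) (𝓝[>] 0) l := by
  refine hG.congr' ?_
  filter_upwards [self_mem_nhdsWithin] with y hy
  exact (h (mem_upper hy)).symm

/-- If `z F' + F = (zF)'` also is the Fourier transform of an `L²` function, then `F` has boundary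
values at all points except the origin, and `x F*(x)` is a primitive. -/
theorem Euler.exists_tendsto {f w : L2pos} (h : Euler 1 f w) :
    ∃ c : ℂ, ∀ x : ℝ, x ≠ 0 → Tendsto (fun y : ℝ => hF f (x + y * Complex.I)) (𝓝[>] 0)
      (𝓝 ((c + ∫ u in (0 : ℝ)..x, bd w u) / x)) := by
  -- a point where the boundary value exists fixes the constant of integration
  obtain ⟨p, hp⟩ := (ae_tendsto_hF f).exists
  have hw := memLp_bd w
  have line (x : ℝ) : Tendsto (fun y : ℝ => (x + y * Complex.I : ℂ)) (𝓝[>] 0) (𝓝 (x : ℂ)) := by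
    have : Tendsto (fun y : ℝ => (x + y * Complex.I : ℂ)) (𝓝 0) (𝓝 (x + (0 : ℝ) * Complex.I)) :=
      Continuous.tendsto (by fun_prop) _
    simpa using this.mono_left nhdsWithin_le_nhds
  refine ⟨p * bd f p - ∫ u in (0 : ℝ)..p, bd w u, fun x hx => ?_⟩
  have hx0 : (x : ℂ) ≠ 0 := by exact_mod_cast hx
  have key : ∀ y : ℝ, 0 < y → (x + y * Complex.I) * hF f (x + y * Complex.I) =
      (p + y * Complex.I) * hF f (p + y * Complex.I) +
        ∫ u in p..x, hF w (u + y * Complex.I) := by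
    intro y hy
    have hd : ∀ u ∈ uIcc p x, HasDerivAt
        (fun u : ℝ => (u + y * Complex.I) * hF f (u + y * Complex.I))
        (hF w (u + y * Complex.I)) u := by
      intro u _
      have h1 : HasDerivAt (fun z : ℂ => z * hF f z) (hF w (u + y * Complex.I))
          (u + y * Complex.I) := by
        refine ((hasDerivAt_id _).mul
          (differentiableAt_hF f (mem_upper hy)).hasDerivAt).congr_deriv ?_
        rw [← h _ (mem_upper hy)]
        ring
      have h2 : HasDerivAt (fun u : ℝ => (u + y * Complex.I : ℂ)) 1 u :=
        (HasDerivAt.ofReal_comp (hasDerivAt_id u)).add_const _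
      simpa using! h1.comp u h2
    have hc : Continuous fun u : ℝ => hF w (u + y * Complex.I) :=
      continuous_line (differentiableOn_hF (Lp.memLp w)).continuousOn hy
    rw [intervalIntegral.integral_eq_sub_of_hasDerivAt hd (hc.intervalIntegrable _ _)]
    ring
  have h1 := ((line p).mul hp).add (tendsto_intervalIntegral_hF w p x)
  have h2 := h1.div (line x) hx0
  have e : (p * bd f p - (∫ u in (0 : ℝ)..p, bd w u) + ∫ u in (0 : ℝ)..x, bd w u) / x =
      (p * bd f p + ∫ u in p..x, bd w u) / x := by
    rw [← intervalIntegral.integral_add_adjacent_intervals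
      (intervalIntegrable_of_memLp_two hw 0 p) (intervalIntegrable_of_memLp_two hw p x)]
    ring
  rw [e]
  refine h2.congr' ?_
  filter_upwards [self_mem_nhdsWithin] with y hy
  have hy0 : (x + y * Complex.I : ℂ) ≠ 0 := by
    intro h0
    have := congrArg Complex.im h0
    simp at this
    exact (ne_of_gt hy) this
  simp only [Pi.div_apply]
  rw [← key y hy, mul_div_cancel_left₀ _ hy0]

/-- Regularity of the boundary function of `F` when `zᵏ F⁽ᵏ⁾` is the Fourier transform of `h k` for
`k ≤ n`. With `b k` the boundary function of `zᵏ F⁽ᵏ⁾`, the relation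
`(z · zᵏ F⁽ᵏ⁾)' = (k + 1) zᵏ F⁽ᵏ⁾ + z^(k+1) F^(k+1)` passes to the boundary and makes `b k / xᵏ`
a chain of derivatives off the origin. -/
theorem ae_iteratedDeriv_bdry {n : ℕ} {F : ℂ → ℂ} (hd : DifferentiableOn ℂ F upperHalfPlaneSet)
    {h : ℕ → L2pos} (hh : ∀ k ≤ n, EqOn (zD k F) (hF (h k)) upperHalfPlaneSet) :
    ∀ᵐ x : ℝ, (∀ k < n, DifferentiableAt ℝ (iteratedDeriv k (bdry F)) x) ∧
      (x : ℂ) ^ n * iteratedDeriv n (bdry F) x = bd (h n) x := by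
  set w : ℕ → L2pos := fun k => (k + 1 : ℂ) • h k + h (k + 1) with hw
  have hE : ∀ k, k < n → Euler 1 (h k) (w k) := by
    intro k hk z hz
    have h1 := mul_deriv_zD hd k hz
    rw [deriv_eq_of_eqOn (hh k hk.le) hz, hh k hk.le hz, hh (k + 1) hk hz] at h1
    rw [hF_add hz, hF_smul]
    linear_combination h1
  have hA : ∀ k, ∃ c : ℂ, k < n → ∀ x : ℝ, x ≠ 0 → Tendsto
      (fun y : ℝ => hF (h k) (x + y * Complex.I)) (𝓝[>] 0)
      (𝓝 ((c + ∫ u in (0 : ℝ)..x, bd (w k) u) / x)) := by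
    intro k
    by_cases hk : k < n
    · obtain ⟨c, hc⟩ := (hE k hk).exists_tendsto
      exact ⟨c, fun _ => hc⟩
    · exact ⟨0, fun h' => absurd h' hk⟩
  choose c hc using hA
  set A : ℕ → ℝ → ℂ := fun k x => c k + ∫ u in (0 : ℝ)..x, bd (w k) u with hAdef
  set b : ℕ → ℝ → ℂ := fun k => bdry (hF (h k)) with hb
  have hbA : ∀ k < n, ∀ x : ℝ, x ≠ 0 → b k x = A k x / x := fun k hk x hx =>
    (hc k hk x hx).limUnder_eq
  have hAc : ∀ k, Continuous (A k) := fun k => continuous_const.add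
    (intervalIntegral.continuous_primitive (fun p q => intervalIntegrable_of_memLp_two
      (memLp_bd (w k)) p q) 0)
  have hbc : ∀ k < n, ContinuousOn (b k) {0}ᶜ := fun k hk =>
    ((hAc k).continuousOn.div Complex.continuous_ofReal.continuousOn
      fun x hx => by exact_mod_cast hx).congr fun x hx => hbA k hk x hx
  have hwb : ∀ k < n, bd (w k) =ᵐ[volume] fun x => (k + 1) * b k x + b (k + 1) x := by
    intro k hk
    filter_upwards [ae_tendsto_hF (w k), ae_tendsto_hF (h k), ae_tendsto_hF (h (k + 1)),
      bdry_hF_ae_eq (h k), bdry_hF_ae_eq (h (k + 1))] with x t1 t2 t3 e1 e2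
    rw [hb]
    simp only
    rw [e1, e2]
    refine tendsto_nhds_unique t1 (tendsto_congr_upper (G := fun z => (k + 1) * hF (h k) z +
      hF (h (k + 1)) z) (fun z hz => ?_) ((t2.const_mul _).add t3))
    rw [hF_add hz, hF_smul]
  -- `b k / xᵏ = A k / x^(k+1)` is the `k`-th derivative of the boundary function
  have hG : ∀ k < n, ∀ x : ℝ, x ≠ 0 → HasDerivAt (A k) ((k + 1) * b k x + b (k + 1) x) x →
      HasDerivAt (fun x : ℝ => b k x / (x : ℂ) ^ k) (b (k + 1) x / (x : ℂ) ^ (k + 1)) x := by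
    intro k hk x hx hder
    have hx0 : (x : ℂ) ≠ 0 := by exact_mod_cast hx
    have h1 : HasDerivAt (fun u : ℝ => (u : ℂ) ^ (k + 1)) ((k + 1 : ℕ) * (x : ℂ) ^ k) x := by
      simpa using! (hasDerivAt_pow (k + 1) (x : ℂ)).comp_ofReal
    have h2 := hder.div h1 (pow_ne_zero _ hx0)
    have h3 : (fun x : ℝ => b k x / (x : ℂ) ^ k) =ᶠ[𝓝 x]
        fun u : ℝ => A k u / (u : ℂ) ^ (k + 1) := by
      filter_upwards [isOpen_compl_singleton.mem_nhds hx] with u hu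
      rw [hbA k hk u hu, div_div, pow_succ']
    refine (h2.congr_of_eventuallyEq h3).congr_deriv ?_
    have hA' : A k x = b k x * x := by rw [hbA k hk x hx]; field_simp
    rw [hA', div_eq_div_iff (by positivity) (by positivity)]
    push_cast
    ring
  have hchain := iteratedDeriv_chain (isOpen_compl_singleton (x := (0 : ℝ))) (n := n)
    (G := fun k x => b k x / (x : ℂ) ^ k) (f := bdry F) ?_ ?_ ?_
  · have hne : ∀ᵐ x : ℝ, x ∈ ({0}ᶜ : Set ℝ) := compl_mem_ae_iff.2 (measure_singleton 0)
    rw [ae_restrict_iff' isOpen_compl_singleton.measurableSet] at hchain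
    filter_upwards [hchain, hne, bdry_hF_ae_eq (h n)] with x h1 h2 h3
    refine ⟨(h1 h2).1, ?_⟩
    have hx0 : (x : ℂ) ≠ 0 := by exact_mod_cast h2
    rw [(h1 h2).2, ← h3, mul_div_cancel₀ _ (pow_ne_zero _ hx0)]
  · intro k hk x hx
    refine hG k (by omega) x hx ?_
    have hcont : ContinuousOn (fun x => (k + 1) * b k x + b (k + 1) x) {0}ᶜ :=
      (continuousOn_const.mul (hbc k (by omega))).add (hbc (k + 1) hk)
    have hint : IntervalIntegrable (fun x => (k + 1) * b k x + b (k + 1) x) volume 0 x :=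
      (intervalIntegrable_of_memLp_two (memLp_bd (w k)) 0 x).congr_ae
        (ae_restrict_of_ae (hwb k (by omega)))
    have hder := (intervalIntegral.integral_hasDerivAt_right hint
      (hcont.stronglyMeasurableAtFilter isOpen_compl_singleton x hx)
      (hcont.continuousAt (isOpen_compl_singleton.mem_nhds hx))).const_add (c k)
    have : A k = fun x => c k + ∫ u in (0 : ℝ)..x, ((k + 1) * b k u + b (k + 1) u) := by
      ext u
      simp only [hAdef]
      congr 1
      exact intervalIntegral.integral_congr_ae ((hwb k (by omega)).mono fun _ h' _ => h')
    rw [this]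
    exact hder
  · rintro k rfl
    refine ae_restrict_of_ae_restrict_of_subset (subset_univ _) ?_
    rw [Measure.restrict_univ]
    have hne : ∀ᵐ x : ℝ, x ∈ ({0}ᶜ : Set ℝ) := compl_mem_ae_iff.2 (measure_singleton 0)
    filter_upwards [LocallyIntegrable.ae_hasDerivAt_integral
      ((memLp_bd (w k)).locallyIntegrable (by norm_num)), hne, hwb k (Nat.lt_succ_self k)]
      with x h1 h2 h3
    refine hG k (Nat.lt_succ_self k) x h2 ?_
    rw [← h3]
    exact (h1 0).const_add (c k)
  · intro x _
    have : b 0 x = bdry F x := by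
      rw [hb]
      simp only
      rw [bdry_congr (fun z hz => (hh 0 (Nat.zero_le _) hz).symm), zD_zero]
    simp [this]

/-! ### The Hilbert space structures -/

section Core

variable {V E : Type*} [AddCommGroup V] [Module ℂ V] [NormedAddCommGroup E] [InnerProductSpace ℂ E]

/-- The inner product transported to `V` along a linear isomorphism. -/
@[reducible]
def coreOfEquiv (L : V ≃ₗ[ℂ] E) : InnerProductSpace.Core ℂ V where
  inner x y := inner ℂ (L x) (L y)
  conj_inner_symm x y := inner_conj_symm _ _
  re_inner_nonneg x := inner_self_nonneg
  add_left x y z := by rw [map_add, inner_add_left]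
  smul_left x y c := by rw [map_smul, inner_smul_left]
  definite x h := by simpa using! h

/-- The isomorphism is an isometry for the transported norm. -/
theorem completeSpace_coreOfEquiv [CompleteSpace E] (L : V ≃ₗ[ℂ] E) :
    @CompleteSpace V
      (coreOfEquiv L).toNormedAddCommGroup.toMetricSpace.toUniformSpace := by
  let _ : NormedAddCommGroup V := (coreOfEquiv L).toNormedAddCommGroup
  have hn : ∀ x : V, ‖L x‖ = ‖x‖ := by
    intro x
    rw [norm_eq_sqrt_re_inner (𝕜 := ℂ)]
    rfl
  have hiso : Isometry L := by
    refine Isometry.of_dist_eq fun x y => ?_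
    rw [dist_eq_norm, dist_eq_norm, ← hn, map_sub]
  exact (hiso.isUniformInducing.completeSpace_congr L.surjective).2 inferInstance

end Core

/-- `L²(ℝ⁺) ≃ 𝒯₂⁽ⁿ⁾`: the inverse of `f ↦ (-t)ⁿ f⁽ⁿ⁾`. -/
def toT2 (n : ℕ) : L2pos ≃ₗ[ℂ] T2 n :=
  LinearEquiv.ofBijective ((hardyProd 0 n).codRestrict (T2 n) fun g => mem_T2_iff.2 ⟨g, rfl⟩)
    ⟨fun g h hgh => hardyProd_injective 0 n (congrArg Subtype.val hgh), fun f => by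
      obtain ⟨g, hg⟩ := mem_T2_iff.1 f.2
      exact ⟨g, Subtype.ext hg⟩⟩

theorem coe_toT2 (n : ℕ) (g : L2pos) : (toT2 n g : L2pos) = hardyProd 0 n g := rfl

/-- `L²(ℝ⁺) ≃ H₂⁽ⁿ⁾`, as the composition of `toT2` with the Fourier transform. -/
def toHS (n : ℕ) : L2pos ≃ₗ[ℂ] HS n :=
  LinearEquiv.ofBijective
    { toFun := fun g => ⟨holFourier (hardyProd 0 n g), mem_HS_iff.2 ⟨g, rfl⟩⟩
      map_add' := fun g h => Subtype.ext (funext fun z => by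
        simp only [map_add]
        exact hF_add z.2)
      map_smul' := fun c g => Subtype.ext (funext fun z => by
        simp only [map_smul]
        exact hF_smul c _ _) }
    ⟨fun g h hgh => hardyProd_injective 0 n (hF_injective fun z hz =>
      congrFun (congrArg Subtype.val hgh) ⟨z, hz⟩), fun F => by
      obtain ⟨g, hg⟩ := mem_HS_iff.1 F.2
      exact ⟨g, Subtype.ext hg.symm⟩⟩

theorem coe_toHS (n : ℕ) (g : L2pos) : (toHS n g : ℍ → ℂ) = holFourier (hardyProd 0 n g) := rfl

theorem innerH2_eq {F G : ℂ → ℂ} {f g : L2pos} (hf : EqOn F (hF f) upperHalfPlaneSet)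
    (hg : EqOn G (hF g) upperHalfPlaneSet) : innerH2 F G = inner ℂ g f := by
  have : ∫ x : ℝ, bdry F x * conj (bdry G x) = ∫ x : ℝ, bd f x * conj (bd g x) := by
    refine integral_congr_ae ?_
    filter_upwards [bdry_hF_ae_eq f, bdry_hF_ae_eq g] with x h1 h2
    rw [bdry_congr hf, bdry_congr hg, h1, h2]
  rw [innerH2, this, integral_bd_mul_conj, inv_mul_cancel_left₀]
  exact_mod_cast two_pi_ne_zero

theorem hardySup_congr {F G : ℂ → ℂ} (h : EqOn F G upperHalfPlaneSet) :
    hardySup F = hardySup G := by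
  unfold hardySup
  refine iSup_congr fun y => iSup_congr fun hy => lintegral_congr fun x => ?_
  rw [h (mem_upper hy)]

theorem normH2_eq {F : ℂ → ℂ} {f : L2pos} (hf : EqOn F (hF f) upperHalfPlaneSet) :
    normH2 F = ‖f‖ := by
  rw [normH2, hardySup_congr hf, hardySup_hF, ENNReal.toReal_ofReal (by positivity),
    inv_mul_cancel_left₀ (by positivity), Real.sqrt_sq (norm_nonneg _)]

/-- The boundary function of `F ∈ H₂⁽ⁿ⁾` and its derivatives. -/
theorem boundary_of_mem_HS {n : ℕ} {F : ℍ → ℂ} (hFn : F ∈ HS n) {f : L2pos}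
    (hf : EqOn (zDeriv n F) (hF f) upperHalfPlaneSet) :
    (∀ᵐ x : ℝ, Tendsto (fun y : ℝ => (F ∘ ofComplex) (x + y * Complex.I)) (𝓝[>] 0)
        (𝓝 (bdry (F ∘ ofComplex) x))) ∧
      ∀ᵐ x : ℝ, (∀ k < n, DifferentiableAt ℝ (iteratedDeriv k (bdry (F ∘ ofComplex))) x) ∧
        (x : ℂ) ^ n * iteratedDeriv n (bdry (F ∘ ofComplex)) x = bd f x := by
  have hF' : ∀ k ≤ n, MemH2 (zDeriv k F) := hFn
  have hex : ∀ k, ∃ h : L2pos, k ≤ n → EqOn (zDeriv k F) (hF h) upperHalfPlaneSet := by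
    intro k
    by_cases hk : k ≤ n
    · obtain ⟨h, hh⟩ := (hF' k hk).exists_hF_eq
      exact ⟨h, fun _ => hh⟩
    · exact ⟨0, fun h' => absurd h' hk⟩
  choose h hh using hex
  have hd : DifferentiableOn ℂ (F ∘ ofComplex) upperHalfPlaneSet :=
    (hF' 0 n.zero_le).1.congr fun w _ => by simp [zDeriv]
  have h0 : EqOn (F ∘ ofComplex) (hF (h 0)) upperHalfPlaneSet := by
    have := hh 0 n.zero_le
    rwa [zDeriv_eq_zD, zD_zero] at this
  have hfn : h n = f := hF_injective fun z hz => by rw [← hf hz, hh n le_rfl hz]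
  refine ⟨?_, ?_⟩
  · filter_upwards [ae_tendsto_hF (h 0), bdry_hF_ae_eq (h 0)] with x h1 h2
    rw [bdry_congr h0, h2]
    exact tendsto_congr_upper h0 h1
  · rw [← hfn]
    exact ae_iteratedDeriv_bdry hd hh

theorem innerHS_eq {n : ℕ} {F G : ℍ → ℂ} (hFn : F ∈ HS n) (hGn : G ∈ HS n) {f g : L2pos}
    (hf : EqOn (zDeriv n F) (hF f) upperHalfPlaneSet)
    (hg : EqOn (zDeriv n G) (hF g) upperHalfPlaneSet) : innerHS n F G = inner ℂ g f := by
  have : ∫ x : ℝ, (x : ℂ) ^ (2 * n) * iteratedDeriv n (bdry (F ∘ ofComplex)) x *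
      conj (iteratedDeriv n (bdry (G ∘ ofComplex)) x) = ∫ x : ℝ, bd f x * conj (bd g x) := by
    refine integral_congr_ae ?_
    filter_upwards [(boundary_of_mem_HS hFn hf).2, (boundary_of_mem_HS hGn hg).2] with x h1 h2
    rw [← h1.2, ← h2.2]
    simp only [map_mul, map_pow, Complex.conj_ofReal]
    ring
  rw [innerHS, this, integral_bd_mul_conj, inv_mul_cancel_left₀]
  exact_mod_cast two_pi_ne_zero

end PaleyWiener

end

theorem theorem3p3 (n : ℕ) :
    -- `W⁻ⁿ` maps `L²(tⁿ)` into `L²(ℝ⁺)`, and `f = W⁻ⁿ φ` has a.e. an `n`-th derivative,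
    -- which lies in `L²(tⁿ)`; so the inner product of `𝒯₂⁽ⁿ⁾` is given by a convergent integral
    (∀ φ : ℝ → ℂ, MemL2t n φ →
      MemLp (Wneg n φ) 2 posMeasure ∧
      (∀ᵐ t ∂posMeasure, ∀ k < n, DifferentiableAt ℝ (iteratedDeriv k (Wneg n φ)) t) ∧
      MemL2t n (iteratedDeriv n (Wneg n φ))) ∧
    -- `𝓕(𝒯₂⁽ⁿ⁾) = H₂⁽ⁿ⁾`
    (fun f : Lp ℂ 2 posMeasure => holFourier f) '' (T2 n : Set (Lp ℂ 2 posMeasure)) =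
      (HS n : Set (ℍ → ℂ)) ∧
    -- for `F ∈ H₂⁽ⁿ⁾`, the boundary function `F*` and its `n`-th derivative exist a.e.,
    -- `xⁿ (F*)⁽ⁿ⁾` is the boundary function of `zⁿ F⁽ⁿ⁾`, and it is square-integrable
    (∀ F ∈ HS n,
      (∀ᵐ x : ℝ, Tendsto (fun y : ℝ => (F ∘ ofComplex) (x + y * Complex.I)) (𝓝[>] 0)
        (𝓝 (bdry (F ∘ ofComplex) x))) ∧
      (∀ᵐ x : ℝ, ∀ k < n, DifferentiableAt ℝ (iteratedDeriv k (bdry (F ∘ ofComplex))) x) ∧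
      (∀ᵐ x : ℝ, Tendsto (fun y : ℝ => zDeriv n F (x + y * Complex.I)) (𝓝[>] 0)
        (𝓝 ((x : ℂ) ^ n * iteratedDeriv n (bdry (F ∘ ofComplex)) x))) ∧
      MemLp (fun x : ℝ => (x : ℂ) ^ n * iteratedDeriv n (bdry (F ∘ ofComplex)) x) 2 volume) ∧
    -- the two Hilbert spaces (Mathlib's `inner` is conjugate-linear in its first argument)
    ∃ (cT : InnerProductSpace.Core ℂ (T2 n)) (cH : InnerProductSpace.Core ℂ (HS n)),
      (∀ (f g : T2 n) (φ ψ : ℝ → ℂ), MemL2t n φ → MemL2t n ψ →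
        (f : Lp ℂ 2 posMeasure) =ᵐ[posMeasure] Wneg n φ →
        (g : Lp ℂ 2 posMeasure) =ᵐ[posMeasure] Wneg n ψ →
        cT.inner g f = innerT n (Wneg n φ) (Wneg n ψ)) ∧
      @CompleteSpace (T2 n) cT.toNormedAddCommGroup.toMetricSpace.toUniformSpace ∧
      (∀ F G : HS n, cH.inner G F = innerHS n F G ∧
        cH.inner G F = innerH2 (zDeriv n F) (zDeriv n G)) ∧
      (∀ F : HS n, √(cH.inner F F).re = normH2 (zDeriv n F)) ∧
      @CompleteSpace (HS n) cH.toNormedAddCommGroup.toMetricSpace.toUniformSpace ∧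
      -- `𝓕` is an isometric isomorphism of `𝒯₂⁽ⁿ⁾` onto `H₂⁽ⁿ⁾`
      ∃ e : T2 n ≃ₗ[ℂ] HS n,
        (∀ f : T2 n, (e f : ℍ → ℂ) = holFourier (f : Lp ℂ 2 posMeasure)) ∧
        ∀ f g : T2 n, cH.inner (e f) (e g) = cT.inner f g := by
  have hzD : ∀ F : HS n, EqOn (zDeriv n F) (hF (cayleyProd n ((toHS n).symm F)))
      upperHalfPlaneSet := by
    intro F
    have := zDeriv_holFourier n ((toHS n).symm F)
    rwa [← coe_toHS, LinearEquiv.apply_symm_apply] at this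
  have hT : ∀ (f : T2 n) (φ : ℝ → ℂ), MemL2t n φ →
      (f : L2pos) =ᵐ[posMeasure] Wneg n φ →
      ((toT2 n).symm f : L2pos) =ᵐ[posMeasure] fun t : ℝ => (t : ℂ) ^ n * φ t := by
    intro f φ hφ hf
    have h1 : f = toT2 n (MemLp.toLp _ hφ) :=
      Subtype.ext (Lp.ext (hf.trans (Wneg_ae_eq hφ (MemLp.coeFn_toLp hφ))))
    rw [h1, LinearEquiv.symm_apply_apply]
    exact MemLp.coeFn_toLp hφ
  refine ⟨fun φ hφ => ⟨?_, ?_, ?_⟩, ?_, fun F hFn => ⟨?_, ?_, ?_, ?_⟩,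
    coreOfEquiv (toT2 n).symm, coreOfEquiv (toHS n).symm, ?_, completeSpace_coreOfEquiv _, ?_, ?_,
    completeSpace_coreOfEquiv _, (toT2 n).symm.trans (toHS n), ?_, ?_⟩
  · exact (Lp.memLp _).ae_eq (Wneg_ae_eq hφ (MemLp.coeFn_toLp hφ)).symm
  · exact (iteratedDeriv_Wneg hφ).mono fun t ht => ht.1
  · refine (MemLp.const_mul hφ ((-1) ^ n)).ae_eq ?_
    filter_upwards [iteratedDeriv_Wneg hφ] with t ht
    rw [ht.2]
    ring
  · ext F
    rw [SetLike.mem_coe, mem_HS_iff]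
    constructor
    · rintro ⟨f, hf, rfl⟩
      obtain ⟨g, rfl⟩ := mem_T2_iff.1 hf
      exact ⟨g, rfl⟩
    · rintro ⟨g, rfl⟩
      exact ⟨_, mem_T2_iff.2 ⟨g, rfl⟩, rfl⟩
  · exact (boundary_of_mem_HS hFn (hzD ⟨F, hFn⟩)).1
  · exact (boundary_of_mem_HS hFn (hzD ⟨F, hFn⟩)).2.mono fun x hx => hx.1
  · filter_upwards [(boundary_of_mem_HS hFn (hzD ⟨F, hFn⟩)).2, ae_tendsto_hF _] with x h1 h2
    rw [h1.2]
    exact tendsto_congr_upper (hzD ⟨F, hFn⟩) h2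
  · exact (memLp_bd _).ae_eq
      ((boundary_of_mem_HS hFn (hzD ⟨F, hFn⟩)).2.mono fun x hx => hx.2.symm)
  · intro f g φ ψ hφ hψ hf hg
    exact (innerT_Wneg hφ hψ (hT f φ hφ hf) (hT g ψ hψ hg)).symm
  · intro F G
    refine ⟨?_, ?_⟩
    · rw [innerHS_eq F.2 G.2 (hzD F) (hzD G), inner_cayleyProd]
      rfl
    · rw [innerH2_eq (hzD F) (hzD G), inner_cayleyProd]
      rfl
  · intro F
    rw [normH2_eq (hzD F), norm_cayleyProd]
    exact (norm_eq_sqrt_re_inner (𝕜 := ℂ) ((toHS n).symm F)).symm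
  · intro f
    rw [LinearEquiv.trans_apply, coe_toHS, ← coe_toT2, LinearEquiv.apply_symm_apply]
  · intro f g
    change inner ℂ ((toHS n).symm (toHS n ((toT2 n).symm f)))
      ((toHS n).symm (toHS n ((toT2 n).symm g))) = inner ℂ ((toT2 n).symm f) ((toT2 n).symm g)
    rw [LinearEquiv.symm_apply_apply, LinearEquiv.symm_apply_apply]
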